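/- Let $n\ge 4$ and $3\le k\le n-1$. For $\rho\in(0,1]$ and $z$ in the $k$-positive cone $\Gamma=\{z\in\mathbb{R}^n : z_{i_1}+\dots+z_{i_k}>0 \text{ for all } i_1<\dots<i_k\}$ put \[ \gamma_{k,\rho}(z)=\Big(\sum_{1\le i_1<\dots<i_k\le n}\frac{\rho}{z_{i_1}+\dots+z_{i_k}}+\frac{1-\rho}{z_1+\dots+z_n}\Big)^{-1}. \] Through eigenvalues, $\gamma_{k,\rho}$ is also regarded as a function of symmetric $n\times n$ matrices with eigenvalues in $\Gamma$, and $\dot\gamma_{k,\rho}^{pq}$ denotes its derivative: $\frac{d}{ds}\big|_{s=0}\gamma_{k,\rho}(Z+sB)=\dot\gamma_{k,\rho}^{pq}(Z)B_{pq}$ for symmetric $B$ (repeated indices are summed). Let $M$ be a nonempty compact smooth $n$-manifold without boundary and let $F:M\times[0,T)\to\mathbb{R}^{n+1}$ be a smooth one-parameter family of immersions with smooth unit normal $\nu$, second fundamental form $A_{pq}=-\langle\partial_p\partial_qF,\nu\rangle$ and principal curvatures $\lambda_1\le\dots\le\lambda_n$. Suppose that the family is strictly $k$-convex, i.e. $\lambda=(\lambda_1,\dots,\lambda_n)\in\Gamma$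 on $M\times[0,T)$, and that \[ \partial_tF=-G_\rho\,\nu,\qquad G_\rho:=\gamma_{k,\rho}(\lambda). \] Write $H=\lambda_1+\dots+\lambda_n$, $G_1=\gamma_{k,1}(\lambda)$, $M_t=F(M,t)$. Then: 1. $t\mapsto\max_{M_t}H/G_\rho$ is nonincreasing on $[0,T)$; in particular $\max_{M_t}H/G_\rho\le\max_{M_0}H/G_\rho$. 2. There is a constant $\bar\alpha$, depending only on $n$, $k$ and $M_0$ (not on $\rho$, $T$ or $F$), such that $H/G_1\le\bar\alpha$ on $M\times[0,T)$. 3. (Uniform $k$-convexity.) $H>0$, and there is a constant $c>0$ depending only on $n$, $k$ and $\bar\alpha$ such that $(\lambda_1+\dots+\lambda_k)/H\ge c$ on $M\times[0,T)$. 4. (Uniform parabolicity.) There is a constant $C>0$ depending only on $n$, $k$ and $\bar\alpha$ such that, at every point of $M\times[0,T)$ and with respect to every orthonormal basis of the tangent space, $\dot\gamma_{k,\rho}^{pq}(A)$ exists and \[ C^{-1}|\xi|^2\le\dot\gamma_{k,\rho}^{pq}(A)\,\xi_p\xi_q\le C|\xi|^2\qquad\text{for all }\xi\in\mathbb{R}^n.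 \] -/

import Mathlib

open Set Filter Topology
open scoped Manifold ContDiff

noncomputable section

/-! ### Symmetric functions of eigenvalues -/

/-- The `k`-positive cone in `ℝⁿ`: all sums of `k` distinct components are positive. -/
def kPositiveCone (n k : ℕ) : Set (Fin n → ℝ) :=
  {z | ∀ s : Finset (Fin n), s.card = k → 0 < ∑ i ∈ s, z i}

/-- The speed function
`γ_{k,ρ}(z) = (∑_{i₁ < ⋯ < i_k} ρ / (z_{i₁} + ⋯ + z_{i_k}) + (1 - ρ) / (z₁ + ⋯ + z_n))⁻¹`. -/
def gammaSpeed {n : ℕ} (k : ℕ) (ρ : ℝ) (z : Fin n → ℝ) : ℝ :=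
  (∑ s ∈ Finset.powersetCard k (Finset.univ : Finset (Fin n)), ρ / ∑ i ∈ s, z i
    + (1 - ρ) / ∑ i, z i)⁻¹

/-- The real eigenvalues of a square matrix (roots of the characteristic polynomial, repeated
according to multiplicity), in nondecreasing order. For the matrices used below (symmetric
matrices, and products of the inverse of a metric with a symmetric matrix) there are exactly `n`
of them, and the default value `0` is not used. -/
def sortedEigenvalues {n : ℕ} (W : Matrix (Fin n) (Fin n) ℝ) : Fin n → ℝ :=
  fun i => (W.charpoly.roots.sort (· ≤ ·)).getD i 0

/-- `γ_{k,ρ}` as a function of symmetric matrices, through the eigenvalues. -/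
def gammaMatrix {n : ℕ} (k : ℕ) (ρ : ℝ) (Z : Matrix (Fin n) (Fin n) ℝ) : ℝ :=
  gammaSpeed k ρ (sortedEigenvalues Z)

/-- The symmetric matrix `D = (D^{pq})` represents the derivative at `Z` of a function `φ` of
symmetric matrices: `d/ds φ(Z + s B)` at `s = 0` equals `D^{pq} B_{pq}` for all symmetric `B`. -/
def IsSymmDerivative {n : ℕ} (φ : Matrix (Fin n) (Fin n) ℝ → ℝ)
    (Z D : Matrix (Fin n) (Fin n) ℝ) : Prop :=
  D.IsSymm ∧ ∀ B : Matrix (Fin n) (Fin n) ℝ, B.IsSymm →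
    HasDerivAt (fun s : ℝ => φ (Z + s • B)) (∑ p, ∑ q, D p q * B p q) 0

/-! ### Geometry of an immersed hypersurface `f : M → ℝⁿ⁺¹` with unit normal `ν` -/

section Geometry

variable {n : ℕ} {M : Type*} [TopologicalSpace M] [ChartedSpace (EuclideanSpace ℝ (Fin n)) M]

/-- The first partial derivative `∂f/∂x^p` in the preferred chart at `x₀`, as a function of the
coordinates `y`. -/
def coordPartial (f : M → EuclideanSpace ℝ (Fin (n + 1))) (x₀ : M) (p : Fin n)
    (y : EuclideanSpace ℝ (Fin n)) : EuclideanSpace ℝ (Fin (n + 1)) :=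
  fderiv ℝ (f ∘ (extChartAt (𝓡 n) x₀).symm) y (EuclideanSpace.single p 1)

/-- The second partial derivative `∂²f/∂x^p∂x^q` at `x` in the preferred chart at `x`. -/
def coordPartial₂ (f : M → EuclideanSpace ℝ (Fin (n + 1))) (x : M) (p q : Fin n) :
    EuclideanSpace ℝ (Fin (n + 1)) :=
  fderiv ℝ (coordPartial f x q) (extChartAt (𝓡 n) x x) (EuclideanSpace.single p 1)

/-- The induced metric `g_{pq} = ⟨∂_p f, ∂_q f⟩` at `x`. -/
def inducedMetric (f : M → EuclideanSpace ℝ (Fin (n + 1))) (x : M) :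
    Matrix (Fin n) (Fin n) ℝ :=
  Matrix.of fun p q => inner ℝ (coordPartial f x p (extChartAt (𝓡 n) x x))
    (coordPartial f x q (extChartAt (𝓡 n) x x))

/-- The second fundamental form `A_{pq} = -⟨∂_p ∂_q f, ν⟩` at `x`. -/
def secondFundamentalForm (f ν : M → EuclideanSpace ℝ (Fin (n + 1))) (x : M) :
    Matrix (Fin n) (Fin n) ℝ :=
  Matrix.of fun p q => -inner ℝ (coordPartial₂ f x p q) (ν x)

/-- The principal curvatures `λ₁ ≤ ⋯ ≤ λ_n`: the eigenvalues of the Weingarten map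
`A^p_q = g^{pr} A_{rq}`. -/
def principalCurvatures (f ν : M → EuclideanSpace ℝ (Fin (n + 1))) (x : M) : Fin n → ℝ :=
  sortedEigenvalues ((inducedMetric f x)⁻¹ * secondFundamentalForm f ν x)

/-- The mean curvature `H = λ₁ + ⋯ + λ_n`. -/
def meanCurvature (f ν : M → EuclideanSpace ℝ (Fin (n + 1))) (x : M) : ℝ :=
  ∑ i, principalCurvatures f ν x i

/-- The speed `G_{k,ρ} = γ_{k,ρ}(λ)`. -/
def speed (k : ℕ) (ρ : ℝ) (f ν : M → EuclideanSpace ℝ (Fin (n + 1))) (x : M) : ℝ :=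
  gammaSpeed k ρ (principalCurvatures f ν x)

/-- `Z` is the matrix of the second fundamental form at `x` with respect to some basis of the
tangent space that is orthonormal for the induced metric; the columns of `e` are the coordinates
of the basis vectors. -/
def IsFrameSecondFundamentalForm (f ν : M → EuclideanSpace ℝ (Fin (n + 1))) (x : M)
    (Z : Matrix (Fin n) (Fin n) ℝ) : Prop :=
  ∃ e : Matrix (Fin n) (Fin n) ℝ,
    e.transpose * inducedMetric f x * e = 1 ∧ Z = e.transpose * secondFundamentalForm f ν x * e

/-- A smooth family `F t : M → ℝⁿ⁺¹`, `t ∈ [0, T)`, of strictly `k`-convex immersed hypersurfaces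
with smooth unit normals `ν t`, evolving by `∂_t F = -G_{k,ρ} ν`. -/
structure IsGammaFlow (k : ℕ) (ρ T : ℝ) (F ν : ℝ → M → EuclideanSpace ℝ (Fin (n + 1))) :
    Prop where
  smooth : ContMDiffOn ((𝓡 n).prod 𝓘(ℝ, ℝ)) (𝓡 (n + 1)) ∞
    (fun p : M × ℝ => F p.2 p.1) (univ ×ˢ Ico 0 T)
  smooth_normal : ContMDiffOn ((𝓡 n).prod 𝓘(ℝ, ℝ)) (𝓡 (n + 1)) ∞
    (fun p : M × ℝ => ν p.2 p.1) (univ ×ˢ Ico 0 T)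
  immersion : ∀ t ∈ Ico 0 T, ∀ x : M,
    Function.Injective (mfderiv (𝓡 n) (𝓡 (n + 1)) (F t) x)
  norm_normal : ∀ t ∈ Ico 0 T, ∀ x : M, ‖ν t x‖ = 1
  normal_orthogonal : ∀ t ∈ Ico 0 T, ∀ (x : M) (v : TangentSpace (𝓡 n) x),
    inner (E := EuclideanSpace ℝ (Fin (n + 1))) ℝ
      (mfderiv (𝓡 n) (𝓡 (n + 1)) (F t) x v) (ν t x) = 0
  k_convex : ∀ t ∈ Ico 0 T, ∀ x : M, principalCurvatures (F t) (ν t) x ∈ kPositiveCone n k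
  evolution : ∀ t ∈ Ico 0 T, ∀ x : M,
    HasDerivWithinAt (fun s => F s x) (-(speed k ρ (F t) (ν t) x) • ν t x) (Ico 0 T) t

end Geometry

end

/-!
The heart of the matter is the monotonicity of `max H / G`, a maximum principle for the flow
`∂_t F = -G ν`. At a point, with `A` diagonal and `γ̇_i = ∂γ/∂λ_i`,
`∂_t H = ΔG + |A|² G` and `∂_t G = ∑ γ̇_i ∇_i ∇_i G + G ∑ γ̇_i λ_i²`.
Let `m` be the maximum of `H / G` at a fixed positive time and look at a point where it is attained.
It suffices to show there that `∂_t H ≤ m ∂_t G` (`simons_inequality`).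

The function `γ_{k,ρ}` is one-homogeneous and concave, so `G ≤ ∑ γ̇_i A_ii` near the point, with the
`γ̇_i` frozen at the point and equality there; hence `∇_j ∇_j G ≤ ∑_i γ̇_i ∇_j ∇_j A_ii`. Likewise
`H - m G ≤ 0` with equality at the point, so `∑_i ∇_j ∇_j A_ii ≤ m ∇_j ∇_j G`. Summing the first
inequality over `j` and the second with weights `γ̇_j > 0`, and commuting derivatives by
`∇_j ∇_j A_ii - ∇_i ∇_i A_jj = λ_i λ_j (λ_i - λ_j)`, gives exactly the claim, since `∑ γ̇_i λ_i = G`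
and `H = m G`. No covariant derivatives are needed for this: the hypersurface is written as a graph
over its tangent space at the point, the shape operator is conjugated to the symmetric matrix
`graphShape` of the gradient and Hessian of the height function, and the formula for the
commutator becomes the symmetry of fourth derivatives together with a second-order expansion of
`graphShape` (`hasJet_graphShape`, `simons_algebra`).

Concavity of `γ` as a function of matrices (`gammaMatrix_le`) follows from that of `γ` as a function
of eigenvalues, the Cauchy-Schwarz inequality, through the theorems of Schur and Birkhoff. For its
derivative (`hasDerivAt_gammaMatrix`), `γ` is a rational function of the matrix entries, because
symmetric polynomials of the eigenvalues are polynomials in the coefficients of the characteristic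
polynomial; the derivative then is determined by the linearization that touches `γ` from above.

The remaining claims are algebra. Since `H / G_ρ = ρ H / G_1 + (1 - ρ)`, the bound for `H / G_ρ`
passes to `H / G_1`, with the constant `max H / G_1` of the initial hypersurface. As
`H / G_1 = ∑ H / (λ_{i₁} + ⋯ + λ_{i_k})` has positive terms, each of them is bounded, which is uniform
`k`-convexity; and with all the partial sums comparable to `H`, the explicit formula for `γ̇_i` bounds
it from both sides (`gammaGrad_bounds`).
-/

noncomputable section

/-! ### The speed function on the `k`-positive cone -/

/-- The gradient of `γ_{k,ρ}` on the `k`-positive cone,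
`∂γ/∂z_i = γ² (∑_{s ∋ i} ρ / σ_s² + (1 - ρ) / H²)` with `σ_s = ∑_{j ∈ s} z_j`, `H = ∑_j z_j`. -/
def gammaGrad {n : ℕ} (k : ℕ) (ρ : ℝ) (z : Fin n → ℝ) (i : Fin n) : ℝ :=
  gammaSpeed k ρ z ^ 2 *
    (∑ s ∈ Finset.powersetCard k (Finset.univ : Finset (Fin n)) with i ∈ s,
      ρ / (∑ j ∈ s, z j) ^ 2 + (1 - ρ) / (∑ j, z j) ^ 2)

section Cone

variable {n k : ℕ} {ρ : ℝ} {z w : Fin n → ℝ}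

lemma sum_pos_of_mem_powersetCard (hz : z ∈ kPositiveCone n k) {s : Finset (Fin n)}
    (hs : s ∈ Finset.powersetCard k (Finset.univ : Finset (Fin n))) : 0 < ∑ i ∈ s, z i :=
  hz s (Finset.mem_powersetCard.1 hs).2

lemma card_powersetCard_filter_mem (k : ℕ) (hk : 1 ≤ k) (i : Fin n) :
    (Finset.filter (i ∈ ·) (Finset.powersetCard k (Finset.univ : Finset (Fin n)))).card
      = (n - 1).choose (k - 1) := by
  have h : Finset.filter (i ∈ ·) (Finset.powersetCard k (Finset.univ : Finset (Fin n)))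
      = (Finset.powersetCard (k - 1) (Finset.univ.erase i)).image (insert i) := by
    ext s
    simp only [Finset.mem_filter, Finset.mem_powersetCard, Finset.mem_image, Finset.subset_univ,
      true_and]
    constructor
    · rintro ⟨hs, hi⟩
      refine ⟨s.erase i, ⟨Finset.erase_subset_erase _ (Finset.subset_univ _), ?_⟩,
        Finset.insert_erase hi⟩
      rw [Finset.card_erase_of_mem hi, hs]
    · rintro ⟨t, ⟨ht, hc⟩, rfl⟩
      have hit : i ∉ t := fun h => Finset.notMem_erase i _ (ht h)
      refine ⟨?_, Finset.mem_insert_self _ _⟩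
      rw [Finset.card_insert_of_notMem hit, hc]; omega
  rw [h, Finset.card_image_of_injOn, Finset.card_powersetCard,
    Finset.card_erase_of_mem (Finset.mem_univ _), Finset.card_univ, Fintype.card_fin]
  intro t ht t' ht' e
  have hit : i ∉ t := fun h => Finset.notMem_erase i _ ((Finset.mem_powersetCard.1 ht).1 h)
  have hit' : i ∉ t' := fun h => Finset.notMem_erase i _ ((Finset.mem_powersetCard.1 ht').1 h)
  have := congrArg (fun u => u.erase i) e
  simpa [Finset.erase_insert hit, Finset.erase_insert hit'] using this

/-- Double counting: interchange of a sum over `k`-subsets with a sum over their elements. -/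
lemma sum_powersetCard_sum_mul (c : Finset (Fin n) → ℝ) (z : Fin n → ℝ) :
    ∑ s ∈ Finset.powersetCard k (Finset.univ : Finset (Fin n)), c s * ∑ i ∈ s, z i
      = ∑ i, (∑ s ∈ Finset.powersetCard k (Finset.univ : Finset (Fin n)) with i ∈ s, c s)
          * z i := by
  simp_rw [Finset.sum_filter, Finset.sum_mul, Finset.mul_sum]
  rw [Finset.sum_comm]
  refine Finset.sum_congr rfl fun s _ => ?_
  rw [← Finset.sum_filter_add_sum_filter_not Finset.univ (· ∈ s) (fun i => _ * z i)]
  rw [Finset.sum_congr rfl (g := fun i => c s * z i) (s₁ := Finset.univ.filter (· ∈ s)),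
    Finset.sum_eq_zero (s := Finset.univ.filter fun i => i ∉ s), add_zero]
  · simp
  · intro i hi; simp [(Finset.mem_filter.1 hi).2]
  · intro i hi; simp [(Finset.mem_filter.1 hi).2]

lemma sum_powersetCard_sum (hk : 1 ≤ k) (z : Fin n → ℝ) :
    ∑ s ∈ Finset.powersetCard k (Finset.univ : Finset (Fin n)), ∑ i ∈ s, z i
      = ((n - 1).choose (k - 1) : ℝ) * ∑ i, z i := by
  have := sum_powersetCard_sum_mul (k := k) (fun _ => 1) z
  simp only [one_mul, Finset.sum_const, card_powersetCard_filter_mem k hk, nsmul_eq_mul,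
    mul_one] at this
  rw [this, Finset.mul_sum]

lemma powersetCard_univ_nonempty (hkn : k ≤ n) :
    (Finset.powersetCard k (Finset.univ : Finset (Fin n))).Nonempty := by
  rw [Finset.powersetCard_nonempty]; simpa using hkn

lemma choose_pred_pos (hk : 1 ≤ k) (hkn : k ≤ n) : (0 : ℝ) < ((n - 1).choose (k - 1) : ℝ) := by
  exact_mod_cast Nat.choose_pos (by omega)

lemma sum_pos_of_mem_cone (hk : 1 ≤ k) (hkn : k ≤ n) (hz : z ∈ kPositiveCone n k) :
    0 < ∑ i, z i := by
  have h := Finset.sum_pos (fun s hs => sum_pos_of_mem_powersetCard hz hs)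
    (powersetCard_univ_nonempty hkn)
  rw [sum_powersetCard_sum hk] at h
  exact (mul_pos_iff_of_pos_left (choose_pred_pos hk hkn)).1 h

lemma partial_sum_le (hk : 1 ≤ k) (hz : z ∈ kPositiveCone n k) {s : Finset (Fin n)}
    (hs : s ∈ Finset.powersetCard k (Finset.univ : Finset (Fin n))) :
    ∑ i ∈ s, z i ≤ ((n - 1).choose (k - 1) : ℝ) * ∑ i, z i := by
  rw [← sum_powersetCard_sum hk]
  exact Finset.single_le_sum (f := fun s => ∑ i ∈ s, z i)
    (fun t ht => (sum_pos_of_mem_powersetCard hz ht).le) hs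

lemma gammaSpeed_denom_pos (hk : 1 ≤ k) (hkn : k ≤ n) (hρ : ρ ∈ Ioc (0 : ℝ) 1)
    (hz : z ∈ kPositiveCone n k) :
    0 < ∑ s ∈ Finset.powersetCard k (Finset.univ : Finset (Fin n)), ρ / ∑ i ∈ s, z i
      + (1 - ρ) / ∑ i, z i := by
  have h := Finset.sum_pos (fun s hs => div_pos hρ.1 (sum_pos_of_mem_powersetCard hz hs))
    (powersetCard_univ_nonempty hkn)
  have h2 : 0 ≤ (1 - ρ) / ∑ i, z i :=
    div_nonneg (by linarith [hρ.2]) (sum_pos_of_mem_cone hk hkn hz).le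
  linarith

lemma gammaSpeed_pos (hk : 1 ≤ k) (hkn : k ≤ n) (hρ : ρ ∈ Ioc (0 : ℝ) 1)
    (hz : z ∈ kPositiveCone n k) : 0 < gammaSpeed k ρ z :=
  inv_pos.2 (gammaSpeed_denom_pos hk hkn hρ hz)

lemma sum_gammaGrad_mul (z w : Fin n → ℝ) :
    ∑ i, gammaGrad k ρ z i * w i = gammaSpeed k ρ z ^ 2 *
      (∑ s ∈ Finset.powersetCard k (Finset.univ : Finset (Fin n)),
        ρ / (∑ j ∈ s, z j) ^ 2 * ∑ j ∈ s, w j + (1 - ρ) / (∑ j, z j) ^ 2 * ∑ j, w j) := by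
  rw [sum_powersetCard_sum_mul (fun s => ρ / (∑ j ∈ s, z j) ^ 2), Finset.mul_sum,
    ← Finset.sum_add_distrib, Finset.mul_sum]
  refine Finset.sum_congr rfl fun i _ => ?_
  rw [gammaGrad]; ring

/-- Euler's relation for the one-homogeneous function `γ_{k,ρ}`. -/
lemma sum_gammaGrad_mul_self (hk : 1 ≤ k) (hkn : k ≤ n) (hρ : ρ ∈ Ioc (0 : ℝ) 1)
    (hz : z ∈ kPositiveCone n k) : ∑ i, gammaGrad k ρ z i * z i = gammaSpeed k ρ z := by
  rw [sum_gammaGrad_mul]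
  have h1 : ∑ s ∈ Finset.powersetCard k (Finset.univ : Finset (Fin n)),
      ρ / (∑ j ∈ s, z j) ^ 2 * ∑ j ∈ s, z j
      = ∑ s ∈ Finset.powersetCard k (Finset.univ : Finset (Fin n)), ρ / ∑ j ∈ s, z j := by
    refine Finset.sum_congr rfl fun s hs => ?_
    have := (sum_pos_of_mem_powersetCard hz hs).ne'
    field_simp
  have h2 : (1 - ρ) / (∑ j, z j) ^ 2 * ∑ j, z j = (1 - ρ) / ∑ j, z j := by
    have := (sum_pos_of_mem_cone hk hkn hz).ne'
    field_simp
  rw [h1, h2, gammaSpeed]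
  have := (gammaSpeed_denom_pos hk hkn hρ hz).ne'
  field_simp

/-- A concave one-homogeneous function lies below its linearizations. For `γ_{k,ρ}`, a weighted
harmonic mean of partial sums, this is the Cauchy-Schwarz inequality. -/
lemma gammaSpeed_le_sum_gammaGrad_mul (hk : 1 ≤ k) (hkn : k ≤ n) (hρ : ρ ∈ Ioc (0 : ℝ) 1)
    (hz : z ∈ kPositiveCone n k) (hw : w ∈ kPositiveCone n k) :
    gammaSpeed k ρ w ≤ ∑ i, gammaGrad k ρ z i * w i := by
  rw [sum_gammaGrad_mul]
  set P := Finset.powersetCard k (Finset.univ : Finset (Fin n))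
  -- the full sum enters like one more partial sum, indexed by `none`
  let Q : Finset (Option (Finset (Fin n))) := P.insertNone
  let c : Option (Finset (Fin n)) → ℝ := fun o => o.elim (1 - ρ) (fun _ => ρ)
  let Y : Option (Finset (Fin n)) → ℝ := fun o => o.elim (∑ j, z j) (fun s => ∑ j ∈ s, z j)
  let X : Option (Finset (Fin n)) → ℝ := fun o => o.elim (∑ j, w j) (fun s => ∑ j ∈ s, w j)
  have hc : ∀ o ∈ Q, 0 ≤ c o := by
    rintro (_ | s) _
    · simpa [c] using hρ.2
    · simpa [c] using hρ.1.le
  have hY : ∀ o ∈ Q, 0 < Y o := by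
    rintro (_ | s) ho
    · exact sum_pos_of_mem_cone hk hkn hz
    · exact sum_pos_of_mem_powersetCard hz (Finset.some_mem_insertNone.1 ho)
  have hX : ∀ o ∈ Q, 0 < X o := by
    rintro (_ | s) ho
    · exact sum_pos_of_mem_cone hk hkn hw
    · exact sum_pos_of_mem_powersetCard hw (Finset.some_mem_insertNone.1 ho)
  have cs := Finset.sum_mul_sq_le_sq_mul_sq Q (fun o => √(c o / X o))
    (fun o => √(c o * X o / Y o ^ 2))
  have e1 : ∑ o ∈ Q, √(c o / X o) * √(c o * X o / Y o ^ 2) = ∑ o ∈ Q, c o / Y o := by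
    refine Finset.sum_congr rfl fun o ho => ?_
    have hx := hX o ho
    have hy := hY o ho
    have hco := hc o ho
    rw [← Real.sqrt_mul (by positivity)]
    rw [show c o / X o * (c o * X o / Y o ^ 2) = (c o / Y o) ^ 2 by field_simp]
    exact Real.sqrt_sq (by positivity)
  have e2 : ∑ o ∈ Q, √(c o / X o) ^ 2 = ∑ o ∈ Q, c o / X o := by
    refine Finset.sum_congr rfl fun o ho => Real.sq_sqrt ?_
    exact div_nonneg (hc o ho) (hX o ho).le
  have e3 : ∑ o ∈ Q, √(c o * X o / Y o ^ 2) ^ 2 = ∑ o ∈ Q, c o * X o / Y o ^ 2 := by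
    refine Finset.sum_congr rfl fun o ho => Real.sq_sqrt ?_
    exact div_nonneg (mul_nonneg (hc o ho) (hX o ho).le) (sq_nonneg _)
  rw [e1, e2, e3] at cs
  have split : ∀ g : Option (Finset (Fin n)) → ℝ,
      ∑ o ∈ Q, g o = g none + ∑ s ∈ P, g (some s) := fun g => Finset.sum_insertNone g P
  have dz := gammaSpeed_denom_pos hk hkn hρ hz
  have dw := gammaSpeed_denom_pos hk hkn hρ hw
  have f1 : ∑ o ∈ Q, c o / Y o
      = ∑ s ∈ P, ρ / ∑ i ∈ s, z i + (1 - ρ) / ∑ i, z i := by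
    rw [split, add_comm]; rfl
  have f2 : ∑ o ∈ Q, c o / X o
      = ∑ s ∈ P, ρ / ∑ i ∈ s, w i + (1 - ρ) / ∑ i, w i := by
    rw [split, add_comm]; rfl
  have f3 : ∑ o ∈ Q, c o * X o / Y o ^ 2
      = ∑ s ∈ P, ρ / (∑ j ∈ s, z j) ^ 2 * ∑ j ∈ s, w j
        + (1 - ρ) / (∑ j, z j) ^ 2 * ∑ j, w j := by
    rw [split, add_comm]
    congr 1
    · refine Finset.sum_congr rfl fun s _ => ?_
      simp only [c, X, Y, Option.elim]; ring
    · simp only [c, X, Y, Option.elim]; ring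
  rw [f1, f2, f3] at cs
  unfold gammaSpeed
  set A := ∑ s ∈ P, ρ / ∑ i ∈ s, z i + (1 - ρ) / ∑ i, z i
  set B := ∑ s ∈ P, ρ / ∑ i ∈ s, w i + (1 - ρ) / ∑ i, w i
  rw [inv_pow, inv_mul_eq_div, le_div_iff₀ (by positivity), inv_mul_le_iff₀ dw]
  exact cs

lemma gammaGrad_pos (hk : 1 ≤ k) (hkn : k ≤ n) (hρ : ρ ∈ Ioc (0 : ℝ) 1)
    (hz : z ∈ kPositiveCone n k) (i : Fin n) : 0 < gammaGrad k ρ z i := by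
  have hne : (Finset.filter (i ∈ ·)
      (Finset.powersetCard k (Finset.univ : Finset (Fin n)))).Nonempty := by
    rw [← Finset.card_pos, card_powersetCard_filter_mem k hk]
    exact Nat.choose_pos (by omega)
  have h1 : 0 < ∑ s ∈ Finset.powersetCard k (Finset.univ : Finset (Fin n)) with i ∈ s,
      ρ / (∑ j ∈ s, z j) ^ 2 := by
    refine Finset.sum_pos (fun s hs => ?_) hne
    exact div_pos hρ.1 (pow_pos (sum_pos_of_mem_powersetCard hz (Finset.mem_filter.1 hs).1) 2)
  have h2 : 0 ≤ (1 - ρ) / (∑ j, z j) ^ 2 := div_nonneg (by linarith [hρ.2]) (sq_nonneg _)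
  exact mul_pos (pow_pos (gammaSpeed_pos hk hkn hρ hz) 2) (by linarith)

/-- A bound for `∂γ/∂z_i` and its inverse on the part of the `k`-positive cone where all partial
sums are at least `c H`. -/
def gradBound (n k : ℕ) (c : ℝ) : ℝ :=
  ((n.choose k : ℝ) / c ^ 2 + 1) + ((n.choose k : ℝ) / c + 1) ^ 2 * ((n - 1).choose (k - 1) : ℝ) ^ 2

lemma gradBound_pos (n k : ℕ) {c : ℝ} (hc : 0 < c) : 0 < gradBound n k c := by
  unfold gradBound; positivity

/-- Where all partial sums are comparable to `H`, so is `γ`, and every term in the formula for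
`∂γ/∂z_i` is of order one. The bounds are uniform in `ρ` because the coefficients `ρ` and `1 - ρ` add
up to one. -/
lemma gammaGrad_bounds (hk : 1 ≤ k) (hkn : k ≤ n) (hρ : ρ ∈ Ioc (0 : ℝ) 1)
    (hz : z ∈ kPositiveCone n k) {c : ℝ} (hc : 0 < c)
    (hcz : ∀ s : Finset (Fin n), s.card = k → c * ∑ i, z i ≤ ∑ i ∈ s, z i) (i : Fin n) :
    (gradBound n k c)⁻¹ ≤ gammaGrad k ρ z i ∧ gammaGrad k ρ z i ≤ gradBound n k c := by
  have hH := sum_pos_of_mem_cone hk hkn hz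
  have hρ0 := hρ.1
  have hρ1 : 0 ≤ 1 - ρ := by linarith [hρ.2]
  set H := ∑ i, z i with hHdef
  set N : ℝ := (n.choose k : ℝ)
  set B : ℝ := ((n - 1).choose (k - 1) : ℝ)
  set P := Finset.powersetCard k (Finset.univ : Finset (Fin n))
  have hN : (P.card : ℝ) = N := by simp [P, N, Finset.card_powersetCard]
  have hB : 0 < B := choose_pred_pos hk hkn
  have hB1 : 1 ≤ B := by
    have : 0 < (n - 1).choose (k - 1) := Nat.choose_pos (by omega)
    exact Nat.one_le_cast.2 this
  have hN0 : 0 ≤ N := Nat.cast_nonneg _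
  have hlow : ∀ s ∈ P, c * H ≤ ∑ j ∈ s, z j := fun s hs => hcz s (Finset.mem_powersetCard.1 hs).2
  have hup : ∀ s ∈ P, ∑ j ∈ s, z j ≤ B * H := fun s hs => partial_sum_le hk hz hs
  have hcH : 0 < c * H := mul_pos hc hH
  have hg := gammaSpeed_pos hk hkn hρ hz
  have hd := gammaSpeed_denom_pos hk hkn hρ hz
  -- `γ ≤ H`, since `∑_s ρ / σ_s ≥ ρ / H` by double counting
  have hgH : gammaSpeed k ρ z ≤ H := by
    rw [gammaSpeed, inv_le_comm₀ hd hH]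
    have h1 : ρ / H ≤ ∑ s ∈ P, ρ / ∑ i ∈ s, z i := by
      have cs := Finset.sq_sum_div_le_sum_sq_div P (fun _ => (1 : ℝ))
        (g := fun s => ∑ i ∈ s, z i) (fun s hs => sum_pos_of_mem_powersetCard hz hs)
      rw [sum_powersetCard_sum hk] at cs
      simp only [Finset.sum_const, nsmul_eq_mul, mul_one, one_pow, hN] at cs
      have hNB : B ≤ N := by
        have : (n - 1).choose (k - 1) ≤ n.choose k := by
          obtain ⟨m, rfl⟩ : ∃ m, n = m + 1 := ⟨n - 1, by omega⟩
          obtain ⟨j, rfl⟩ : ∃ j, k = j + 1 := ⟨k - 1, by omega⟩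
          rw [Nat.choose_succ_succ]; simp
        exact Nat.cast_le.2 this
      have h4 : 1 / H ≤ N ^ 2 / (B * H) := by
        rw [div_le_div_iff₀ hH (by positivity)]
        nlinarith [mul_le_mul hNB hNB hB.le hN0, mul_nonneg (sub_nonneg.2 hB1) hB.le]
      calc ρ / H = ρ * (1 / H) := by ring
        _ ≤ ρ * ∑ s ∈ P, 1 / ∑ i ∈ s, z i := mul_le_mul_of_nonneg_left (h4.trans cs) hρ0.le
        _ = _ := by rw [Finset.mul_sum]; exact Finset.sum_congr rfl fun s _ => by ring
    calc H⁻¹ = ρ / H + (1 - ρ) / H := by field_simp; ring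
      _ ≤ _ := by gcongr
  have hgL : H / (N / c + 1) ≤ gammaSpeed k ρ z := by
    rw [gammaSpeed, le_inv_comm₀ (by positivity) hd, inv_div]
    have h1 : ∑ s ∈ P, ρ / ∑ i ∈ s, z i ≤ N * (1 / (c * H)) := by
      rw [← hN, ← nsmul_eq_mul]
      refine Finset.sum_le_card_nsmul _ _ _ fun s hs => ?_
      exact div_le_div₀ zero_le_one hρ.2 hcH (hlow s hs)
    have h2 : (1 - ρ) / H ≤ 1 / H := by gcongr; linarith
    calc _ ≤ N * (1 / (c * H)) + 1 / H := add_le_add h1 h2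
      _ = _ := by field_simp
  have hS : ∑ s ∈ P with i ∈ s, ρ / (∑ j ∈ s, z j) ^ 2 ≤ N * (1 / (c * H) ^ 2) := by
    calc _ ≤ ∑ s ∈ P, ρ / (∑ j ∈ s, z j) ^ 2 :=
          Finset.sum_le_sum_of_subset_of_nonneg (Finset.filter_subset _ _)
            fun s _ _ => by positivity
      _ ≤ _ := by
          rw [← hN, ← nsmul_eq_mul]
          refine Finset.sum_le_card_nsmul _ _ _ fun s hs => ?_
          exact div_le_div₀ zero_le_one hρ.2 (by positivity)
            (pow_le_pow_left₀ hcH.le (hlow s hs) 2)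
  have hS' : ρ / (B * H) ^ 2 ≤ ∑ s ∈ P with i ∈ s, ρ / (∑ j ∈ s, z j) ^ 2 := by
    obtain ⟨s, hs⟩ : (Finset.filter (i ∈ ·) P).Nonempty := by
      rw [← Finset.card_pos, card_powersetCard_filter_mem k hk]
      exact Nat.choose_pos (by omega)
    have hsP := (Finset.mem_filter.1 hs).1
    refine le_trans ?_ (Finset.single_le_sum (f := fun s => ρ / (∑ j ∈ s, z j) ^ 2)
      (fun t _ => by positivity) hs)
    have := sum_pos_of_mem_powersetCard hz hsP
    exact div_le_div_of_nonneg_left hρ0.le (by positivity)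
      (pow_le_pow_left₀ this.le (hup s hsP) 2)
  have hupper : gammaGrad k ρ z i ≤ N / c ^ 2 + 1 := by
    have h2 : (1 - ρ) / H ^ 2 ≤ 1 / H ^ 2 := by gcongr; linarith
    calc gammaGrad k ρ z i ≤ H ^ 2 * (N * (1 / (c * H) ^ 2) + 1 / H ^ 2) := by
          unfold gammaGrad
          exact mul_le_mul (pow_le_pow_left₀ hg.le hgH 2) (add_le_add hS h2)
            (by positivity) (by positivity)
      _ = _ := by field_simp
  have hlower : ((N / c + 1) ^ 2 * B ^ 2)⁻¹ ≤ gammaGrad k ρ z i := by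
    have h2 : (1 - ρ) / (B * H) ^ 2 ≤ (1 - ρ) / H ^ 2 := by
      refine div_le_div_of_nonneg_left hρ1 (by positivity) (pow_le_pow_left₀ hH.le ?_ 2)
      nlinarith
    calc ((N / c + 1) ^ 2 * B ^ 2)⁻¹
        = (H / (N / c + 1)) ^ 2 * (ρ / (B * H) ^ 2 + (1 - ρ) / (B * H) ^ 2) := by
          have : (N / c + 1) ≠ 0 := by positivity
          generalize N / c + 1 = q at this
          field_simp; ring
      _ ≤ _ := by
          unfold gammaGrad
          exact mul_le_mul (pow_le_pow_left₀ (by positivity) hgL 2) (add_le_add hS' h2)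
            (by positivity) (by positivity)
  constructor
  · refine le_trans ?_ hlower
    refine inv_anti₀ (by positivity) ?_
    have : 0 ≤ N / c ^ 2 + 1 := by positivity
    exact le_add_of_nonneg_left this
  · refine hupper.trans ?_
    exact le_add_of_nonneg_right (by positivity)

lemma sum_comp_perm (z : Fin n → ℝ) (π : Equiv.Perm (Fin n)) (s : Finset (Fin n)) :
    ∑ i ∈ s, (z ∘ π) i = ∑ i ∈ s.map π.toEmbedding, z i := by
  rw [Finset.sum_map]; rfl

lemma comp_perm_mem_cone (π : Equiv.Perm (Fin n)) (hz : z ∈ kPositiveCone n k) :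
    z ∘ π ∈ kPositiveCone n k := fun s hs => by
  rw [sum_comp_perm]; exact hz _ (by simpa using hs)

lemma sum_powersetCard_comp_perm (π : Equiv.Perm (Fin n)) (g : ℝ → ℝ) (z : Fin n → ℝ) :
    ∑ s ∈ Finset.powersetCard k (Finset.univ : Finset (Fin n)), g (∑ i ∈ s, (z ∘ π) i)
      = ∑ s ∈ Finset.powersetCard k (Finset.univ : Finset (Fin n)), g (∑ i ∈ s, z i) := by
  refine Finset.sum_equiv π.finsetCongr (fun s => ?_) (fun s _ => ?_)
  · simp [Finset.mem_powersetCard]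
  · rw [sum_comp_perm]; rfl

lemma gammaSpeed_comp_perm (π : Equiv.Perm (Fin n)) (ρ : ℝ) (z : Fin n → ℝ) :
    gammaSpeed k ρ (z ∘ π) = gammaSpeed k ρ z := by
  unfold gammaSpeed
  rw [sum_powersetCard_comp_perm π (fun x => ρ / x) z]
  congr 3
  exact Equiv.sum_comp π z

end Cone

/-! ### Eigenvalues of symmetric matrices and concavity of the speed -/

section Eigenvalues

open Matrix Polynomial

variable {n k : ℕ} {ρ : ℝ}

lemma charpoly_roots_of_eq_diagonal {W : Matrix (Fin n) (Fin n) ℝ} {μ : Fin n → ℝ}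
    (h : W.charpoly = (Matrix.diagonal μ).charpoly) :
    W.charpoly.roots = Finset.univ.val.map μ := by
  rw [h, Matrix.charpoly_diagonal, ← Polynomial.roots_multiset_prod_X_sub_C
    (Finset.univ.val.map μ), Multiset.map_map]
  rfl

/-- A matrix with the characteristic polynomial of `diagonal μ` has the entries of `μ`, in some
order, as its sorted eigenvalues. -/
lemma exists_perm_sortedEigenvalues {W : Matrix (Fin n) (Fin n) ℝ} {μ : Fin n → ℝ}
    (h : W.charpoly = (Matrix.diagonal μ).charpoly) :
    ∃ π : Equiv.Perm (Fin n), sortedEigenvalues W = μ ∘ π := by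
  have hr := charpoly_roots_of_eq_diagonal h
  set L := W.charpoly.roots.sort (· ≤ ·) with hL
  have hLm : (L : Multiset ℝ) = Finset.univ.val.map μ := by rw [hL, Multiset.sort_eq, hr]
  have hlen : L.length = n := by
    have := congrArg Multiset.card hLm
    simpa using this
  have hof : List.ofFn (sortedEigenvalues W) = L := by
    apply List.ext_getElem
    · simp [hlen]
    · intro i h1 h2
      rw [List.getElem_ofFn, sortedEigenvalues, ← hL]
      exact List.getD_eq_getElem _ _ h2
  have hperm : (List.ofFn (sortedEigenvalues W)).Perm (List.ofFn μ) := by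
    rw [hof, ← Multiset.coe_eq_coe, hLm]
    simp [Fin.univ_val_map]
  -- two tuples that are permutations of each other agree after sorting
  have heq : sortedEigenvalues W ∘ Tuple.sort (sortedEigenvalues W) = μ ∘ Tuple.sort μ := by
    apply List.ofFn_injective
    apply List.Perm.eq_of_pairwise (le := (· ≤ ·)) (fun a b _ _ => le_antisymm)
    · exact List.sortedLE_ofFn_iff.2 (Tuple.monotone_sort _) |>.pairwise
    · exact List.sortedLE_ofFn_iff.2 (Tuple.monotone_sort _) |>.pairwise
    · exact ((Tuple.sort _).ofFn_comp_perm _).trans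
        (hperm.trans ((Tuple.sort μ).ofFn_comp_perm μ).symm)
  refine ⟨(Tuple.sort (sortedEigenvalues W)).symm.trans (Tuple.sort μ), ?_⟩
  funext i
  have := congrFun heq ((Tuple.sort (sortedEigenvalues W)).symm i)
  simpa using this

/-- Spectral theorem for real symmetric matrices. -/
lemma exists_orthogonal_diagonalization {S : Matrix (Fin n) (Fin n) ℝ} (hS : S.IsSymm) :
    ∃ (V : Matrix (Fin n) (Fin n) ℝ) (μ : Fin n → ℝ), Vᵀ * V = 1 ∧ V * Vᵀ = 1 ∧
      S = V * Matrix.diagonal μ * Vᵀ := by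
  have hH : S.IsHermitian := by
    rw [Matrix.IsHermitian, Matrix.conjTranspose_eq_transpose_of_trivial]; exact hS
  refine ⟨hH.eigenvectorUnitary, hH.eigenvalues, ?_, ?_, ?_⟩
  · have := Unitary.coe_star_mul_self hH.eigenvectorUnitary
    rwa [Matrix.star_eq_conjTranspose, Matrix.conjTranspose_eq_transpose_of_trivial] at this
  · have := Unitary.coe_mul_star_self hH.eigenvectorUnitary
    rwa [Unitary.coe_star, Matrix.star_eq_conjTranspose,
      Matrix.conjTranspose_eq_transpose_of_trivial] at this
  · have := hH.spectral_theorem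
    rw [Unitary.conjStarAlgAut_apply, Matrix.star_eq_conjTranspose,
      Matrix.conjTranspose_eq_transpose_of_trivial] at this
    simpa using this

lemma charpoly_conj_of_mul_eq_one {V V' W : Matrix (Fin n) (Fin n) ℝ} (h : V' * V = 1) :
    (V * W * V').charpoly = W.charpoly := by
  rw [Matrix.charpoly_mul_comm, ← Matrix.mul_assoc, h, Matrix.one_mul]

lemma gammaSpeed_sortedEigenvalues {W : Matrix (Fin n) (Fin n) ℝ} {μ : Fin n → ℝ}
    (h : W.charpoly = (Matrix.diagonal μ).charpoly) :
    gammaMatrix k ρ W = gammaSpeed k ρ μ := by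
  obtain ⟨π, hπ⟩ := exists_perm_sortedEigenvalues h
  rw [gammaMatrix, hπ, gammaSpeed_comp_perm]

lemma sortedEigenvalues_mem_cone_iff {W : Matrix (Fin n) (Fin n) ℝ} {μ : Fin n → ℝ}
    (h : W.charpoly = (Matrix.diagonal μ).charpoly) :
    sortedEigenvalues W ∈ kPositiveCone n k ↔ μ ∈ kPositiveCone n k := by
  obtain ⟨π, hπ⟩ := exists_perm_sortedEigenvalues h
  rw [hπ]
  refine ⟨fun hm => ?_, comp_perm_mem_cone π⟩
  have := comp_perm_mem_cone π.symm hm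
  rwa [Function.comp_assoc, Equiv.self_comp_symm, Function.comp_id] at this

lemma sum_sortedEigenvalues {W : Matrix (Fin n) (Fin n) ℝ} {μ : Fin n → ℝ}
    (h : W.charpoly = (Matrix.diagonal μ).charpoly) :
    ∑ i, sortedEigenvalues W i = W.trace := by
  obtain ⟨π, hπ⟩ := exists_perm_sortedEigenvalues h
  have h1 : W.trace = (Matrix.diagonal μ).trace := by
    rcases Nat.eq_zero_or_pos n with rfl | hn
    · simp [Matrix.trace]
    · have : Nonempty (Fin n) := ⟨⟨0, hn⟩⟩
      rw [Matrix.trace_eq_neg_charpoly_coeff, h, ← Matrix.trace_eq_neg_charpoly_coeff]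
  rw [hπ, h1, Matrix.trace_diagonal]
  exact Equiv.sum_comp π μ

/-- By Birkhoff's theorem, a lower bound for a linear functional at all rearrangements of `μ`
persists under doubly stochastic averaging. -/
lemma le_of_forall_perm_of_doublyStochastic {P : Matrix (Fin n) (Fin n) ℝ}
    (hP : P ∈ doublyStochastic ℝ (Fin n)) (a μ : Fin n → ℝ) {c : ℝ}
    (h : ∀ π : Equiv.Perm (Fin n), c ≤ ∑ i, a i * μ (π i)) :
    c ≤ ∑ i, a i * ∑ j, P i j * μ j := by
  obtain ⟨w, hw0, hw1, rfl⟩ := exists_eq_sum_perm_of_mem_doublyStochastic hP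
  have hrow : ∀ (π : Equiv.Perm (Fin n)) (i : Fin n),
      ∑ j, (π.permMatrix ℝ) i j * μ j = μ (π i) := by
    intro π i
    simp [Equiv.Perm.permMatrix, PEquiv.toMatrix_apply, Equiv.toPEquiv]
  have : ∑ i, a i * ∑ j, (∑ π : Equiv.Perm (Fin n), w π • π.permMatrix ℝ) i j * μ j
      = ∑ π : Equiv.Perm (Fin n), w π * ∑ i, a i * μ (π i) := by
    have hi : ∀ i, ∑ j, (∑ π : Equiv.Perm (Fin n), w π • π.permMatrix ℝ) i j * μ j
        = ∑ π : Equiv.Perm (Fin n), w π * μ (π i) := by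
      intro i
      simp_rw [← hrow, Matrix.sum_apply, Matrix.smul_apply, smul_eq_mul, Finset.sum_mul,
        Finset.mul_sum]
      rw [Finset.sum_comm]
      simp_rw [mul_assoc]
    simp_rw [hi, Finset.mul_sum]
    rw [Finset.sum_comm]
    exact Finset.sum_congr rfl fun π _ => Finset.sum_congr rfl fun i _ => by ring
  rw [this]
  calc c = ∑ π : Equiv.Perm (Fin n), w π * c := by rw [← Finset.sum_mul, hw1, one_mul]
    _ ≤ _ := Finset.sum_le_sum fun π _ => mul_le_mul_of_nonneg_left (h π) (hw0 π)

lemma sq_mem_doublyStochastic {Q : Matrix (Fin n) (Fin n) ℝ} (h1 : Qᵀ * Q = 1)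
    (h2 : Q * Qᵀ = 1) : (Matrix.of fun i j => Q i j ^ 2) ∈ doublyStochastic ℝ (Fin n) := by
  rw [mem_doublyStochastic_iff_sum]
  refine ⟨fun i j => sq_nonneg _, fun i => ?_, fun j => ?_⟩
  · have := congrFun (congrFun h2 i) i
    simpa [Matrix.mul_apply, sq] using this
  · have := congrFun (congrFun h1 j) j
    simpa [Matrix.mul_apply, sq] using this

/-- Schur: the diagonal of a symmetric matrix in any orthonormal basis is a doubly stochastic
average of its eigenvalues. -/
lemma exists_doublyStochastic_diag_conj {U V : Matrix (Fin n) (Fin n) ℝ} (hU : Uᵀ * U = 1)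
    (hV : Vᵀ * V = 1) (μ : Fin n → ℝ) :
    ∃ P ∈ doublyStochastic ℝ (Fin n), ∀ i,
      (Uᵀ * (V * Matrix.diagonal μ * Vᵀ) * U) i i = ∑ j, P i j * μ j := by
  have hU' := mul_eq_one_comm.1 hU
  have hV' := mul_eq_one_comm.1 hV
  refine ⟨_, sq_mem_doublyStochastic (Q := Uᵀ * V) ?_ ?_, fun i => ?_⟩
  · rw [Matrix.transpose_mul, Matrix.transpose_transpose, Matrix.mul_assoc,
      ← Matrix.mul_assoc U, hU', Matrix.one_mul, hV]
  · rw [Matrix.transpose_mul, Matrix.transpose_transpose, Matrix.mul_assoc,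
      ← Matrix.mul_assoc V, hV', Matrix.one_mul, hU]
  · have : Uᵀ * (V * Matrix.diagonal μ * Vᵀ) * U
        = (Uᵀ * V) * Matrix.diagonal μ * (Uᵀ * V)ᵀ := by
      rw [Matrix.transpose_mul, Matrix.transpose_transpose]; simp only [Matrix.mul_assoc]
    rw [this, Matrix.mul_apply]
    refine Finset.sum_congr rfl fun j _ => ?_
    rw [Matrix.mul_diagonal, Matrix.transpose_apply, Matrix.of_apply]
    ring

/-- The matrix function `γ_{k,ρ}` lies below its linearization at a matrix with eigenvalues `z` and
orthonormal eigenbasis `U`. -/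
lemma gammaMatrix_le (hk : 1 ≤ k) (hkn : k ≤ n) (hρ : ρ ∈ Ioc (0 : ℝ) 1)
    {S U : Matrix (Fin n) (Fin n) ℝ} (hS : S.IsSymm)
    (hSc : sortedEigenvalues S ∈ kPositiveCone n k) (hU : Uᵀ * U = 1) {z : Fin n → ℝ}
    (hz : z ∈ kPositiveCone n k) :
    gammaMatrix k ρ S ≤ ∑ i, gammaGrad k ρ z i * (Uᵀ * S * U) i i := by
  obtain ⟨V, μ, hV, -, rfl⟩ := exists_orthogonal_diagonalization hS
  have hch : (V * Matrix.diagonal μ * Vᵀ).charpoly = (Matrix.diagonal μ).charpoly :=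
    charpoly_conj_of_mul_eq_one hV
  rw [sortedEigenvalues_mem_cone_iff hch] at hSc
  rw [gammaSpeed_sortedEigenvalues hch]
  obtain ⟨P, hP, hPd⟩ := exists_doublyStochastic_diag_conj hU hV μ
  simp_rw [hPd]
  refine le_of_forall_perm_of_doublyStochastic hP _ _ fun π => ?_
  rw [← gammaSpeed_comp_perm π]
  exact gammaSpeed_le_sum_gammaGrad_mul hk hkn hρ hz (comp_perm_mem_cone π hSc)

/-- The set of symmetric matrices with eigenvalues in the `k`-positive cone is open along lines. -/
lemma eventually_sortedEigenvalues_mem_cone {S B : Matrix (Fin n) (Fin n) ℝ} (hS : S.IsSymm)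
    (hB : B.IsSymm) (hSc : sortedEigenvalues S ∈ kPositiveCone n k) :
    ∀ᶠ s in 𝓝 (0 : ℝ), sortedEigenvalues (S + s • B) ∈ kPositiveCone n k := by
  obtain ⟨V, μ, hV, -, rfl⟩ := exists_orthogonal_diagonalization hS
  have hch : (V * Matrix.diagonal μ * Vᵀ).charpoly = (Matrix.diagonal μ).charpoly :=
    charpoly_conj_of_mul_eq_one hV
  rw [sortedEigenvalues_mem_cone_iff hch] at hSc
  -- a uniform positive lower bound for the `k`-sums of the eigenvalues
  obtain ⟨δ, hδ, hδμ⟩ : ∃ δ > 0, ∀ s : Finset (Fin n), s.card = k → δ ≤ ∑ i ∈ s, μ i := by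
    rcases (Finset.powersetCard k (Finset.univ : Finset (Fin n))).eq_empty_or_nonempty with
      he | hne
    · refine ⟨1, one_pos, fun s hs => ?_⟩
      have : s ∈ Finset.powersetCard k (Finset.univ : Finset (Fin n)) := by
        simp [Finset.mem_powersetCard, hs]
      simp [he] at this
    · obtain ⟨s₀, hs₀, hmin⟩ := Finset.exists_min_image _ (fun s => ∑ i ∈ s, μ i) hne
      exact ⟨_, sum_pos_of_mem_powersetCard hSc hs₀, fun s hs =>
        hmin s (by simp [Finset.mem_powersetCard, hs])⟩
  set C : ℝ := n * ∑ p, ∑ q, |B p q| with hC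
  have hC0 : 0 ≤ C := by positivity
  have hev : ∀ᶠ s in 𝓝 (0 : ℝ), |s| * C < δ := by
    have hcont : Tendsto (fun s : ℝ => |s| * C) (𝓝 0) (𝓝 (|0| * C)) :=
      (continuous_abs.mul continuous_const).tendsto 0
    exact hcont.eventually_lt_const (by simpa using hδ)
  filter_upwards [hev] with s hs
  have hsym : (V * Matrix.diagonal μ * Vᵀ + s • B).IsSymm := hS.add (hB.smul s)
  obtain ⟨U, μ', hU, -, hdec⟩ := exists_orthogonal_diagonalization hsym
  have hch' : (V * Matrix.diagonal μ * Vᵀ + s • B).charpoly = (Matrix.diagonal μ').charpoly := by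
    rw [hdec]; exact charpoly_conj_of_mul_eq_one hU
  rw [sortedEigenvalues_mem_cone_iff hch']
  have hU' := mul_eq_one_comm.1 hU
  have hdiag : ∀ i, μ' i = (Uᵀ * (V * Matrix.diagonal μ * Vᵀ) * U) i i
      + s * (Uᵀ * B * U) i i := by
    intro i
    have : Matrix.diagonal μ' = Uᵀ * (V * Matrix.diagonal μ * Vᵀ + s • B) * U := by
      rw [hdec]
      calc Matrix.diagonal μ' = (Uᵀ * U) * Matrix.diagonal μ' * (Uᵀ * U) := by
            rw [hU, Matrix.one_mul, Matrix.mul_one]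
        _ = _ := by simp only [Matrix.mul_assoc]
    have h2 := congrFun (congrFun this i) i
    rw [Matrix.diagonal_apply_eq] at h2
    rw [h2, Matrix.mul_add, Matrix.add_mul, Matrix.add_apply, Matrix.mul_smul, Matrix.smul_mul,
      Matrix.smul_apply, smul_eq_mul]
  have hentry : ∀ i j, |U i j| ≤ 1 := by
    intro i j
    have h2 := congrFun (congrFun hU j) j
    rw [Matrix.mul_apply, Matrix.one_apply_eq] at h2
    have h3 : U i j ^ 2 ≤ 1 := by
      rw [← h2]
      have := Finset.single_le_sum (f := fun l => Uᵀ j l * U l j)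
        (fun l _ => by simpa [Matrix.transpose_apply] using mul_self_nonneg (U l j))
        (Finset.mem_univ i)
      simpa [sq, Matrix.transpose_apply] using this
    exact (sq_le_one_iff_abs_le_one _).1 h3
  have hBb : ∀ i, |(Uᵀ * B * U) i i| ≤ ∑ p, ∑ q, |B p q| := by
    intro i
    simp only [Matrix.mul_apply, Finset.sum_mul, Matrix.transpose_apply]
    rw [Finset.sum_comm]
    refine (Finset.abs_sum_le_sum_abs _ _).trans (Finset.sum_le_sum fun p _ => ?_)
    refine (Finset.abs_sum_le_sum_abs _ _).trans (Finset.sum_le_sum fun q _ => ?_)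
    rw [abs_mul, abs_mul]
    calc |U p i| * |B p q| * |U q i| ≤ 1 * |B p q| * 1 := by
          gcongr
          · exact hentry p i
          · exact hentry q i
      _ = _ := by ring
  intro t ht
  obtain ⟨P, hP, hPd⟩ := exists_doublyStochastic_diag_conj hU hV μ
  have h1 : δ ≤ ∑ i ∈ t, (Uᵀ * (V * Matrix.diagonal μ * Vᵀ) * U) i i := by
    have := le_of_forall_perm_of_doublyStochastic hP (fun i => if i ∈ t then 1 else 0) μ
      (c := δ) fun π => by
        have h4 := hδμ (t.map π.toEmbedding) (by simpa using ht)
        rw [← sum_comp_perm] at h4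
        simpa [Finset.sum_ite_mem] using h4
    simp_rw [hPd]
    simpa [Finset.sum_ite_mem] using this
  have h2 : |∑ i ∈ t, s * (Uᵀ * B * U) i i| ≤ |s| * C := by
    rw [← Finset.mul_sum, abs_mul]
    refine mul_le_mul_of_nonneg_left ?_ (abs_nonneg s)
    refine (Finset.abs_sum_le_sum_abs _ _).trans ?_
    refine (Finset.sum_le_card_nsmul _ _ _ fun i _ => hBb i).trans ?_
    rw [nsmul_eq_mul, hC]
    have : (t.card : ℝ) ≤ n := by
      exact_mod_cast (Finset.card_le_univ t).trans_eq (Fintype.card_fin n)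
    exact mul_le_mul_of_nonneg_right this (by positivity)
  simp_rw [hdiag]
  rw [Finset.sum_add_distrib]
  have := (abs_le.1 h2).1
  linarith

end Eigenvalues

/-! ### Differentiability of the speed as a matrix function -/

section Differentiability

open Matrix MvPolynomial

variable {n k : ℕ} {ρ : ℝ}

lemma hasDerivAt_mvPolynomial_eval {σ : Type*} [Fintype σ] (P : MvPolynomial σ ℝ)
    {x : ℝ → σ → ℝ} {x' : σ → ℝ} {t₀ : ℝ} (hx : ∀ i, HasDerivAt (fun t => x t i) (x' i) t₀) :
    HasDerivAt (fun t => eval (x t) P) (∑ i, eval (x t₀) (pderiv i P) * x' i) t₀ := by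
  classical
  induction P using MvPolynomial.induction_on with
  | C a => simpa using hasDerivAt_const t₀ a
  | add p q hp hq =>
    simp only [map_add, add_mul, Finset.sum_add_distrib]
    exact hp.add hq
  | mul_X p i hp =>
    have h := hp.mul (hx i)
    simp only [map_mul, eval_X, Derivation.leibniz, map_add, smul_eq_mul, add_mul,
      Finset.sum_add_distrib]
    refine h.congr_deriv ?_
    rw [Finset.sum_mul, add_comm (∑ i, _) (eval (x t₀) p * x' i)]
    congr 1
    · symm
      rw [Finset.sum_eq_single i]
      · simp
      · intro j _ hj
        simp [pderiv_X_of_ne hj.symm]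
      · simp
    · exact Finset.sum_congr rfl fun j _ => by ring

lemma eval_esymm_eq_charpoly_coeff {W : Matrix (Fin n) (Fin n) ℝ} {μ : Fin n → ℝ}
    (h : W.charpoly = (Matrix.diagonal μ).charpoly) {j : ℕ} (hj : j ≤ n) :
    eval μ (esymm (Fin n) ℝ j) = (-1) ^ j * W.charpoly.coeff (n - j) := by
  have h1 : eval μ (esymm (Fin n) ℝ j) = (Finset.univ.val.map μ).esymm j := by
    rw [← aeval_esymm_eq_multiset_esymm (Fin n) ℝ]; rfl
  have hcard : (Finset.univ.val.map μ).card = n := by simp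
  have h2 : W.charpoly = ((Finset.univ.val.map μ).map fun t => Polynomial.X - Polynomial.C t).prod
      := by
    rw [h, Matrix.charpoly_diagonal, Multiset.map_map]; rfl
  rw [h1, h2, Multiset.prod_X_sub_C_coeff _ (by rw [hcard]; omega), hcard,
    Nat.sub_sub_self hj, ← mul_assoc, ← mul_pow]
  simp

/-- A symmetric polynomial of the eigenvalues is a polynomial in the entries of the matrix. -/
lemma exists_entry_polynomial_of_isSymmetric {P : MvPolynomial (Fin n) ℝ} (hP : P.IsSymmetric) :
    ∃ R : MvPolynomial (Fin n × Fin n) ℝ, ∀ (W : Matrix (Fin n) (Fin n) ℝ) (μ : Fin n → ℝ),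
      W.charpoly = (Matrix.diagonal μ).charpoly →
      eval (fun p : Fin n × Fin n => W p.1 p.2) R = eval μ P := by
  obtain ⟨Q, hQ⟩ := (esymmAlgEquiv (Fin n) ℝ (Fintype.card_fin n)).surjective ⟨P, hP⟩
  have hQ' : aeval (fun i : Fin n => esymm (Fin n) ℝ (i + 1)) Q = P := by
    have := congrArg Subtype.val hQ
    rw [← esymmAlgHom_apply]
    exact this
  refine ⟨aeval (fun i : Fin n => (-1) ^ ((i : ℕ) + 1) *
    (Matrix.charpoly.univ ℝ (Fin n)).coeff (n - (i + 1))) Q, fun W μ h => ?_⟩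
  have hcomp : ∀ {σ : Type} (x : σ → ℝ) (y : Fin n → MvPolynomial σ ℝ),
      eval x (aeval y Q) = aeval (fun i => eval x (y i)) Q := fun x y =>
    comp_aeval_apply y (aeval x) Q
  rw [← hQ', hcomp, hcomp]
  congr 2
  funext i
  rw [eval_esymm_eq_charpoly_coeff h (by omega), map_mul, map_pow, map_neg, map_one]
  congr 1
  have := Matrix.charpoly.univ_coeff_eval₂Hom (Fin n) (RingHom.id ℝ)
    (fun p : Fin n × Fin n => W p.1 p.2) (n - (i + 1))
  rw [← eval₂_id]
  exact this

/-- The `k`-sum `∑_{i ∈ s} X_i`. -/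
def partialSumPoly (s : Finset (Fin n)) : MvPolynomial (Fin n) ℝ := ∑ i ∈ s, X i

lemma eval_partialSumPoly (s : Finset (Fin n)) (z : Fin n → ℝ) :
    eval z (partialSumPoly s) = ∑ i ∈ s, z i := by
  simp [partialSumPoly]

lemma rename_partialSumPoly (π : Equiv.Perm (Fin n)) (s : Finset (Fin n)) :
    rename π (partialSumPoly s) = partialSumPoly (π.finsetCongr s) := by
  simp [partialSumPoly, Equiv.finsetCongr_apply]

lemma isSymmetric_prod_partialSumPoly (k : ℕ) :
    (∏ s ∈ Finset.powersetCard k (Finset.univ : Finset (Fin n)),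
      partialSumPoly s).IsSymmetric := by
  intro π
  rw [map_prod]
  refine Finset.prod_equiv π.finsetCongr (fun s => ?_) fun s _ => rename_partialSumPoly π s
  simp [Finset.mem_powersetCard]

lemma isSymmetric_sum_prod_erase_partialSumPoly (k : ℕ) :
    (∑ s ∈ Finset.powersetCard k (Finset.univ : Finset (Fin n)),
      ∏ t ∈ (Finset.powersetCard k (Finset.univ : Finset (Fin n))).erase s,
        partialSumPoly t).IsSymmetric := by
  intro π
  rw [map_sum]
  refine Finset.sum_equiv π.finsetCongr (fun s => ?_) fun s _ => ?_
  · simp [Finset.mem_powersetCard]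
  · rw [map_prod]
    refine Finset.prod_equiv π.finsetCongr (fun t => ?_) fun t _ => rename_partialSumPoly π t
    simp [Finset.mem_powersetCard]

/-- `γ_{k,ρ}` of the eigenvalues is a rational function of the entries of the matrix. Along paths of
matrices with real eigenvalues it is therefore differentiable, with a derivative that is linear in
the velocity. -/
lemma exists_hasDerivAt_gammaMatrix (hk : 1 ≤ k) (hkn : k ≤ n) (hρ : ρ ∈ Ioc (0 : ℝ) 1)
    {W₀ : Matrix (Fin n) (Fin n) ℝ} {z : Fin n → ℝ}
    (hW₀ : W₀.charpoly = (Matrix.diagonal z).charpoly) (hz : z ∈ kPositiveCone n k) :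
    ∃ D : Matrix (Fin n) (Fin n) ℝ, ∀ (W : ℝ → Matrix (Fin n) (Fin n) ℝ)
      (W' : Matrix (Fin n) (Fin n) ℝ) (t₀ : ℝ), W t₀ = W₀ →
      (∀ i j, HasDerivAt (fun t => W t i j) (W' i j) t₀) →
      (∀ᶠ t in 𝓝 t₀, ∃ μ : Fin n → ℝ, (W t).charpoly = (Matrix.diagonal μ).charpoly) →
      HasDerivAt (fun t => gammaMatrix k ρ (W t)) (∑ i, ∑ j, D i j * W' i j) t₀ := by
  classical
  set P := Finset.powersetCard k (Finset.univ : Finset (Fin n)) with hPdef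
  obtain ⟨R₁, hR₁⟩ := exists_entry_polynomial_of_isSymmetric
    (isSymmetric_sum_prod_erase_partialSumPoly (n := n) k)
  obtain ⟨R₂, hR₂⟩ := exists_entry_polynomial_of_isSymmetric
    (isSymmetric_prod_partialSumPoly (n := n) k)
  let ent : Matrix (Fin n) (Fin n) ℝ → Fin n × Fin n → ℝ := fun W p => W p.1 p.2
  let N : Matrix (Fin n) (Fin n) ℝ → ℝ := fun W => eval (ent W) R₁
  let Q : Matrix (Fin n) (Fin n) ℝ → ℝ := fun W => eval (ent W) R₂
  have hN : ∀ (W : Matrix (Fin n) (Fin n) ℝ) (μ : Fin n → ℝ),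
      W.charpoly = (Matrix.diagonal μ).charpoly →
      N W = ∑ s ∈ P, ∏ t ∈ P.erase s, ∑ i ∈ t, μ i := by
    intro W μ h
    simp only [N, ent]
    rw [hR₁ W μ h, map_sum]
    refine Finset.sum_congr rfl fun s _ => ?_
    rw [map_prod]
    exact Finset.prod_congr rfl fun t _ => eval_partialSumPoly t μ
  have hQ : ∀ (W : Matrix (Fin n) (Fin n) ℝ) (μ : Fin n → ℝ),
      W.charpoly = (Matrix.diagonal μ).charpoly → Q W = ∏ t ∈ P, ∑ i ∈ t, μ i := by
    intro W μ h
    simp only [Q, ent]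
    rw [hR₂ W μ h, map_prod]
    exact Finset.prod_congr rfl fun t _ => eval_partialSumPoly t μ
  have hform : ∀ (W : Matrix (Fin n) (Fin n) ℝ) (μ : Fin n → ℝ),
      W.charpoly = (Matrix.diagonal μ).charpoly → Q W ≠ 0 →
      gammaMatrix k ρ W = (ρ * (N W / Q W) + (1 - ρ) / W.trace)⁻¹ := by
    intro W μ h hne
    have hne' : ∀ t ∈ P, ∑ i ∈ t, μ i ≠ 0 := by
      rw [hQ W μ h] at hne
      exact Finset.prod_ne_zero_iff.1 hne
    have htr : W.trace = ∑ i, μ i := by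
      obtain ⟨π, hπ⟩ := exists_perm_sortedEigenvalues h
      rw [← sum_sortedEigenvalues h, hπ]
      exact Equiv.sum_comp π μ
    rw [gammaSpeed_sortedEigenvalues h, gammaSpeed, htr, hN W μ h, hQ W μ h, Finset.sum_div,
      Finset.mul_sum]
    congr 2
    refine Finset.sum_congr rfl fun s hs => ?_
    rw [← Finset.mul_prod_erase P _ hs]
    have h1 := hne' s hs
    have h2 : ∏ t ∈ P.erase s, ∑ i ∈ t, μ i ≠ 0 :=
      Finset.prod_ne_zero_iff.2 fun t ht => hne' t (Finset.mem_of_mem_erase ht)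
    field_simp
  have hQ0 : Q W₀ ≠ 0 := by
    rw [hQ W₀ z hW₀]
    exact Finset.prod_ne_zero_iff.2 fun t ht => (sum_pos_of_mem_powersetCard hz ht).ne'
  have htr0 : W₀.trace ≠ 0 := by
    obtain ⟨π, hπ⟩ := exists_perm_sortedEigenvalues hW₀
    rw [← sum_sortedEigenvalues hW₀, hπ]
    exact (sum_pos_of_mem_cone hk hkn (comp_perm_mem_cone π hz)).ne'
  have hden0 : ρ * (N W₀ / Q W₀) + (1 - ρ) / W₀.trace ≠ 0 := by
    have h1 := hform W₀ z hW₀ hQ0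
    have h2 := gammaSpeed_pos hk hkn hρ hz
    rw [← gammaSpeed_sortedEigenvalues hW₀, h1] at h2
    exact (inv_pos.1 h2).ne'
  -- the derivative of the rational expression, by the chain rule
  let c := ρ * (N W₀ / Q W₀) + (1 - ρ) / W₀.trace
  refine ⟨Matrix.of fun i j => -(ρ * ((eval (ent W₀) (pderiv (i, j) R₁) * Q W₀
      - N W₀ * eval (ent W₀) (pderiv (i, j) R₂)) / Q W₀ ^ 2)
      + -((1 - ρ) * (1 : Matrix (Fin n) (Fin n) ℝ) i j) / W₀.trace ^ 2) / c ^ 2,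
    fun W W' t₀ h0 hW' hev => ?_⟩
  subst h0
  have dent : ∀ p : Fin n × Fin n, HasDerivAt (fun t => ent (W t) p) (ent W' p) t₀ :=
    fun p => hW' p.1 p.2
  have dN : HasDerivAt (fun t => N (W t)) _ t₀ := hasDerivAt_mvPolynomial_eval R₁ dent
  have dQ : HasDerivAt (fun t => Q (W t)) _ t₀ := hasDerivAt_mvPolynomial_eval R₂ dent
  have dT : HasDerivAt (fun t => (W t).trace) W'.trace t₀ := by
    simp only [Matrix.trace, Matrix.diag_apply]
    exact HasDerivAt.fun_sum fun i _ => hW' i i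
  have dall := (((dN.div dQ hQ0).const_mul ρ).add
    ((hasDerivAt_const t₀ (1 - ρ)).div dT htr0)).inv hden0
  have hQev : ∀ᶠ t in 𝓝 t₀, Q (W t) ≠ 0 := dQ.continuousAt.eventually_ne hQ0
  have hcongr : (fun t => gammaMatrix k ρ (W t)) =ᶠ[𝓝 t₀]
      fun t => (ρ * (N (W t) / Q (W t)) + (1 - ρ) / (W t).trace)⁻¹ := by
    filter_upwards [hev, hQev] with t ⟨μ, hμ⟩ hq
    exact hform _ μ hμ hq
  refine HasDerivAt.congr_of_eventuallyEq ?_ hcongr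
  refine dall.congr_deriv ?_
  simp only [Pi.add_apply, Pi.div_apply, Matrix.of_apply, Fintype.sum_prod_type, zero_mul, zero_sub]
  have htrace : W'.trace = ∑ i, ∑ j, (1 : Matrix (Fin n) (Fin n) ℝ) i j * W' i j := by
    simp [Matrix.one_apply, Matrix.trace]
  rw [htrace]
  simp only [Finset.sum_mul, Finset.mul_sum, neg_div, Finset.sum_div, ← Finset.sum_neg_distrib,
    ← Finset.sum_add_distrib, ← Finset.sum_sub_distrib, add_div, sub_div]
  refine Finset.sum_congr rfl fun i _ => Finset.sum_congr rfl fun j _ => ?_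
  simp only [ent, c]
  ring

/-- The derivative of `γ_{k,ρ}` at a symmetric matrix with eigenvalues `z` and orthonormal eigenbasis
`U`, in symmetric directions. It has to agree with the linearization that bounds `γ_{k,ρ}` from
above. -/
lemma hasDerivAt_gammaMatrix (hk : 1 ≤ k) (hkn : k ≤ n) (hρ : ρ ∈ Ioc (0 : ℝ) 1)
    {U : Matrix (Fin n) (Fin n) ℝ} (hU : Uᵀ * U = 1) {z : Fin n → ℝ}
    (hz : z ∈ kPositiveCone n k) {W : ℝ → Matrix (Fin n) (Fin n) ℝ}
    {W' : Matrix (Fin n) (Fin n) ℝ} {t₀ : ℝ} (h0 : W t₀ = U * Matrix.diagonal z * Uᵀ)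
    (hW' : ∀ i j, HasDerivAt (fun t => W t i j) (W' i j) t₀) (hsymm : W'.IsSymm)
    (hev : ∀ᶠ t in 𝓝 t₀, ∃ μ : Fin n → ℝ, (W t).charpoly = (Matrix.diagonal μ).charpoly) :
    HasDerivAt (fun t => gammaMatrix k ρ (W t)) (∑ i, gammaGrad k ρ z i * (Uᵀ * W' * U) i i)
      t₀ := by
  set S := U * Matrix.diagonal z * Uᵀ with hSdef
  have hch : S.charpoly = (Matrix.diagonal z).charpoly := charpoly_conj_of_mul_eq_one hU
  have hS : S.IsSymm := by
    rw [Matrix.IsSymm, hSdef, Matrix.transpose_mul, Matrix.transpose_mul,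
      Matrix.transpose_transpose, Matrix.diagonal_transpose, Matrix.mul_assoc]
  obtain ⟨D, hD⟩ := exists_hasDerivAt_gammaMatrix hk hkn hρ hch hz
  have hline := hD (fun s => S + s • W') W' 0 (by simp)
    (fun i j => by
      have h := ((hasDerivAt_id (0 : ℝ)).mul_const (W' i j)).const_add (S i j)
      simpa using h)
    (Eventually.of_forall fun s => by
      obtain ⟨V, μ, hV, -, hdec⟩ := exists_orthogonal_diagonalization (hS.add (hsymm.smul s))
      exact ⟨μ, by rw [hdec]; exact charpoly_conj_of_mul_eq_one hV⟩)
  have hup : HasDerivAt (fun s : ℝ => ∑ i, gammaGrad k ρ z i * (Uᵀ * (S + s • W') * U) i i)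
      (∑ i, gammaGrad k ρ z i * (Uᵀ * W' * U) i i) 0 := by
    refine HasDerivAt.fun_sum fun i _ => HasDerivAt.const_mul _ ?_
    have h := ((hasDerivAt_id (0 : ℝ)).mul_const ((Uᵀ * W' * U) i i)).const_add
      ((Uᵀ * S * U) i i)
    have he : (fun s : ℝ => (Uᵀ * (S + s • W') * U) i i)
        = fun s => (Uᵀ * S * U) i i + id s * (Uᵀ * W' * U) i i := by
      funext s
      simp [Matrix.mul_add, Matrix.add_mul]
    rw [he]
    simpa using h
  have hconj : Uᵀ * S * U = Matrix.diagonal z := by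
    rw [hSdef]
    calc _ = (Uᵀ * U) * Matrix.diagonal z * (Uᵀ * U) := by simp only [Matrix.mul_assoc]
      _ = _ := by rw [hU, Matrix.one_mul, Matrix.mul_one]
  have hmin : IsLocalMin (fun s : ℝ => ∑ i, gammaGrad k ρ z i * (Uᵀ * (S + s • W') * U) i i
      - gammaMatrix k ρ (S + s • W')) 0 := by
    have hzero : ∑ i, gammaGrad k ρ z i * (Uᵀ * (S + (0 : ℝ) • W') * U) i i
        - gammaMatrix k ρ (S + (0 : ℝ) • W') = 0 := by
      rw [zero_smul, add_zero, hconj, gammaSpeed_sortedEigenvalues hch]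
      simp only [Matrix.diagonal_apply_eq]
      rw [sum_gammaGrad_mul_self hk hkn hρ hz, sub_self]
    filter_upwards [eventually_sortedEigenvalues_mem_cone hS hsymm
      ((sortedEigenvalues_mem_cone_iff hch).2 hz)] with s hs
    rw [hzero]
    exact sub_nonneg.2 (gammaMatrix_le hk hkn hρ (hS.add (hsymm.smul s)) hs hU hz)
  have h3 := hmin.hasDerivAt_eq_zero (hup.sub hline)
  rw [sub_eq_zero.1 h3]
  exact hD W W' t₀ h0 hW' hev

end Differentiability

/-! ### Directional derivatives -/

section DirectionalDerivative

variable {X V : Type*} [NormedAddCommGroup X] [NormedSpace ℝ X]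
  [NormedAddCommGroup V] [InnerProductSpace ℝ V]

/-- The directional derivative `∂_v f`, as a function of the base point. -/
def pd {Y : Type*} [NormedAddCommGroup Y] [NormedSpace ℝ Y] (v : X) (f : X → Y) : X → Y :=
  fun z => fderiv ℝ f z v

variable {U : Set X} {z : X}

section General

variable {Y : Type*} [NormedAddCommGroup Y] [NormedSpace ℝ Y] {f g : X → Y}

lemma differentiableAt_of_smoothOn (hU : IsOpen U) (hf : ContDiffOn ℝ ∞ f U) (hz : z ∈ U) :
    DifferentiableAt ℝ f z :=
  (hf.contDiffAt (hU.mem_nhds hz)).differentiableAt (by simp)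

lemma pd_smoothOn (hU : IsOpen U) (hf : ContDiffOn ℝ ∞ f U) (v : X) :
    ContDiffOn ℝ ∞ (pd v f) U :=
  (hf.fderiv_of_isOpen hU (by simp)).clm_apply contDiffOn_const

lemma pd_congr (hU : IsOpen U) (h : EqOn f g U) (v : X) : EqOn (pd v f) (pd v g) U :=
  fun z hz => by
    have : f =ᶠ[𝓝 z] g := h.eventuallyEq_of_mem (hU.mem_nhds hz)
    simp only [pd]
    rw [this.fderiv_eq]

lemma pd_comm (hU : IsOpen U) (hf : ContDiffOn ℝ ∞ f U) (v w : X) (hz : z ∈ U) :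
    pd v (pd w f) z = pd w (pd v f) z := by
  have hd : DifferentiableAt ℝ (fderiv ℝ f) z :=
    differentiableAt_of_smoothOn hU (hf.fderiv_of_isOpen hU (by simp)) hz
  have key : ∀ a b : X, pd a (pd b f) z = fderiv ℝ (fderiv ℝ f) z a b := by
    intro a b
    change fderiv ℝ (fun y => fderiv ℝ f y b) z a = _
    rw [fderiv_clm_apply hd (differentiableAt_const b)]
    simp
  have hs : IsSymmSndFDerivAt ℝ f z :=
    (hf.contDiffAt (hU.mem_nhds hz)).isSymmSndFDerivAt
      (by simp only [minSmoothness_of_isRCLikeNormedField]; exact WithTop.coe_le_coe.2 le_top)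
  rw [key, key]
  exact hs v w

lemma pd_const (c : Y) (v : X) : pd v (fun _ : X => c) z = 0 := by
  simp [pd]

lemma pd_neg (f : X → Y) (v : X) : pd v (fun x => -f x) z = -pd v f z := by
  simp only [pd]
  rw [fderiv_fun_neg]; rfl

lemma pd_add (hf : DifferentiableAt ℝ f z) (hg : DifferentiableAt ℝ g z) (v : X) :
    pd v (fun x => f x + g x) z = pd v f z + pd v g z := by
  simp only [pd]
  rw [fderiv_fun_add hf hg]; rfl

lemma hasDerivAt_along_line (v : X) (y : X) (hf : DifferentiableAt ℝ f y) {s : ℝ} {z₀ : X}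
    (hy : z₀ + s • v = y) : HasDerivAt (fun s : ℝ => f (z₀ + s • v)) (pd v f y) s := by
  subst hy
  have h1 : HasDerivAt (fun s : ℝ => z₀ + s • v) v s := by
    simpa using ((hasDerivAt_id s).smul_const v).const_add z₀
  exact hf.hasFDerivAt.comp_hasDerivAt s h1

end General

lemma pd_inner {f g : X → V} (hf : DifferentiableAt ℝ f z) (hg : DifferentiableAt ℝ g z) (v : X) :
    pd v (fun x => inner ℝ (f x) (g x)) z
      = inner ℝ (f z) (pd v g z) + inner ℝ (pd v f z) (g z) := by
  simp only [pd]
  rw [fderiv_inner_apply ℝ hf hg]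

lemma pd_smul {c : X → ℝ} {g : X → V} (hc : DifferentiableAt ℝ c z)
    (hg : DifferentiableAt ℝ g z) (v : X) :
    pd v (fun x => c x • g x) z = c z • pd v g z + pd v c z • g z := by
  simp only [pd]
  rw [fderiv_fun_smul hc hg]
  simp

end DirectionalDerivative

/-! ### Second-order expansions along lines -/

/-- `f` has the second-order expansion `f s = a + b s + c s² + o(s²)` at `0`. -/
def HasJet (f : ℝ → ℝ) (a b c : ℝ) : Prop :=
  (fun s => f s - (a + b * s + c * s ^ 2)) =o[𝓝 0] fun s : ℝ => s ^ 2

namespace HasJet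

variable {f g : ℝ → ℝ} {a b c a' b' c' : ℝ}

lemma congr' (hf : HasJet f a b c) (h : f =ᶠ[𝓝 0] g) : HasJet g a b c := by
  refine Asymptotics.IsLittleO.congr' hf ?_ EventuallyEq.rfl
  filter_upwards [h] with s hs
  rw [hs]

lemma congr_coeff (hf : HasJet f a b c) (ha : a = a') (hb : b = b') (hc : c = c') :
    HasJet f a' b' c' := by
  subst ha hb hc; exact hf

lemma const (a : ℝ) : HasJet (fun _ => a) a 0 0 := by
  simp [HasJet]

lemma add (hf : HasJet f a b c) (hg : HasJet g a' b' c') :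
    HasJet (fun s => f s + g s) (a + a') (b + b') (c + c') :=
  (Asymptotics.IsLittleO.add hf hg).congr_left fun s => by ring

lemma const_mul (r : ℝ) (hf : HasJet f a b c) :
    HasJet (fun s => r * f s) (r * a) (r * b) (r * c) :=
  (Asymptotics.IsLittleO.const_mul_left hf r).congr_left fun s => by ring

lemma sub (hf : HasJet f a b c) (hg : HasJet g a' b' c') :
    HasJet (fun s => f s - g s) (a - a') (b - b') (c - c') :=
  (Asymptotics.IsLittleO.sub hf hg).congr_left fun s => by ring

lemma sum {ι : Type*} (t : Finset ι) {f : ι → ℝ → ℝ} {a b c : ι → ℝ}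
    (h : ∀ i ∈ t, HasJet (f i) (a i) (b i) (c i)) :
    HasJet (fun s => ∑ i ∈ t, f i s) (∑ i ∈ t, a i) (∑ i ∈ t, b i) (∑ i ∈ t, c i) := by
  classical
  induction t using Finset.induction_on with
  | empty => simpa using const 0
  | insert i t hi ih =>
    simp only [Finset.sum_insert hi]
    exact (h i (Finset.mem_insert_self _ _)).add
      (ih fun j hj => h j (Finset.mem_insert_of_mem hj))

lemma poly_tendsto (a b c : ℝ) : Tendsto (fun s : ℝ => a + b * s + c * s ^ 2) (𝓝 0) (𝓝 a) := by
  have : Continuous fun s : ℝ => a + b * s + c * s ^ 2 := by fun_prop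
  simpa using this.tendsto 0

lemma sq_tendsto : Tendsto (fun s : ℝ => s ^ 2) (𝓝 0) (𝓝 0) := by
  simpa using (continuous_pow 2 : Continuous fun s : ℝ => s ^ 2).tendsto 0

lemma tendsto (hf : HasJet f a b c) : Tendsto f (𝓝 0) (𝓝 a) := by
  have h := (Asymptotics.IsLittleO.trans_tendsto hf sq_tendsto).add (poly_tendsto a b c)
  simpa using h

lemma mul (hf : HasJet f a b c) (hg : HasJet g a' b' c') :
    HasJet (fun s => f s * g s) (a * a') (a * b' + b * a') (a * c' + b * b' + c * a') := by
  have h1 : (fun s => (f s - (a + b * s + c * s ^ 2)) * g s) =o[𝓝 0] fun s : ℝ => s ^ 2 := by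
    simpa using Asymptotics.IsLittleO.mul_isBigO hf (hg.tendsto.isBigO_one ℝ)
  have h2 : (fun s => (a + b * s + c * s ^ 2) * (g s - (a' + b' * s + c' * s ^ 2)))
      =o[𝓝 0] fun s : ℝ => s ^ 2 := by
    simpa using Asymptotics.IsBigO.mul_isLittleO ((poly_tendsto a b c).isBigO_one ℝ) hg
  have h3 : (fun s : ℝ => s ^ 2 * (s * (b * c' + c * b' + c * c' * s)))
      =o[𝓝 0] fun s : ℝ => s ^ 2 := by
    have h4 : Tendsto (fun s : ℝ => s * (b * c' + c * b' + c * c' * s)) (𝓝 0) (𝓝 0) := by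
      have : Continuous fun s : ℝ => s * (b * c' + c * b' + c * c' * s) := by fun_prop
      simpa using this.tendsto 0
    simpa using (Asymptotics.isBigO_refl (fun s : ℝ => s ^ 2) (𝓝 0)).mul_isLittleO
      ((Asymptotics.isLittleO_one_iff ℝ).2 h4)
  exact ((h1.add h2).add h3).congr_left fun s => by ring

/-- The necessary conditions for a local minimum with value zero. -/
lemma of_nonneg (hf : HasJet f 0 b c) (h : ∀ᶠ s in 𝓝 0, 0 ≤ f s) : b = 0 ∧ 0 ≤ c := by
  have h0 := Asymptotics.IsLittleO.tendsto_div_nhds_zero hf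
  have h1 : Tendsto (fun s : ℝ => f s / s) (𝓝[≠] 0) (𝓝 b) := by
    have hb : Tendsto (fun s : ℝ => (f s - (0 + b * s + c * s ^ 2)) / s ^ 2 * s + (b + c * s))
        (𝓝[≠] 0) (𝓝 (0 * 0 + (b + c * 0))) := by
      refine Tendsto.mono_left ?_ nhdsWithin_le_nhds
      exact (h0.mul tendsto_id).add ((tendsto_id.const_mul c).const_add b)
    simp only [mul_zero, add_zero, zero_add] at hb
    refine hb.congr' ?_
    filter_upwards [self_mem_nhdsWithin] with s hs
    have : s ≠ 0 := hs
    field_simp; ring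
  have hb0 : b = 0 := by
    apply le_antisymm
    · refine le_of_tendsto (h1.mono_left (nhdsWithin_mono (s := Iio 0) 0 fun s hs => ne_of_lt hs)) ?_
      filter_upwards [nhdsWithin_le_nhds h, self_mem_nhdsWithin] with s h2 hs
      exact div_nonpos_of_nonneg_of_nonpos h2 (le_of_lt hs)
    · refine ge_of_tendsto (h1.mono_left (nhdsWithin_mono (s := Ioi 0) 0 fun s hs => ne_of_gt hs)) ?_
      filter_upwards [nhdsWithin_le_nhds h, self_mem_nhdsWithin] with s h2 hs
      exact div_nonneg h2 (le_of_lt hs)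
  refine ⟨hb0, ?_⟩
  have h2 : Tendsto (fun s : ℝ => f s / s ^ 2) (𝓝[≠] 0) (𝓝 c) := by
    have hc : Tendsto (fun s : ℝ => (f s - (0 + b * s + c * s ^ 2)) / s ^ 2 + c)
        (𝓝[≠] 0) (𝓝 (0 + c)) :=
      (h0.mono_left nhdsWithin_le_nhds).add_const c
    rw [zero_add] at hc
    refine hc.congr' ?_
    filter_upwards [self_mem_nhdsWithin] with s hs
    have : s ≠ 0 := hs
    rw [hb0]; field_simp; ring
  refine ge_of_tendsto h2 ?_
  filter_upwards [nhdsWithin_le_nhds h] with s hs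
  exact div_nonneg hs (sq_nonneg s)

lemma unique (hf : HasJet f a b c) (hf' : HasJet f a' b' c') : a = a' ∧ b = b' ∧ c = c' := by
  have ha : a = a' := tendsto_nhds_unique hf.tendsto hf'.tendsto
  subst ha
  have h1 : HasJet (fun _ => 0) 0 (b - b') (c - c') :=
    ((hf.sub hf').congr_coeff (sub_self a) rfl rfl).congr'
      (Eventually.of_forall fun s => sub_self _)
  have h2 : HasJet (fun _ => 0) 0 (b' - b) (c' - c) :=
    ((hf'.sub hf).congr_coeff (sub_self a) rfl rfl).congr'
      (Eventually.of_forall fun s => sub_self _)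
  have e1 := h1.of_nonneg (Eventually.of_forall fun _ => le_rfl)
  have e2 := h2.of_nonneg (Eventually.of_forall fun _ => le_rfl)
  exact ⟨rfl, by linarith [e1.1], by linarith [e1.2, e2.2]⟩

/-- The expansion of a function whose derivative exists near `0` and is differentiable at `0`. -/
lemma of_hasDerivAt {φ ψ : ℝ → ℝ} {d : ℝ} (h1 : ∀ᶠ s in 𝓝 0, HasDerivAt φ (ψ s) s)
    (h2 : HasDerivAt ψ d 0) : HasJet φ (φ 0) (ψ 0) (d / 2) := by
  rw [HasJet, Asymptotics.isLittleO_iff]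
  intro ε hε
  have h3 := (hasDerivAt_iff_isLittleO.1 h2)
  have h4 := (Asymptotics.isLittleO_iff.1 h3) hε
  obtain ⟨r, hr, hball⟩ := Metric.eventually_nhds_iff_ball.1 (h1.and h4)
  filter_upwards [Metric.ball_mem_nhds (0 : ℝ) hr] with s hs
  rw [Metric.mem_ball, dist_zero_right, Real.norm_eq_abs] at hs
  -- mean value inequality on the interval between `0` and `s`
  have hbd : ∀ x ∈ uIcc 0 s, |x| ≤ |s| := fun x hx => by
    have := abs_sub_left_of_mem_uIcc hx
    simpa using this
  have hder : ∀ x ∈ uIcc 0 s, HasDerivWithinAt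
      (fun x => φ x - (φ 0 + ψ 0 * x + d / 2 * x ^ 2)) (ψ x - (ψ 0 + d * x)) (uIcc 0 s) x := by
    intro x hx
    have hxb : x ∈ Metric.ball (0 : ℝ) r := by
      rw [Metric.mem_ball, dist_zero_right, Real.norm_eq_abs]
      exact (hbd x hx).trans_lt hs
    have hp : HasDerivAt (fun x : ℝ => φ 0 + ψ 0 * x + d / 2 * x ^ 2) (ψ 0 + d * x) x := by
      have := (((hasDerivAt_id x).const_mul (ψ 0)).const_add (φ 0)).add
        (((hasDerivAt_id x).pow 2).const_mul (d / 2))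
      refine this.congr_deriv ?_
      simp; ring
    exact ((hball x hxb).1.sub hp).hasDerivWithinAt
  have hmv := Convex.norm_image_sub_le_of_norm_hasDerivWithin_le (C := ε * |s|) hder
    (fun x hx => by
      have hxb : x ∈ Metric.ball (0 : ℝ) r := by
        rw [Metric.mem_ball, dist_zero_right, Real.norm_eq_abs]
        exact (hbd x hx).trans_lt hs
      have := (hball x hxb).2
      simp only [sub_zero, smul_eq_mul, Real.norm_eq_abs] at this
      rw [Real.norm_eq_abs, show ψ x - (ψ 0 + d * x) = ψ x - ψ 0 - x * d by ring]
      exact this.trans (mul_le_mul_of_nonneg_left (hbd x hx) hε.le))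
    (convex_uIcc 0 s) left_mem_uIcc right_mem_uIcc
  simp only [sub_zero, Real.norm_eq_abs] at hmv ⊢
  rw [abs_pow, pow_two |s|, ← mul_assoc]
  rwa [show φ 0 - (φ 0 + ψ 0 * 0 + d / 2 * 0 ^ 2) = 0 by ring, sub_zero] at hmv

/-- The expansion of a smooth function along a line. -/
lemma of_smoothOn {X : Type*} [NormedAddCommGroup X] [NormedSpace ℝ X] {U : Set X}
    (hU : IsOpen U) {z : X} (hz : z ∈ U) {F : X → ℝ} (hF : ContDiffOn ℝ ∞ F U) (v : X) :
    HasJet (fun s => F (z + s • v)) (F z) (pd v F z) (pd v (pd v F) z / 2) := by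
  have hline : Tendsto (fun s : ℝ => z + s • v) (𝓝 0) (𝓝 z) := by
    have : Continuous fun s : ℝ => z + s • v := by fun_prop
    simpa using this.tendsto 0
  have h1 : ∀ᶠ s in 𝓝 (0 : ℝ), HasDerivAt (fun s : ℝ => F (z + s • v)) (pd v F (z + s • v)) s := by
    filter_upwards [hline (hU.mem_nhds hz)] with s hs
    exact hasDerivAt_along_line v _ (differentiableAt_of_smoothOn hU hF hs) rfl
  have h2 : HasDerivAt (fun s : ℝ => pd v F (z + s • v)) (pd v (pd v F) z) 0 :=
    hasDerivAt_along_line v _ (differentiableAt_of_smoothOn hU (pd_smoothOn hU hF v) hz)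
      (by simp)
  have := of_hasDerivAt h1 h2
  simpa using this

end HasJet

/-! ### The contracted Simons inequality in graph coordinates -/

section Graph

open Matrix

variable {n k : ℕ} {ρ : ℝ} {X : Type*} [NormedAddCommGroup X] [NormedSpace ℝ X]

/-- The matrix `⟨∂_p f, ∂_q f⟩` of the metric induced by `f`, for the derivatives in the directions
`b p`. -/
def paramMetric {V : Type*} [NormedAddCommGroup V] [InnerProductSpace ℝ V]
    (b : Fin n → X) (f : X → V) (z : X) : Matrix (Fin n) (Fin n) ℝ :=
  Matrix.of fun p q => inner ℝ (pd (b p) f z) (pd (b q) f z)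

/-- The matrix `-⟨∂_p ∂_q f, ν⟩` of the second fundamental form of `f`, for the derivatives in the
directions `b p`. -/
def paramSff {V : Type*} [NormedAddCommGroup V] [InnerProductSpace ℝ V]
    (b : Fin n → X) (f ν : X → V) (z : X) : Matrix (Fin n) (Fin n) ℝ :=
  Matrix.of fun p q => -inner ℝ (pd (b p) (pd (b q) f) z) (ν z)

lemma orthonormal_expansion {τ : Fin n → EuclideanSpace ℝ (Fin (n + 1))} (hτ : Orthonormal ℝ τ)
    {ν : EuclideanSpace ℝ (Fin (n + 1))} (hν : ‖ν‖ = 1) (hτν : ∀ i, inner ℝ (τ i) ν = 0)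
    (x : EuclideanSpace ℝ (Fin (n + 1))) :
    x = inner ℝ ν x • ν + ∑ i, inner ℝ (τ i) x • τ i := by
  have hv : Orthonormal ℝ (Fin.cons ν τ : Fin (n + 1) → EuclideanSpace ℝ (Fin (n + 1))) := by
    constructor
    · intro i
      refine Fin.cases ?_ (fun i => ?_) i
      · simpa using hν
      · simpa using hτ.1 i
    · intro i
      refine Fin.cases (fun j => ?_) (fun i j => ?_) i
      · refine Fin.cases (fun h => absurd rfl h) (fun j _ => ?_) j
        simpa [real_inner_comm] using hτν j
      · refine Fin.cases (fun _ => ?_) (fun j hij => ?_) j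
        · simpa using hτν i
        · simpa using hτ.2 (fun h => hij (by rw [h]))
  let B := (basisOfOrthonormalOfCardEqFinrank hv (by simp)).toOrthonormalBasis
    (by simpa using hv)
  have := (B.sum_repr' x).symm
  rw [Fin.sum_univ_succ] at this
  simpa [B] using this

lemma inner_eq_sum_of_orthonormal {τ : Fin n → EuclideanSpace ℝ (Fin (n + 1))}
    (hτ : Orthonormal ℝ τ) {ν : EuclideanSpace ℝ (Fin (n + 1))} (hν : ‖ν‖ = 1)
    (hτν : ∀ i, inner ℝ (τ i) ν = 0) (x y : EuclideanSpace ℝ (Fin (n + 1))) :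
    inner ℝ x y = inner ℝ ν x * inner ℝ ν y + ∑ i, inner ℝ (τ i) x * inner ℝ (τ i) y := by
  conv_lhs => rw [orthonormal_expansion hτ hν hτν x]
  rw [inner_add_left, sum_inner, real_inner_smul_left]
  simp_rw [real_inner_smul_left]

/-- The shape operator of a graph in the orthonormal frame `e = g^{-1/2}`. Here `v` is the gradient
and `q` the Hessian of the height function, `σ = (1 + |v|²)^{-1/2}`, so that `g = 1 + v vᵀ`,
`h = σ q` and `e = 1 - σ² / (1 + σ) v vᵀ`. -/
def graphShape (v : Fin n → ℝ) (q : Matrix (Fin n) (Fin n) ℝ) (σ : ℝ) :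
    Matrix (Fin n) (Fin n) ℝ :=
  (1 - (σ ^ 2 / (1 + σ)) • Matrix.vecMulVec v v) * (σ • q)
    * (1 - (σ ^ 2 / (1 + σ)) • Matrix.vecMulVec v v)

lemma graphFrame_isSymm (v : Fin n → ℝ) (c : ℝ) :
    (1 - c • Matrix.vecMulVec v v : Matrix (Fin n) (Fin n) ℝ)ᵀ = 1 - c • Matrix.vecMulVec v v := by
  ext i j
  simp [Matrix.vecMulVec_apply, Matrix.one_apply, mul_comm, eq_comm]

lemma graphShape_isSymm (v : Fin n → ℝ) {q : Matrix (Fin n) (Fin n) ℝ} (hq : q.IsSymm) (σ : ℝ) :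
    (graphShape v q σ).IsSymm := by
  rw [Matrix.IsSymm, graphShape, Matrix.transpose_mul, Matrix.transpose_mul, graphFrame_isSymm,
    Matrix.transpose_smul, hq, Matrix.mul_assoc]

lemma graphFrame_mul_metric_mul (v : Fin n → ℝ) {σ : ℝ} (hσ : 0 < σ)
    (h : σ ^ 2 * (1 + ∑ i, v i ^ 2) = 1) :
    (1 - (σ ^ 2 / (1 + σ)) • Matrix.vecMulVec v v) * (1 + Matrix.vecMulVec v v)
      * (1 - (σ ^ 2 / (1 + σ)) • Matrix.vecMulVec v v) = 1 := by
  set c := σ ^ 2 / (1 + σ) with hc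
  set A := Matrix.vecMulVec v v with hA
  set P := ∑ i, v i ^ 2 with hP
  have hAA : A * A = P • A := by
    rw [hA, Matrix.vecMulVec_mul_vecMulVec]
    ext i j
    simp only [Matrix.vecMulVec_apply, Matrix.smul_apply, smul_eq_mul, dotProduct, Pi.smul_apply]
    rw [hP, ← Finset.sum_congr rfl fun i _ => sq (v i)]
    ring_nf
  have hcoef : 1 - 2 * c - 2 * c * P + c ^ 2 * P + c ^ 2 * P ^ 2 = 0 := by
    have h1 : P = 1 / σ ^ 2 - 1 := by field_simp; linarith
    have h2 : 1 + σ ≠ 0 := by positivity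
    rw [h1, hc]; field_simp; ring
  have hexp : (1 - c • A) * (1 + A) * (1 - c • A)
      = 1 + (1 - 2 * c - 2 * c * P + c ^ 2 * P + c ^ 2 * P ^ 2) • A := by
    simp only [Matrix.sub_mul, Matrix.mul_sub, Matrix.mul_add, Matrix.add_mul, Matrix.one_mul,
      Matrix.mul_one, Matrix.smul_mul, Matrix.mul_smul, hAA]
    module
  rw [hexp, hcoef, zero_smul, add_zero]

lemma charpoly_graph_eq (v : Fin n → ℝ) (q : Matrix (Fin n) (Fin n) ℝ) {σ : ℝ} (hσ : 0 < σ)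
    (h : σ ^ 2 * (1 + ∑ i, v i ^ 2) = 1) :
    ((1 + Matrix.vecMulVec v v)⁻¹ * (σ • q)).charpoly = (graphShape v q σ).charpoly := by
  have h1 := graphFrame_mul_metric_mul v hσ h
  set e := (1 - (σ ^ 2 / (1 + σ)) • Matrix.vecMulVec v v) with he
  have h2 : (1 + Matrix.vecMulVec v v)⁻¹ = e * e := by
    apply Matrix.inv_eq_left_inv
    rw [Matrix.mul_assoc] at h1
    have := mul_eq_one_comm.1 h1
    rw [Matrix.mul_assoc] at this
    exact mul_eq_one_comm.1 this
  rw [h2, graphShape, ← he, Matrix.mul_assoc, Matrix.charpoly_mul_comm]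

lemma graphShape_diag (v : Fin n → ℝ) {q : Matrix (Fin n) (Fin n) ℝ} (hq : q.IsSymm) (σ : ℝ)
    (i : Fin n) : graphShape v q σ i i = σ * q i i
      - 2 * (σ * (σ ^ 2 / (1 + σ)) * (v i * ∑ j, q i j * v j))
      + σ * (σ ^ 2 / (1 + σ)) ^ 2 * (v i * v i * ∑ l, v l * ∑ j, q l j * v j) := by
  set c := σ ^ 2 / (1 + σ) with hc
  have hL : ∀ (N : Matrix (Fin n) (Fin n) ℝ) (i j : Fin n),
      ((1 - c • Matrix.vecMulVec v v) * N) i j = N i j - c * (v i * ∑ l, v l * N l j) := by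
    intro N i j
    rw [Matrix.sub_mul, Matrix.one_mul, Matrix.sub_apply, Matrix.smul_mul, Matrix.smul_apply,
      Matrix.mul_apply, Finset.mul_sum]
    simp [Matrix.vecMulVec_apply, mul_assoc]
  have hR : ∀ (N : Matrix (Fin n) (Fin n) ℝ) (i j : Fin n),
      (N * (1 - c • Matrix.vecMulVec v v)) i j = N i j - c * ((∑ l, N i l * v l) * v j) := by
    intro N i j
    rw [Matrix.mul_sub, Matrix.mul_one, Matrix.sub_apply, Matrix.mul_smul, Matrix.smul_apply,
      Matrix.mul_apply, Finset.sum_mul]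
    simp [Matrix.vecMulVec_apply, mul_assoc]
  have hsym : ∀ a b, q a b = q b a := fun a b => hq.apply b a
  have h1 : ∑ l, v l * (σ * q l i) = σ * ∑ j, q i j * v j := by
    rw [Finset.mul_sum]
    exact Finset.sum_congr rfl fun l _ => by rw [hsym l i]; ring
  have h2 : ∑ j, (σ * q i j - c * (v i * ∑ l, v l * (σ * q l j))) * v j
      = σ * (∑ j, q i j * v j) - c * (v i * (σ * ∑ l, v l * ∑ j, q l j * v j)) := by
    simp_rw [sub_mul, Finset.sum_sub_distrib]
    congr 1
    · rw [Finset.mul_sum]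
      exact Finset.sum_congr rfl fun l _ => by ring
    · simp only [Finset.mul_sum, Finset.sum_mul]
      rw [Finset.sum_comm]
      exact Finset.sum_congr rfl fun l _ => Finset.sum_congr rfl fun j _ => by ring
  rw [graphShape, ← hc, hR]
  simp only [hL, Matrix.smul_apply, smul_eq_mul]
  rw [h2, h1]
  ring

/-- Second-order expansion of the diagonal entries of `graphShape` along the `m`-th coordinate
direction, at a point where the gradient vanishes and the Hessian is diagonal. -/
lemma hasJet_graphShape {v : ℝ → Fin n → ℝ} {q : ℝ → Matrix (Fin n) (Fin n) ℝ} {σ : ℝ → ℝ}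
    {lam : Fin n → ℝ} {m i : Fin n} {Q : ℝ}
    {w₁ w₂ : ℝ} {v₂ : Fin n → ℝ} {q₁ q₂ : Fin n → Fin n → ℝ}
    (hq : ∀ᶠ s in 𝓝 0, (q s).IsSymm)
    (hσ : HasJet σ 1 w₁ w₂)
    (hc : ∃ c₁ c₂, HasJet (fun s => σ s ^ 2 / (1 + σ s)) (1 / 2) c₁ c₂)
    (h : ∀ᶠ s in 𝓝 0, σ s ^ 2 * (1 + ∑ j, v s j ^ 2) = 1)
    (hv : ∀ j, HasJet (fun s => v s j) 0 (if j = m then lam m else 0) (v₂ j))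
    (hqj : ∀ j l, HasJet (fun s => q s j l) (if j = l then lam j else 0) (q₁ j l) (q₂ j l))
    (hQ : q₂ i i = Q / 2) :
    ∃ β, HasJet (fun s => graphShape (v s) (q s) (σ s) i i) (lam i) β
      (Q / 2 - lam i * lam m ^ 2 / 2 - if i = m then lam m ^ 3 else 0) := by
  obtain ⟨c₁, c₂, hc⟩ := hc
  have hv2 : HasJet (fun s => ∑ j, v s j * v s j) 0 0 (lam m ^ 2) := by
    refine (HasJet.sum Finset.univ fun j _ => (hv j).mul (hv j)).congr_coeff ?_ ?_ ?_
    · simp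
    · simp
    · rw [Finset.sum_eq_single m]
      · simp; ring
      · intro j _ hj; simp [hj]
      · simp
  -- the constraint `σ² (1 + |v|²) = 1` determines the expansion of `σ`
  have hone := (((hσ.mul hσ).mul ((HasJet.const 1).add hv2)).congr'
    (g := fun _ => 1) (by
      filter_upwards [h] with s hs
      simp only [← sq]
      exact hs)).unique (HasJet.const 1)
  have hw₁ : w₁ = 0 := by
    have := hone.2.1
    simp only [mul_one, one_mul, add_zero, mul_zero, zero_add] at this
    linarith
  have hw₂ : w₂ = -lam m ^ 2 / 2 := by
    have := hone.2.2
    rw [hw₁] at this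
    simp only [mul_one, one_mul, add_zero, mul_zero, zero_add] at this
    linarith
  have hqv : ∀ l, HasJet (fun s => ∑ j, q s l j * v s j) 0 (if l = m then lam m * lam m else 0)
      (∑ j, ((if l = j then lam l else 0) * v₂ j
        + q₁ l j * (if j = m then lam m else 0) + q₂ l j * 0)) := by
    intro l
    refine (HasJet.sum Finset.univ fun j _ => (hqj l j).mul (hv j)).congr_coeff ?_ ?_ rfl
    · simp
    · rw [Finset.sum_eq_single l]
      · by_cases hl : l = m <;> simp [hl]
      · intro j _ hj; simp [hj.symm]
      · simp
  have hvqv : HasJet (fun s => ∑ l, v s l * ∑ j, q s l j * v s j) 0 0 _ :=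
    (HasJet.sum Finset.univ fun l _ => (hv l).mul (hqv l)).congr_coeff (by simp) (by simp) rfl
  have hi := hv i
  have j1 := hσ.mul (hqj i i)
  have j2 := ((hσ.mul hc).mul (hi.mul (hqv i))).const_mul 2
  have j3 := (hσ.mul (hc.mul hc)).mul ((hi.mul hi).mul hvqv)
  refine ⟨_, ((j1.sub j2).add j3).congr' (g := fun s => graphShape (v s) (q s) (σ s) i i) ?_
    |>.congr_coeff ?_ rfl ?_⟩
  · filter_upwards [hq] with s hs
    rw [graphShape_diag _ hs]; ring
  · simp
  · rw [hw₂, hw₁, hQ]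
    by_cases him : i = m
    · subst him; simp; ring
    · simp [him]; ring

end Graph

section Simons

open Matrix

variable {n k : ℕ} {ρ : ℝ} {X : Type*} [NormedAddCommGroup X] [NormedSpace ℝ X]

lemma sortedEigenvalues_congr {W W' : Matrix (Fin n) (Fin n) ℝ} (h : W.charpoly = W'.charpoly) :
    sortedEigenvalues W = sortedEigenvalues W' := by
  unfold sortedEigenvalues; rw [h]

lemma gammaMatrix_congr {W W' : Matrix (Fin n) (Fin n) ℝ} (h : W.charpoly = W'.charpoly) :
    gammaMatrix k ρ W = gammaMatrix k ρ W' := by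
  unfold gammaMatrix; rw [sortedEigenvalues_congr h]

lemma trace_congr_of_charpoly {W W' : Matrix (Fin n) (Fin n) ℝ} (h : W.charpoly = W'.charpoly) :
    W.trace = W'.trace := by
  rcases Nat.eq_zero_or_pos n with rfl | hn
  · simp [Matrix.trace]
  · have : Nonempty (Fin n) := ⟨⟨0, hn⟩⟩
    rw [Matrix.trace_eq_neg_charpoly_coeff, h, ← Matrix.trace_eq_neg_charpoly_coeff]

lemma pd_pd_pd_comm {O : Set X} (hO : IsOpen O) {u : X → ℝ} (hu : ContDiffOn ℝ ∞ u O) (v w : X) :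
    EqOn (pd v (pd w (pd w u))) (pd w (pd w (pd v u))) O := by
  have h1 : EqOn (pd v (pd w (pd w u))) (pd w (pd v (pd w u))) O :=
    fun z hz => pd_comm hO (pd_smoothOn hO hu w) v w hz
  have h2 : EqOn (pd v (pd w u)) (pd w (pd v u)) O := fun z hz => pd_comm hO hu v w hz
  exact fun z hz => (h1 hz).trans (pd_congr hO h2 w hz)

lemma pd_four_comm {O : Set X} (hO : IsOpen O) {u : X → ℝ} (hu : ContDiffOn ℝ ∞ u O) (v w : X) :
    EqOn (pd v (pd v (pd w (pd w u)))) (pd w (pd w (pd v (pd v u)))) O := fun _ hz =>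
  (pd_congr hO (pd_pd_pd_comm hO hu v w) v hz).trans
    (pd_pd_pd_comm hO (pd_smoothOn hO hu v) v w hz)

/-- The algebra behind the contracted Simons inequality: with
`∂_m ∂_m S_ii = Q_im - λ_i λ_m² - 2 δ_im λ_m³` and `Q` symmetric, the commutator
`∂_m ∂_m S_ii - ∂_i ∂_i S_mm` is `λ_i λ_m (λ_i - λ_m)`. -/
lemma simons_algebra {a lam D : Fin n → ℝ} {Q : Fin n → Fin n → ℝ} {G₀ m : ℝ}
    (hQ : ∀ i j, Q i j = Q j i) (ha : ∀ i, 0 ≤ a i) (hG : ∑ i, a i * lam i = G₀)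
    (hH : ∑ i, lam i = m * G₀)
    (hup : ∀ j, D j / 2 ≤ ∑ i, a i * (Q i j / 2 - lam i * lam j ^ 2 / 2
      - if i = j then lam j ^ 3 else 0))
    (hlow : ∀ j, ∑ i, (Q i j / 2 - lam i * lam j ^ 2 / 2 - if i = j then lam j ^ 3 else 0)
      ≤ m * (D j / 2)) :
    ∑ j, D j + (∑ j, lam j ^ 2) * G₀ ≤ m * (∑ j, a j * D j + G₀ * ∑ j, a j * lam j ^ 2) := by
  let T : Fin n → Fin n → ℝ := fun i j =>
    Q i j / 2 - lam i * lam j ^ 2 / 2 - if i = j then lam j ^ 3 else 0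
  have h1 : ∑ j, D j ≤ 2 * ∑ i, ∑ j, a i * T i j := by
    rw [Finset.sum_comm, Finset.mul_sum]
    exact Finset.sum_le_sum fun j _ => by have := hup j; simp only [T]; linarith
  have h2 : 2 * ∑ i, ∑ j, a i * T j i ≤ m * ∑ j, a j * D j := by
    rw [Finset.mul_sum, Finset.mul_sum]
    refine Finset.sum_le_sum fun j _ => ?_
    rw [← Finset.mul_sum]
    have := mul_le_mul_of_nonneg_left (hlow j) (ha j)
    simp only [T]
    linarith
  have h3 : ∑ i, ∑ j, a i * T i j - ∑ i, ∑ j, a i * T j i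
      = (1 / 2) * ((∑ i, a i * lam i ^ 2) * ∑ j, lam j
        - (∑ i, a i * lam i) * ∑ j, lam j ^ 2) := by
    rw [Finset.sum_mul_sum, Finset.sum_mul_sum, ← Finset.sum_sub_distrib,
      ← Finset.sum_sub_distrib, Finset.mul_sum]
    refine Finset.sum_congr rfl fun i _ => ?_
    rw [← Finset.sum_sub_distrib, ← Finset.sum_sub_distrib, Finset.mul_sum]
    refine Finset.sum_congr rfl fun j _ => ?_
    simp only [T]
    rw [hQ j i]
    by_cases hij : i = j
    · subst hij; ring
    · simp only [if_neg hij, if_neg (Ne.symm hij)]; ring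
  rw [hG, hH] at h3
  linarith

/-- At a point where `f` is written as a graph over its tangent plane with diagonal Hessian, and
`H - m G` attains its maximum zero, `ΔG + |A|² G ≤ m (γ̇^{pq} ∇_p ∇_q G + γ̇^{pq} A²_{pq} G)`.
Concavity enters through `G ≤ ∑_i γ̇_i S_ii` with equality at the point, Codazzi and Gauss through
the symmetry of the fourth derivatives of the height function. -/
lemma simons_inequality (hk : 1 ≤ k) (hkn : k ≤ n) (hρ : ρ ∈ Ioc (0 : ℝ) 1)
    {O : Set X} (hO : IsOpen O) {z₀ : X} (hz₀ : z₀ ∈ O) (b : Fin n → X)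
    {f ν : X → EuclideanSpace ℝ (Fin (n + 1))} {G : X → ℝ}
    (hf : ContDiffOn ℝ ∞ f O) (hν : ContDiffOn ℝ ∞ ν O) (hG : ContDiffOn ℝ ∞ G O)
    (hnorm : ∀ z ∈ O, ‖ν z‖ = 1) (horth : ∀ z ∈ O, ∀ p, inner ℝ (pd (b p) f z) (ν z) = 0)
    {τ : Fin n → EuclideanSpace ℝ (Fin (n + 1))} (hτ : Orthonormal ℝ τ)
    (hτν : ∀ i, inner ℝ (τ i) (ν z₀) = 0)
    (hgraph : ∀ z ∈ O, ∀ p i, inner ℝ (τ i) (pd (b p) f z) = if i = p then 1 else 0)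
    {lam : Fin n → ℝ} (hh : paramSff b f ν z₀ = Matrix.diagonal lam)
    (hcone : ∀ z ∈ O, sortedEigenvalues ((paramMetric b f z)⁻¹ * paramSff b f ν z)
      ∈ kPositiveCone n k)
    (hGeq : ∀ z ∈ O, G z = gammaMatrix k ρ ((paramMetric b f z)⁻¹ * paramSff b f ν z))
    {m : ℝ} (hmax : ∀ z ∈ O, ((paramMetric b f z)⁻¹ * paramSff b f ν z).trace ≤ m * G z)
    (hmax₀ : ((paramMetric b f z₀)⁻¹ * paramSff b f ν z₀).trace = m * G z₀) :
    ∑ p, pd (b p) (pd (b p) G) z₀ + (∑ p, lam p ^ 2) * G z₀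
      ≤ m * (∑ p, gammaGrad k ρ lam p * pd (b p) (pd (b p) G) z₀
        + G z₀ * ∑ p, gammaGrad k ρ lam p * lam p ^ 2) := by
  set ν₀ := ν z₀ with hν₀
  have hν₀1 : ‖ν₀‖ = 1 := hnorm z₀ hz₀
  set u : X → ℝ := fun z => -inner ℝ (f z) ν₀ with hu
  set v : X → Fin n → ℝ := fun z i => pd (b i) u z with hv
  set q : X → Matrix (Fin n) (Fin n) ℝ := fun z => Matrix.of fun i j => pd (b i) (pd (b j) u) z
    with hq
  set σ : X → ℝ := fun z => inner ℝ (ν z) ν₀ with hσdef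
  have smu : ContDiffOn ℝ ∞ u O := (hf.inner ℝ contDiffOn_const).neg
  have smv : ∀ i, ContDiffOn ℝ ∞ (fun z => v z i) O := fun i => pd_smoothOn hO smu (b i)
  have smq : ∀ i j, ContDiffOn ℝ ∞ (fun z => q z i j) O := fun i j =>
    pd_smoothOn hO (smv j) (b i)
  have smσ : ContDiffOn ℝ ∞ σ O := hν.inner ℝ contDiffOn_const
  have pd_inner_const : ∀ {F : X → EuclideanSpace ℝ (Fin (n + 1))} (_ : ContDiffOn ℝ ∞ F O)
      (w : EuclideanSpace ℝ (Fin (n + 1))) (d : X) (z : X), z ∈ O →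
      pd d (fun z => inner ℝ w (F z)) z = inner ℝ w (pd d F z) := by
    intro F hF w d z hz
    rw [pd_inner (differentiableAt_const w) (differentiableAt_of_smoothOn hO hF hz), pd_const]
    simp
  have hueq : u = fun z => inner ℝ (-ν₀) (f z) := by
    funext z; simp only [hu, inner_neg_left, real_inner_comm]
  have hvf : ∀ z ∈ O, ∀ p, inner ℝ ν₀ (pd (b p) f z) = -v z p := by
    intro z hz p
    simp only [hv, hueq]
    rw [pd_inner_const hf _ _ z hz, inner_neg_left, neg_neg]
  have hqf : ∀ z ∈ O, ∀ p r, inner ℝ ν₀ (pd (b p) (pd (b r) f) z) = -q z p r := by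
    intro z hz p r
    have h1 : EqOn (fun z => v z r) (fun z => inner ℝ (-ν₀) (pd (b r) f z)) O := by
      intro y hy
      simp only [inner_neg_left, hvf y hy r, neg_neg]
    have h2 := pd_congr hO h1 (b p) hz
    rw [pd_inner_const (pd_smoothOn hO hf (b r)) _ _ z hz, inner_neg_left] at h2
    have h3 : q z p r = pd (b p) (fun z => v z r) z := rfl
    rw [h3, h2, neg_neg]
  have hτf : ∀ z ∈ O, ∀ i p r, inner ℝ (τ i) (pd (b p) (pd (b r) f) z) = 0 := by
    intro z hz i p r
    have h1 : EqOn (fun z => inner ℝ (τ i) (pd (b r) f z)) (fun _ => if i = r then (1 : ℝ) else 0)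
        O := fun y hy => hgraph y hy r i
    have h2 := pd_congr hO h1 (b p) hz
    rwa [pd_inner_const (pd_smoothOn hO hf (b r)) _ _ z hz, pd_const] at h2
  have parseval := inner_eq_sum_of_orthonormal hτ hν₀1 hτν
  have hσ' : ∀ z, inner ℝ ν₀ (ν z) = σ z := fun z => real_inner_comm _ _
  have hmetric : ∀ z ∈ O, paramMetric b f z = 1 + Matrix.vecMulVec (v z) (v z) := by
    intro z hz
    ext p r
    rw [paramMetric, Matrix.of_apply, parseval, hvf z hz, hvf z hz, Matrix.add_apply,
      Matrix.vecMulVec_apply, Matrix.one_apply]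
    simp_rw [hgraph z hz]
    simp [add_comm, eq_comm]
  have hsff : ∀ z ∈ O, paramSff b f ν z = σ z • q z := by
    intro z hz
    ext p r
    rw [paramSff, Matrix.of_apply, parseval, hqf z hz, hσ', Matrix.smul_apply, smul_eq_mul]
    simp_rw [hτf z hz]
    simp [mul_comm]
  have hτν' : ∀ z ∈ O, ∀ p, inner ℝ (τ p) (ν z) = v z p * σ z := by
    intro z hz p
    have h1 := horth z hz p
    rw [parseval, hvf z hz, hσ'] at h1
    simp_rw [hgraph z hz] at h1
    simp at h1
    linarith
  have hconstr : ∀ z ∈ O, σ z ^ 2 * (1 + ∑ i, v z i ^ 2) = 1 := by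
    intro z hz
    have h1 : inner ℝ (ν z) (ν z) = (1 : ℝ) := by
      rw [real_inner_self_eq_norm_sq, hnorm z hz, one_pow]
    rw [parseval, hσ'] at h1
    simp_rw [hτν' z hz] at h1
    refine Eq.trans ?_ h1
    rw [mul_add, Finset.mul_sum, mul_one, sq]
    congr 1
    exact Finset.sum_congr rfl fun i _ => by ring
  have hσ0 : σ z₀ = 1 := by
    simp only [hσdef, ← hν₀]
    rw [real_inner_self_eq_norm_sq, hν₀1, one_pow]
  have hv0 : ∀ i, v z₀ i = 0 := by
    intro i
    have h1 := horth z₀ hz₀ i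
    rw [real_inner_comm, ← hν₀, hvf z₀ hz₀] at h1
    linarith
  have hq0 : q z₀ = Matrix.diagonal lam := by
    rw [← hh, hsff z₀ hz₀, hσ0, one_smul]
  have hqsymm : ∀ z ∈ O, (q z).IsSymm := by
    intro z hz
    ext i j
    exact pd_comm hO smu (b j) (b i) hz
  -- restrict to a neighbourhood where `σ > 0`
  set O' := O ∩ σ ⁻¹' Ioi 0 with hO'def
  have hO' : IsOpen O' := smσ.continuousOn.isOpen_inter_preimage hO isOpen_Ioi
  have hO'O : O' ⊆ O := inter_subset_left
  have hz₀' : z₀ ∈ O' := ⟨hz₀, by simp [hσ0]⟩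
  have hch : ∀ z ∈ O', ((paramMetric b f z)⁻¹ * paramSff b f ν z).charpoly
      = (graphShape (v z) (q z) (σ z)).charpoly := by
    intro z hz
    rw [hmetric z hz.1, hsff z hz.1]
    exact charpoly_graph_eq _ _ hz.2 (hconstr z hz.1)
  have hS0 : graphShape (v z₀) (q z₀) (σ z₀) = Matrix.diagonal lam := by
    have : v z₀ = 0 := funext hv0
    rw [graphShape, this, hσ0, hq0]
    simp
  have hlam : lam ∈ kPositiveCone n k := by
    have h1 := hcone z₀ hz₀
    rwa [sortedEigenvalues_mem_cone_iff (by rw [hch z₀ hz₀', hS0])] at h1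
  set a := gammaGrad k ρ lam with ha
  have hG0 : G z₀ = ∑ i, a i * lam i := by
    rw [hGeq z₀ hz₀, gammaSpeed_sortedEigenvalues (by rw [hch z₀ hz₀', hS0]),
      sum_gammaGrad_mul_self hk hkn hρ hlam]
  have htr : ∀ z ∈ O', ∑ i, graphShape (v z) (q z) (σ z) i i ≤ m * G z := by
    intro z hz
    have := hmax z hz.1
    rwa [trace_congr_of_charpoly (hch z hz)] at this
  have htr0 : ∑ i, lam i = m * G z₀ := by
    rw [← hmax₀, trace_congr_of_charpoly (hch z₀ hz₀'), hS0, Matrix.trace_diagonal]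
  have hGle : ∀ z ∈ O', G z ≤ ∑ i, a i * graphShape (v z) (q z) (σ z) i i := by
    intro z hz
    rw [hGeq z hz.1, gammaMatrix_congr (hch z hz)]
    have h1 := hcone z hz.1
    rw [sortedEigenvalues_congr (hch z hz)] at h1
    have := gammaMatrix_le hk hkn hρ (graphShape_isSymm (v z) (hqsymm z hz.1) (σ z)) h1
      (U := 1) (by simp) hlam
    simpa using this
  have hline : ∀ j, Tendsto (fun s : ℝ => z₀ + s • b j) (𝓝 0) (𝓝 z₀) := by
    intro j
    have : Continuous fun s : ℝ => z₀ + s • b j := by fun_prop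
    simpa using this.tendsto 0
  have hev : ∀ j, ∀ᶠ s in 𝓝 (0 : ℝ), z₀ + s • b j ∈ O' := fun j =>
    hline j (hO'.mem_nhds hz₀')
  let Q : Fin n → Fin n → ℝ := fun i j => pd (b j) (pd (b j) (pd (b i) (pd (b i) u))) z₀
  have hQs : ∀ i j, Q i j = Q j i := fun i j => pd_four_comm hO smu (b j) (b i) hz₀
  have smc : ContDiffOn ℝ ∞ (fun z => σ z ^ 2 / (1 + σ z)) O' := by
    have h1 := smσ.mono hO'O
    refine (h1.pow 2).div (contDiffOn_const.add h1) fun z hz => ?_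
    have : 0 < σ z := hz.2
    positivity
  have hjet : ∀ i j, ∃ β, HasJet
      (fun s => graphShape (v (z₀ + s • b j)) (q (z₀ + s • b j)) (σ (z₀ + s • b j)) i i) (lam i) β
      (Q i j / 2 - lam i * lam j ^ 2 / 2 - if i = j then lam j ^ 3 else 0) := by
    intro i j
    refine hasJet_graphShape (v := fun s => v (z₀ + s • b j)) (q := fun s => q (z₀ + s • b j))
      (σ := fun s => σ (z₀ + s • b j))
      (w₁ := pd (b j) σ z₀) (w₂ := pd (b j) (pd (b j) σ) z₀ / 2)
      (v₂ := fun l => pd (b j) (pd (b j) (fun z => v z l)) z₀ / 2)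
      (q₁ := fun l r => pd (b j) (fun z => q z l r) z₀)
      (q₂ := fun l r => pd (b j) (pd (b j) (fun z => q z l r)) z₀ / 2) ?_ ?_ ?_ ?_ ?_ ?_ rfl
    · filter_upwards [hev j] with s hs using hqsymm _ hs.1
    · exact (HasJet.of_smoothOn hO hz₀ smσ (b j)).congr_coeff hσ0 rfl rfl
    · exact ⟨_, _, (HasJet.of_smoothOn hO' hz₀' smc (b j)).congr_coeff
        (by rw [hσ0]; norm_num) rfl rfl⟩
    · filter_upwards [hev j] with s hs using hconstr _ hs.1
    · intro l
      refine (HasJet.of_smoothOn hO hz₀ (smv l) (b j)).congr_coeff (hv0 l) ?_ rfl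
      have h1 : pd (b j) (fun z => v z l) z₀ = q z₀ j l := rfl
      rw [h1, hq0, Matrix.diagonal_apply]
      by_cases hl : l = j
      · subst hl; simp
      · simp [hl, Ne.symm hl]
    · intro l r
      refine (HasJet.of_smoothOn hO hz₀ (smq l r) (b j)).congr_coeff ?_ rfl rfl
      rw [hq0, Matrix.diagonal_apply]
  choose β hβ using hjet
  have hjG := fun j => HasJet.of_smoothOn hO hz₀ hG (b j)
  refine simons_algebra (Q := Q) hQs (fun i => (gammaGrad_pos hk hkn hρ hlam i).le) hG0.symm htr0
    (fun j => ?_) fun j => ?_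
  · have h1 := (((HasJet.sum Finset.univ fun i _ => (hβ i j).const_mul (a i)).sub
      (hjG j)).congr_coeff (a' := 0) (by rw [hG0, sub_self]) rfl rfl).of_nonneg (by
        filter_upwards [hev j] with s hs using sub_nonneg.2 (hGle _ hs))
    linarith [h1.2]
  · have h1 := ((((hjG j).const_mul m).sub
      (HasJet.sum Finset.univ fun i _ => hβ i j)).congr_coeff (a' := 0)
        (by rw [htr0, sub_self]) rfl rfl).of_nonneg (by
        filter_upwards [hev j] with s hs using sub_nonneg.2 (htr _ hs))
    linarith [h1.2]

end Simons

/-! ### Evolution of the curvature at a point -/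

section Evolution

open Matrix

variable {n k : ℕ} {ρ : ℝ} {X : Type*} [NormedAddCommGroup X] [NormedSpace ℝ X]

lemma differentiableAt_det {N : ℕ} {A : ℝ → Matrix (Fin N) (Fin N) ℝ} {s₀ : ℝ}
    (hA : ∀ i j, DifferentiableAt ℝ (fun s => A s i j) s₀) :
    DifferentiableAt ℝ (fun s => (A s).det) s₀ := by
  simp only [Matrix.det_apply]
  refine DifferentiableAt.fun_sum fun π _ => DifferentiableAt.const_smul ?_ _
  exact DifferentiableAt.fun_finsetProd fun i _ => hA _ _

lemma differentiableAt_inv_apply {A : ℝ → Matrix (Fin n) (Fin n) ℝ} {s₀ : ℝ}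
    (hA : ∀ i j, DifferentiableAt ℝ (fun s => A s i j) s₀) (hdet : (A s₀).det ≠ 0) (i j : Fin n) :
    DifferentiableAt ℝ (fun s => (A s)⁻¹ i j) s₀ := by
  have h1 : (fun s => (A s)⁻¹ i j) = fun s => ((A s).det)⁻¹ * (A s).adjugate i j := by
    funext s
    rw [Matrix.inv_def, Matrix.smul_apply, Ring.inverse_eq_inv', smul_eq_mul]
  rw [h1]
  refine ((differentiableAt_det hA).inv hdet).mul ?_
  simp only [Matrix.adjugate_apply]
  refine differentiableAt_det fun a c => ?_
  by_cases ha : a = j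
  · subst ha; simp
  · simpa [Matrix.updateRow_ne ha] using hA a c

/-- The derivative of `g⁻¹ h` at a point where `g = 1`. -/
lemma hasDerivAt_inv_mul_apply {g h : ℝ → Matrix (Fin n) (Fin n) ℝ}
    {g' h' : Matrix (Fin n) (Fin n) ℝ} {s₀ : ℝ}
    (hg : ∀ i j, HasDerivAt (fun s => g s i j) (g' i j) s₀)
    (hh : ∀ i j, HasDerivAt (fun s => h s i j) (h' i j) s₀) (h1 : g s₀ = 1) (i j : Fin n) :
    HasDerivAt (fun s => ((g s)⁻¹ * h s) i j) ((h' - g' * h s₀) i j) s₀ := by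
  have hdet : (g s₀).det ≠ 0 := by simp [h1]
  have hinv : ∀ i j, HasDerivAt (fun s => (g s)⁻¹ i j) (deriv (fun s => (g s)⁻¹ i j) s₀) s₀ :=
    fun i j => (differentiableAt_inv_apply (fun a c => (hg a c).differentiableAt) hdet
      i j).hasDerivAt
  have hprod : ∀ (h : ℝ → Matrix (Fin n) (Fin n) ℝ) (h' : Matrix (Fin n) (Fin n) ℝ)
      (_ : ∀ i j, HasDerivAt (fun s => h s i j) (h' i j) s₀) (i j : Fin n),
      HasDerivAt (fun s => ((g s)⁻¹ * h s) i j)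
        (∑ l, deriv (fun s => (g s)⁻¹ i l) s₀ * h s₀ l j + h' i j) s₀ := by
    intro h h' hh i j
    simp only [Matrix.mul_apply]
    have := HasDerivAt.fun_sum (u := Finset.univ) fun l _ => (hinv i l).mul (hh l j)
    refine this.congr_deriv ?_
    rw [Finset.sum_add_distrib, h1, inv_one]
    simp [Matrix.one_apply]
  have hN : ∀ i l, deriv (fun s => (g s)⁻¹ i l) s₀ = -g' i l := by
    intro i l
    have h2 := hprod g g' hg i l
    have h3 : (fun s => ((g s)⁻¹ * g s) i l) =ᶠ[𝓝 s₀]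
        fun _ => (1 : Matrix (Fin n) (Fin n) ℝ) i l := by
      have : ContinuousAt (fun s => (g s).det) s₀ :=
        (differentiableAt_det fun a c => (hg a c).differentiableAt).continuousAt
      filter_upwards [this.eventually_ne hdet] with s hs
      rw [Matrix.nonsing_inv_mul _ (isUnit_iff_ne_zero.2 hs)]
    have h4 := (h2.congr_of_eventuallyEq h3.symm).unique (hasDerivAt_const s₀ _)
    rw [h1] at h4
    simp [Matrix.one_apply] at h4
    linarith
  refine (hprod h h' hh i j).congr_deriv ?_
  simp_rw [hN]
  rw [Matrix.sub_apply, Matrix.mul_apply]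
  simp only [neg_mul, Finset.sum_neg_distrib]
  ring

section TimeDerivative

variable {O : Set X} {z₀ : X} {b : Fin n → X} {T₀ : X}
  {f ν : X → EuclideanSpace ℝ (Fin (n + 1))} {G : X → ℝ} {lam : Fin n → ℝ}

lemma inner_pd_normal_self (hO : IsOpen O) (hν : ContDiffOn ℝ ∞ ν O)
    (hnorm : ∀ z ∈ O, ‖ν z‖ = 1) (d : X) : EqOn (fun z => inner ℝ (pd d ν z) (ν z)) 0 O := by
  intro z hz
  have h1 : EqOn (fun z => inner ℝ (ν z) (ν z)) (fun _ => (1 : ℝ)) O := fun y hy => by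
    simp only [real_inner_self_eq_norm_sq, hnorm y hy, one_pow]
  have h2 := pd_congr hO h1 d hz
  have hd := differentiableAt_of_smoothOn hO hν hz
  rw [pd_inner hd hd, pd_const, real_inner_comm] at h2
  simp only [Pi.zero_apply]
  linarith

lemma inner_pd_normal_pd (hO : IsOpen O) (hf : ContDiffOn ℝ ∞ f O) (hν : ContDiffOn ℝ ∞ ν O)
    (horth : ∀ z ∈ O, ∀ p, inner ℝ (pd (b p) f z) (ν z) = 0) {z : X} (hz : z ∈ O) (p r : Fin n) :
    inner ℝ (pd (b p) ν z) (pd (b r) f z) = paramSff b f ν z p r := by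
  have h1 : EqOn (fun z => inner ℝ (pd (b r) f z) (ν z)) (fun _ => (0 : ℝ)) O :=
    fun y hy => horth y hy r
  have h2 := pd_congr hO h1 (b p) hz
  rw [pd_inner (differentiableAt_of_smoothOn hO (pd_smoothOn hO hf (b r)) hz)
    (differentiableAt_of_smoothOn hO hν hz), pd_const] at h2
  rw [paramSff, Matrix.of_apply, real_inner_comm]
  linarith

/-- `∂_t g_{pq} = -2 G h_{pq}` for a flow `∂_t f = -G ν`. -/
lemma pd_paramMetric (hO : IsOpen O) (hz₀ : z₀ ∈ O) (hf : ContDiffOn ℝ ∞ f O)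
    (hν : ContDiffOn ℝ ∞ ν O) (hG : ContDiffOn ℝ ∞ G O)
    (horth : ∀ z ∈ O, ∀ p, inner ℝ (pd (b p) f z) (ν z) = 0)
    (hflow : ∀ z ∈ O, pd T₀ f z = -G z • ν z)
    (hh : paramSff b f ν z₀ = Matrix.diagonal lam) (p r : Fin n) :
    pd T₀ (fun z => paramMetric b f z p r) z₀ = -2 * G z₀ * Matrix.diagonal lam p r := by
  have hmix : ∀ i, pd T₀ (pd (b i) f) z₀
      = -(G z₀ • pd (b i) ν z₀ + pd (b i) G z₀ • ν z₀) := by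
    intro i
    have h1 : EqOn (pd T₀ f) (fun z => (-G z) • ν z) O := hflow
    rw [pd_comm hO hf T₀ (b i) hz₀, pd_congr hO h1 (b i) hz₀,
      pd_smul (differentiableAt_of_smoothOn hO hG.neg hz₀)
        (differentiableAt_of_smoothOn hO hν hz₀)]
    rw [pd_neg]; module
  have hd : ∀ i, DifferentiableAt ℝ (pd (b i) f) z₀ := fun i =>
    differentiableAt_of_smoothOn hO (pd_smoothOn hO hf (b i)) hz₀
  simp only [paramMetric, Matrix.of_apply]
  rw [pd_inner (hd p) (hd r), hmix, hmix]
  simp only [inner_neg_left, inner_neg_right, inner_add_left, inner_add_right,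
    real_inner_smul_left, real_inner_smul_right]
  rw [real_inner_comm (pd (b r) ν z₀), horth z₀ hz₀ p, real_inner_comm (pd (b r) f z₀) (ν z₀),
    horth z₀ hz₀ r, inner_pd_normal_pd hO hf hν horth hz₀ r p,
    inner_pd_normal_pd hO hf hν horth hz₀ p r, hh, Matrix.diagonal_apply, Matrix.diagonal_apply]
  by_cases hpr : p = r
  · subst hpr; simp; ring
  · simp [hpr, Ne.symm hpr]

/-- `∂_t h_{pq} = ∂_p ∂_q G - G h_{pr} h_{rq}` for a flow `∂_t f = -G ν`, at a point where the metric
is the identity and the second derivatives of `f` are normal. -/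
lemma pd_paramSff (hO : IsOpen O) (hz₀ : z₀ ∈ O) (hf : ContDiffOn ℝ ∞ f O)
    (hν : ContDiffOn ℝ ∞ ν O) (hG : ContDiffOn ℝ ∞ G O) (hnorm : ∀ z ∈ O, ‖ν z‖ = 1)
    (horth : ∀ z ∈ O, ∀ p, inner ℝ (pd (b p) f z) (ν z) = 0)
    (hflow : ∀ z ∈ O, pd T₀ f z = -G z • ν z)
    (hτ : Orthonormal ℝ fun i => pd (b i) f z₀)
    (hnormal : ∀ i p r, inner ℝ (pd (b i) f z₀) (pd (b p) (pd (b r) f) z₀) = 0)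
    (hh : paramSff b f ν z₀ = Matrix.diagonal lam) (p r : Fin n) :
    pd T₀ (fun z => paramSff b f ν z p r) z₀
      = pd (b p) (pd (b r) G) z₀ - G z₀ * Matrix.diagonal (fun i => lam i ^ 2) p r := by
  have hν₀ := hnorm z₀ hz₀
  have hτν : ∀ i, inner ℝ (pd (b i) f z₀) (ν z₀) = 0 := fun i => horth z₀ hz₀ i
  have smνp : ∀ i, ContDiffOn ℝ ∞ (pd (b i) ν) O := fun i => pd_smoothOn hO hν (b i)
  have smGp : ∀ i, ContDiffOn ℝ ∞ (pd (b i) G) O := fun i => pd_smoothOn hO hG (b i)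
  have dν := differentiableAt_of_smoothOn hO hν hz₀
  -- `∂_p ν = h_{pq} ∂_q f`, so `⟨∂_p ν, ∂_q ν⟩ = h_{pr} h_{rq}`
  have hνν : inner ℝ (pd (b p) ν z₀) (pd (b r) ν z₀)
      = Matrix.diagonal (fun i => lam i ^ 2) p r := by
    rw [inner_eq_sum_of_orthonormal hτ hν₀ hτν]
    have h0 : ∀ i, inner ℝ (ν z₀) (pd (b i) ν z₀) = 0 := fun i => by
      rw [real_inner_comm]; exact inner_pd_normal_self hO hν hnorm (b i) hz₀
    have h1 : ∀ i j, inner ℝ (pd (b i) f z₀) (pd (b j) ν z₀) = Matrix.diagonal lam j i := by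
      intro i j
      rw [real_inner_comm, inner_pd_normal_pd hO hf hν horth hz₀, hh]
    simp_rw [h0, h1, Matrix.diagonal_apply]
    by_cases hpr : p = r
    · subst hpr; simp [sq]
    · simp [hpr]
  have hnn : inner ℝ (pd (b p) (pd (b r) ν) z₀) (ν z₀)
      = -Matrix.diagonal (fun i => lam i ^ 2) p r := by
    have h1 := pd_congr hO (inner_pd_normal_self hO hν hnorm (b r)) (b p) hz₀
    rw [pd_inner (differentiableAt_of_smoothOn hO (smνp r) hz₀) dν] at h1
    have h2 : pd (b p) (0 : X → ℝ) z₀ = 0 := pd_const 0 (b p)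
    rw [h2, real_inner_comm, hνν] at h1
    linarith
  have hcomm : pd T₀ (pd (b p) (pd (b r) f)) z₀ = pd (b p) (pd (b r) (pd T₀ f)) z₀ := by
    rw [pd_comm hO (pd_smoothOn hO hf (b r)) T₀ (b p) hz₀]
    exact pd_congr hO (fun y hy => pd_comm hO hf T₀ (b r) hy) (b p) hz₀
  have hfirst : EqOn (pd (b r) (pd T₀ f))
      (fun z => (-G z) • pd (b r) ν z + (-pd (b r) G z) • ν z) O := by
    intro z hz
    have h1 : EqOn (pd T₀ f) (fun z => (-G z) • ν z) O := hflow
    rw [pd_congr hO h1 (b r) hz, pd_smul (differentiableAt_of_smoothOn hO hG.neg hz)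
        (differentiableAt_of_smoothOn hO hν hz)]
    rw [pd_neg]
  have dG : DifferentiableAt ℝ (fun z => -G z) z₀ :=
    (differentiableAt_of_smoothOn hO hG hz₀).neg
  have dGr : DifferentiableAt ℝ (fun z => -pd (b r) G z) z₀ :=
    (differentiableAt_of_smoothOn hO (smGp r) hz₀).neg
  have dνr := differentiableAt_of_smoothOn hO (smνp r) hz₀
  have hsecond : pd (b p) (pd (b r) (pd T₀ f)) z₀
      = -(G z₀ • pd (b p) (pd (b r) ν) z₀ + pd (b p) G z₀ • pd (b r) ν z₀
        + pd (b r) G z₀ • pd (b p) ν z₀ + pd (b p) (pd (b r) G) z₀ • ν z₀) := by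
    rw [pd_congr hO hfirst (b p) hz₀, pd_add (dG.fun_smul dνr) (dGr.fun_smul dν), pd_smul dG dνr,
      pd_smul dGr dν, pd_neg, pd_neg]
    module
  have dsm : DifferentiableAt ℝ (pd (b p) (pd (b r) f)) z₀ :=
    differentiableAt_of_smoothOn hO (pd_smoothOn hO (pd_smoothOn hO hf (b r)) (b p)) hz₀
  simp only [paramSff, Matrix.of_apply]
  rw [pd_neg, pd_inner dsm dν, hcomm, hsecond]
  -- the second derivatives of `f` are normal, `∂_t ν` is tangential
  have hperp : inner ℝ (pd (b p) (pd (b r) f) z₀) (pd T₀ ν z₀) = 0 := by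
    rw [inner_eq_sum_of_orthonormal hτ hν₀ hτν]
    simp_rw [hnormal]
    rw [real_inner_comm (pd T₀ ν z₀) (ν z₀), show inner ℝ (pd T₀ ν z₀) (ν z₀) = 0 from
      inner_pd_normal_self hO hν hnorm T₀ hz₀]
    simp
  have hz : ∀ i, inner ℝ (pd (b i) ν z₀) (ν z₀) = 0 := fun i =>
    inner_pd_normal_self hO hν hnorm (b i) hz₀
  rw [hperp, inner_neg_left]
  simp only [inner_add_left, real_inner_smul_left]
  rw [hnn, hz, hz, real_inner_self_eq_norm_sq, hν₀]
  ring

/-- At a spatial maximum of `H / G` the time derivative of `H - m G`, `m = max H / G`, is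
nonpositive, if the conclusion of the contracted Simons inequality holds there. -/
lemma hasDerivAt_trace_sub_nonpos (hk : 1 ≤ k) (hkn : k ≤ n) (hρ : ρ ∈ Ioc (0 : ℝ) 1)
    (hO : IsOpen O) (hz₀ : z₀ ∈ O) (hf : ContDiffOn ℝ ∞ f O)
    (hν : ContDiffOn ℝ ∞ ν O) (hG : ContDiffOn ℝ ∞ G O) (hnorm : ∀ z ∈ O, ‖ν z‖ = 1)
    (horth : ∀ z ∈ O, ∀ p, inner ℝ (pd (b p) f z) (ν z) = 0)
    (hflow : ∀ z ∈ O, pd T₀ f z = -G z • ν z)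
    (hτ : Orthonormal ℝ fun i => pd (b i) f z₀)
    (hnormal : ∀ i p r, inner ℝ (pd (b i) f z₀) (pd (b p) (pd (b r) f) z₀) = 0)
    (hh : paramSff b f ν z₀ = Matrix.diagonal lam) (hlam : lam ∈ kPositiveCone n k)
    (hreal : ∀ z ∈ O, ∃ μ : Fin n → ℝ,
      ((paramMetric b f z)⁻¹ * paramSff b f ν z).charpoly = (Matrix.diagonal μ).charpoly)
    (hGeq : ∀ z ∈ O, G z = gammaMatrix k ρ ((paramMetric b f z)⁻¹ * paramSff b f ν z))
    {m : ℝ}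
    (hsimons : ∑ p, pd (b p) (pd (b p) G) z₀ + (∑ p, lam p ^ 2) * G z₀
      ≤ m * (∑ p, gammaGrad k ρ lam p * pd (b p) (pd (b p) G) z₀
        + G z₀ * ∑ p, gammaGrad k ρ lam p * lam p ^ 2)) :
    ∃ H' G' : ℝ, HasDerivAt (fun s : ℝ => ((paramMetric b f (z₀ + s • T₀))⁻¹
        * paramSff b f ν (z₀ + s • T₀)).trace) H' 0
      ∧ HasDerivAt (fun s : ℝ => G (z₀ + s • T₀)) G' 0 ∧ H' ≤ m * G' := by
  have hline : Tendsto (fun s : ℝ => z₀ + s • T₀) (𝓝 0) (𝓝 z₀) := by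
    have : Continuous fun s : ℝ => z₀ + s • T₀ := by fun_prop
    simpa using this.tendsto 0
  have hev : ∀ᶠ s in 𝓝 (0 : ℝ), z₀ + s • T₀ ∈ O := hline (hO.mem_nhds hz₀)
  have smg : ∀ p r, ContDiffOn ℝ ∞ (fun z => paramMetric b f z p r) O := fun p r =>
    (pd_smoothOn hO hf (b p)).inner ℝ (pd_smoothOn hO hf (b r))
  have smh : ∀ p r, ContDiffOn ℝ ∞ (fun z => paramSff b f ν z p r) O := fun p r =>
    ((pd_smoothOn hO (pd_smoothOn hO hf (b r)) (b p)).inner ℝ hν).neg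
  have hg1 : paramMetric b f z₀ = 1 := by
    ext p r
    rw [paramMetric, Matrix.of_apply, Matrix.one_apply]
    exact orthonormal_iff_ite.1 hτ p r
  let g' : Matrix (Fin n) (Fin n) ℝ := (-2 * G z₀) • Matrix.diagonal lam
  let h' : Matrix (Fin n) (Fin n) ℝ := Matrix.of fun p r =>
    pd (b p) (pd (b r) G) z₀ - G z₀ * Matrix.diagonal (fun i => lam i ^ 2) p r
  have hgd : ∀ p r, HasDerivAt (fun s : ℝ => paramMetric b f (z₀ + s • T₀) p r) (g' p r) 0 := by
    intro p r
    have := hasDerivAt_along_line T₀ z₀ (differentiableAt_of_smoothOn hO (smg p r) hz₀)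
      (s := 0) (z₀ := z₀) (by simp)
    rw [pd_paramMetric hO hz₀ hf hν hG horth hflow hh] at this
    simpa [g'] using this
  have hhd : ∀ p r, HasDerivAt (fun s : ℝ => paramSff b f ν (z₀ + s • T₀) p r) (h' p r) 0 := by
    intro p r
    have := hasDerivAt_along_line T₀ z₀ (differentiableAt_of_smoothOn hO (smh p r) hz₀)
      (s := 0) (z₀ := z₀) (by simp)
    rw [pd_paramSff hO hz₀ hf hν hG hnorm horth hflow hτ hnormal hh] at this
    simpa [h'] using this
  set W' : Matrix (Fin n) (Fin n) ℝ := Matrix.of fun p r =>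
    pd (b p) (pd (b r) G) z₀ + G z₀ * Matrix.diagonal (fun i => lam i ^ 2) p r with hW'
  have hWd : ∀ p r, HasDerivAt (fun s : ℝ => ((paramMetric b f (z₀ + s • T₀))⁻¹
      * paramSff b f ν (z₀ + s • T₀)) p r) (W' p r) 0 := by
    intro p r
    have := hasDerivAt_inv_mul_apply hgd hhd (by simp [hg1]) p r
    refine this.congr_deriv ?_
    have e1 : g' * paramSff b f ν (z₀ + (0 : ℝ) • T₀)
        = (-2 * G z₀) • Matrix.diagonal (fun i => lam i ^ 2) := by
      rw [zero_smul, add_zero, hh]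
      simp only [g', Matrix.smul_mul, Matrix.diagonal_mul_diagonal, sq]
    rw [Matrix.sub_apply, e1]
    simp only [h', hW', Matrix.of_apply, Matrix.smul_apply, smul_eq_mul]
    ring
  have hW'symm : W'.IsSymm := by
    ext p r
    simp only [hW', Matrix.transpose_apply, Matrix.of_apply]
    rw [pd_comm hO hG (b r) (b p) hz₀]
    congr 2
    by_cases hpr : p = r
    · subst hpr; rfl
    · rw [Matrix.diagonal_apply_ne _ hpr, Matrix.diagonal_apply_ne _ (Ne.symm hpr)]
  have hGd := hasDerivAt_gammaMatrix (ρ := ρ) hk hkn hρ (U := 1) (by simp) hlam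
    (W := fun s : ℝ => (paramMetric b f (z₀ + s • T₀))⁻¹ * paramSff b f ν (z₀ + s • T₀))
    (W' := W') (t₀ := 0) (by simp [hg1, hh]) hWd hW'symm
    (by filter_upwards [hev] with s hs using hreal _ hs)
  have hGd' := hGd.congr_of_eventuallyEq (f₁ := fun s : ℝ => G (z₀ + s • T₀))
    (by filter_upwards [hev] with s hs using hGeq _ hs)
  have hHd : HasDerivAt (fun s : ℝ => ((paramMetric b f (z₀ + s • T₀))⁻¹
        * paramSff b f ν (z₀ + s • T₀)).trace) (∑ p, W' p p) 0 := by
    simp only [Matrix.trace, Matrix.diag_apply]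
    exact HasDerivAt.fun_sum fun p _ => hWd p p
  refine ⟨_, _, hHd, hGd', ?_⟩
  have hWpp : ∀ p, W' p p = pd (b p) (pd (b p) G) z₀ + G z₀ * lam p ^ 2 := by
    intro p; simp [hW']
  simp only [Matrix.transpose_one, Matrix.one_mul, Matrix.mul_one, hWpp]
  simp only [mul_add, Finset.sum_add_distrib]
  rw [Finset.sum_mul, Finset.mul_sum (a := G z₀)] at hsimons
  calc _ = _ := by
        congr 1
        exact Finset.sum_congr rfl fun p _ => mul_comm _ _
    _ ≤ _ := hsimons
    _ = _ := by
        rw [mul_add]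
        congr 2
        exact Finset.sum_congr rfl fun p _ => by ring

end TimeDerivative

end Evolution

section SpaceTime

open Matrix

variable {n k : ℕ} {ρ : ℝ}

/-- The `p`-th coordinate vector. -/
abbrev coordVec (n : ℕ) (p : Fin n) : EuclideanSpace ℝ (Fin n) := EuclideanSpace.single p 1

/-- The `p`-th spatial coordinate vector of space-time. -/
abbrev spaceVec (n : ℕ) (p : Fin n) : EuclideanSpace ℝ (Fin n) × ℝ := (coordVec n p, 0)

lemma pd_slice {Y Z : Type*} [NormedAddCommGroup Y] [NormedSpace ℝ Y] [NormedAddCommGroup Z]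
    [NormedSpace ℝ Z] {f : Y × ℝ → Z} {y : Y} {t : ℝ} (hf : DifferentiableAt ℝ f (y, t)) (d : Y) :
    pd d (fun y => f (y, t)) y = pd (d, 0) f (y, t) := by
  have h1 : HasFDerivAt (fun y : Y => (y, t)) (ContinuousLinearMap.inl ℝ Y ℝ) y := by
    simpa using hasFDerivAt_prodMk_left y t
  have h2 := (hf.hasFDerivAt (x := (y, t))).comp y h1
  simp only [pd]
  have h3 : fderiv ℝ (fun y => f (y, t)) y = _ := h2.fderiv
  rw [h3]
  simp

/-- The maximum principle for `H / G` in coordinates that present the hypersurface at time `t₀` as a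
graph over its tangent plane: at a spatial maximum `m` of `H / G`, `∂_t H ≤ m ∂_t G`. -/
lemma local_maximum_principle (hk : 1 ≤ k) (hkn : k ≤ n) (hρ : ρ ∈ Ioc (0 : ℝ) 1)
    {O : Set (EuclideanSpace ℝ (Fin n) × ℝ)} (hO : IsOpen O) {y₀ : EuclideanSpace ℝ (Fin n)}
    {t₀ : ℝ} (hz₀ : (y₀, t₀) ∈ O)
    {f ν : EuclideanSpace ℝ (Fin n) × ℝ → EuclideanSpace ℝ (Fin (n + 1))}
    {G : EuclideanSpace ℝ (Fin n) × ℝ → ℝ} {lam : Fin n → ℝ}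
    (hf : ContDiffOn ℝ ∞ f O)
    (hν : ContDiffOn ℝ ∞ ν O) (hG : ContDiffOn ℝ ∞ G O) (hnorm : ∀ z ∈ O, ‖ν z‖ = 1)
    (horth : ∀ z ∈ O, ∀ p, inner ℝ (pd (spaceVec n p) f z) (ν z) = 0)
    (hflow : ∀ z ∈ O, pd ((0 : EuclideanSpace ℝ (Fin n)), (1 : ℝ)) f z = -G z • ν z)
    {τ : Fin n → EuclideanSpace ℝ (Fin (n + 1))} (hτ : Orthonormal ℝ τ)
    (hτν : ∀ i, inner ℝ (τ i) (ν (y₀, t₀)) = 0)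
    (hgraph : ∀ y, (y, t₀) ∈ O → ∀ p i,
      inner ℝ (τ i) (pd (spaceVec n p) f (y, t₀)) = if i = p then 1 else 0)
    (hh : paramSff (spaceVec n) f ν (y₀, t₀) = Matrix.diagonal lam)
    (hreal : ∀ z ∈ O, ∃ μ : Fin n → ℝ,
      ((paramMetric (spaceVec n) f z)⁻¹ * paramSff (spaceVec n) f ν z).charpoly
        = (Matrix.diagonal μ).charpoly)
    (hcone : ∀ z ∈ O, sortedEigenvalues ((paramMetric (spaceVec n) f z)⁻¹
      * paramSff (spaceVec n) f ν z) ∈ kPositiveCone n k)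
    (hGeq : ∀ z ∈ O, G z = gammaMatrix k ρ ((paramMetric (spaceVec n) f z)⁻¹
      * paramSff (spaceVec n) f ν z))
    {m : ℝ} (hmax : ∀ y, (y, t₀) ∈ O → ((paramMetric (spaceVec n) f (y, t₀))⁻¹
      * paramSff (spaceVec n) f ν (y, t₀)).trace ≤ m * G (y, t₀))
    (hmax₀ : ((paramMetric (spaceVec n) f (y₀, t₀))⁻¹
      * paramSff (spaceVec n) f ν (y₀, t₀)).trace = m * G (y₀, t₀)) :
    ∃ H' G' : ℝ, HasDerivAt (fun s : ℝ => ((paramMetric (spaceVec n) f (y₀, t₀ + s))⁻¹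
        * paramSff (spaceVec n) f ν (y₀, t₀ + s)).trace) H' 0
      ∧ HasDerivAt (fun s : ℝ => G (y₀, t₀ + s)) G' 0 ∧ H' ≤ m * G' := by
  set O₁ : Set (EuclideanSpace ℝ (Fin n)) := {y | (y, t₀) ∈ O} with hO₁def
  have hcs : ContDiff ℝ ∞ fun y : EuclideanSpace ℝ (Fin n) => (y, t₀) :=
    contDiff_id.prodMk contDiff_const
  have hO₁ : IsOpen O₁ := hO.preimage hcs.continuous
  have hmaps : MapsTo (fun y : EuclideanSpace ℝ (Fin n) => (y, t₀)) O₁ O := fun y hy => hy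
  have sm1 : ∀ {Z : Type} [NormedAddCommGroup Z] [NormedSpace ℝ Z]
      {g : EuclideanSpace ℝ (Fin n) × ℝ → Z} (_ : ContDiffOn ℝ ∞ g O),
      ContDiffOn ℝ ∞ (fun y => g (y, t₀)) O₁ := fun hg => hg.comp hcs.contDiffOn hmaps
  have sl1 : ∀ {Z : Type} [NormedAddCommGroup Z] [NormedSpace ℝ Z]
      {g : EuclideanSpace ℝ (Fin n) × ℝ → Z} (_ : ContDiffOn ℝ ∞ g O) (p : Fin n),
      EqOn (pd (coordVec n p) fun y => g (y, t₀)) (fun y => pd (spaceVec n p) g (y, t₀)) O₁ :=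
    fun hg p y hy => pd_slice (differentiableAt_of_smoothOn hO hg hy) _
  have sl2 : ∀ {Z : Type} [NormedAddCommGroup Z] [NormedSpace ℝ Z]
      {g : EuclideanSpace ℝ (Fin n) × ℝ → Z} (_ : ContDiffOn ℝ ∞ g O) (p r : Fin n),
      EqOn (pd (coordVec n p) (pd (coordVec n r) fun y => g (y, t₀)))
        (fun y => pd (spaceVec n p) (pd (spaceVec n r) g) (y, t₀)) O₁ :=
    fun hg p r y hy => (pd_congr hO₁ (sl1 hg r) _ hy).trans
      (sl1 (pd_smoothOn hO hg (spaceVec n r)) p hy)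
  have hmet : ∀ y ∈ O₁, paramMetric (coordVec n) (fun y => f (y, t₀)) y
      = paramMetric (spaceVec n) f (y, t₀) := by
    intro y hy
    ext p r
    simp only [paramMetric, Matrix.of_apply]
    rw [sl1 hf p hy, sl1 hf r hy]
  have hsff : ∀ y ∈ O₁, paramSff (coordVec n) (fun y => f (y, t₀)) (fun y => ν (y, t₀)) y
      = paramSff (spaceVec n) f ν (y, t₀) := by
    intro y hy
    ext p r
    simp only [paramSff, Matrix.of_apply]
    rw [sl2 hf p r hy]
  have hsim := simons_inequality hk hkn hρ hO₁ (z₀ := y₀) hz₀ (coordVec n) (sm1 hf) (sm1 hν)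
    (sm1 hG) (fun y hy => hnorm _ hy) (fun y hy p => by rw [sl1 hf p hy]; exact horth _ hy p)
    hτ hτν (fun y hy p i => by rw [sl1 hf p hy]; exact hgraph y hy p i)
    (lam := lam) (by rw [hsff y₀ hz₀, hh])
    (fun y hy => by rw [hmet y hy, hsff y hy]; exact hcone _ hy)
    (fun y hy => by rw [hmet y hy, hsff y hy]; exact hGeq _ hy) (m := m)
    (fun y hy => by rw [hmet y hy, hsff y hy]; exact hmax y hy)
    (by rw [hmet y₀ hz₀, hsff y₀ hz₀]; exact hmax₀)
  simp_rw [sl2 hG _ _ hz₀] at hsim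
  have hν₀ := hnorm _ hz₀
  -- at the base point the coordinate frame is `τ`
  have hframe : ∀ i, pd (spaceVec n i) f (y₀, t₀) = τ i := by
    intro i
    rw [orthonormal_expansion hτ hν₀ hτν (pd (spaceVec n i) f (y₀, t₀)), real_inner_comm,
      horth _ hz₀ i]
    simp_rw [hgraph y₀ hz₀]
    simp
  have hnormal : ∀ i p r, inner ℝ (pd (spaceVec n i) f (y₀, t₀))
      (pd (spaceVec n p) (pd (spaceVec n r) f) (y₀, t₀)) = 0 := by
    intro i p r
    have hs := sl2 hf p r hz₀
    simp only at hs
    rw [hframe i, ← hs]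
    have h1 : EqOn (fun y => inner ℝ (τ i) (pd (coordVec n r) (fun y => f (y, t₀)) y))
        (fun _ => if i = r then (1 : ℝ) else 0) O₁ := fun y hy => by
      simp only
      rw [sl1 hf r hy]; exact hgraph y hy r i
    have h2 := pd_congr hO₁ h1 (coordVec n p) hz₀
    rw [pd_inner (differentiableAt_const _) (differentiableAt_of_smoothOn hO₁
      (pd_smoothOn hO₁ (sm1 hf) _) hz₀), pd_const, pd_const] at h2
    simpa using h2
  have hlam : lam ∈ kPositiveCone n k := by
    have h1 := hcone _ hz₀
    have hg1 : paramMetric (spaceVec n) f (y₀, t₀) = 1 := by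
      ext p r
      rw [paramMetric, Matrix.of_apply, hframe, hframe, Matrix.one_apply]
      exact orthonormal_iff_ite.1 hτ p r
    rwa [hg1, hh, inv_one, Matrix.one_mul, sortedEigenvalues_mem_cone_iff rfl] at h1
  have hfin := hasDerivAt_trace_sub_nonpos hk hkn hρ hO hz₀ hf hν hG hnorm horth hflow
    (by simp_rw [hframe]; exact hτ) hnormal hh hlam hreal hGeq hsim
  have hpt : ∀ s : ℝ, (y₀, t₀) + s • ((0 : EuclideanSpace ℝ (Fin n)), (1 : ℝ)) = (y₀, t₀ + s) := by
    intro s; simp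
  simpa only [hpt] using hfin

end SpaceTime

/-! ### Change of coordinates -/

section CoordinateChange

open Matrix

variable {n : ℕ}

lemma euclidean_eq_sum (w : EuclideanSpace ℝ (Fin n)) : w = ∑ r, w r • coordVec n r := by
  ext i
  simp [Pi.single_apply]

lemma isSymm_paramSff {X V : Type*} [NormedAddCommGroup X] [NormedSpace ℝ X]
    [NormedAddCommGroup V] [InnerProductSpace ℝ V] {O : Set X} (hO : IsOpen O) {z : X}
    (hz : z ∈ O) {f ν : X → V} (hf : ContDiffOn ℝ ∞ f O) (b : Fin n → X) :
    (paramSff b f ν z).IsSymm := by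
  ext p q
  simp only [paramSff, Matrix.transpose_apply, Matrix.of_apply]
  rw [pd_comm hO hf _ _ hz]

lemma posDef_paramMetric {V : Type*} [NormedAddCommGroup V] [InnerProductSpace ℝ V]
    {f : EuclideanSpace ℝ (Fin n) → V} {y : EuclideanSpace ℝ (Fin n)}
    (h : Function.Injective (fderiv ℝ f y)) : (paramMetric (coordVec n) f y).PosDef := by
  refine Matrix.PosDef.of_dotProduct_mulVec_pos ?_ fun x hx => ?_
  · ext p q
    simp [paramMetric, real_inner_comm]
  · have h1 : star x ⬝ᵥ (paramMetric (coordVec n) f y *ᵥ x)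
        = inner ℝ (fderiv ℝ f y (∑ p, x p • coordVec n p))
          (fderiv ℝ f y (∑ p, x p • coordVec n p)) := by
      rw [map_sum, sum_inner]
      simp_rw [inner_sum, map_smul, real_inner_smul_left, real_inner_smul_right]
      simp only [dotProduct, Matrix.mulVec, Finset.mul_sum, paramMetric, Matrix.of_apply, pd]
      refine Finset.sum_congr rfl fun p _ => Finset.sum_congr rfl fun q _ => ?_
      simp only [Pi.star_apply, star_trivial]; ring
    rw [h1]
    refine real_inner_self_pos.2 fun h0 => hx ?_
    have h2 := h (h0.trans (map_zero _).symm)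
    funext i
    have := congrArg (fun w : EuclideanSpace ℝ (Fin n) => w i) h2
    simpa [Pi.single_apply] using this

/-- Simultaneous diagonalization of a metric and a symmetric form. -/
lemma exists_frame_diagonalizing {g h : Matrix (Fin n) (Fin n) ℝ} (hg : g.PosDef)
    (hh : h.IsSymm) : ∃ (e : Matrix (Fin n) (Fin n) ℝ) (μ : Fin n → ℝ),
      eᵀ * g * e = 1 ∧ eᵀ * h * e = Matrix.diagonal μ := by
  have hgs : g.IsSymm := by
    have := hg.isHermitian
    rwa [Matrix.IsHermitian, Matrix.conjTranspose_eq_transpose_of_trivial] at this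
  obtain ⟨U, d, hU, hU', hgd⟩ := exists_orthogonal_diagonalization hgs
  have hd : ∀ i, 0 < d i := by
    have h1 := hg.conjTranspose_mul_mul_same (B := U) (Matrix.mulVec_injective_of_isUnit
      ((Matrix.isUnit_iff_isUnit_det _).2 (Matrix.isUnit_det_of_left_inverse hU)))
    have h2 : Uᴴ * g * U = Matrix.diagonal d := by
      rw [Matrix.conjTranspose_eq_transpose_of_trivial, hgd]
      calc _ = (Uᵀ * U) * Matrix.diagonal d * (Uᵀ * U) := by simp only [Matrix.mul_assoc]
        _ = _ := by rw [hU, Matrix.one_mul, Matrix.mul_one]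
    rw [h2] at h1
    exact Matrix.posDef_diagonal_iff.1 h1
  obtain ⟨B, hB⟩ : ∃ B, B = U * Matrix.diagonal (fun i => (√(d i))⁻¹) := ⟨_, rfl⟩
  have h1 : Bᵀ * g * B = 1 := by
    rw [hB, hgd, Matrix.transpose_mul, Matrix.diagonal_transpose]
    calc _ = Matrix.diagonal (fun i => (√(d i))⁻¹) * (Uᵀ * U) * Matrix.diagonal d * (Uᵀ * U)
          * Matrix.diagonal (fun i => (√(d i))⁻¹) := by simp only [Matrix.mul_assoc]
      _ = 1 := by
        rw [hU, Matrix.mul_one, Matrix.mul_one, Matrix.diagonal_mul_diagonal,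
          Matrix.diagonal_mul_diagonal, ← Matrix.diagonal_one]
        congr 1
        funext i
        have h3 := Real.sqrt_pos.2 (hd i)
        have h4 := Real.mul_self_sqrt (hd i).le
        field_simp
        rw [sq, h4]
  have h2 : (Bᵀ * h * B).IsSymm := by
    rw [Matrix.IsSymm, Matrix.transpose_mul, Matrix.transpose_mul, Matrix.transpose_transpose, hh,
      Matrix.mul_assoc]
  obtain ⟨V, μ, hV, -, hdec⟩ := exists_orthogonal_diagonalization h2
  refine ⟨B * V, μ, ?_, ?_⟩
  · calc (B * V)ᵀ * g * (B * V) = Vᵀ * (Bᵀ * g * B) * V := by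
          rw [Matrix.transpose_mul]; simp only [Matrix.mul_assoc]
      _ = 1 := by rw [h1, Matrix.mul_one, hV]
  · calc (B * V)ᵀ * h * (B * V) = Vᵀ * (Bᵀ * h * B) * V := by
          rw [Matrix.transpose_mul]; simp only [Matrix.mul_assoc]
      _ = (Vᵀ * V) * Matrix.diagonal μ * (Vᵀ * V) := by
          rw [hdec]; simp only [Matrix.mul_assoc]
      _ = Matrix.diagonal μ := by rw [hV, Matrix.one_mul, Matrix.mul_one]

lemma charpoly_inv_mul_eq_of_frame {g h e : Matrix (Fin n) (Fin n) ℝ} (he : eᵀ * g * e = 1) :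
    (g⁻¹ * h).charpoly = (eᵀ * h * e).charpoly := by
  have h1 : g⁻¹ = e * eᵀ := by
    apply Matrix.inv_eq_left_inv
    have := mul_eq_one_comm.1 he
    rwa [← Matrix.mul_assoc] at this
  rw [h1, Matrix.mul_assoc, Matrix.charpoly_mul_comm]

lemma charpoly_inv_mul_congr {g h J : Matrix (Fin n) (Fin n) ℝ} (hJ : (Jᵀ * g * J).det ≠ 0) :
    ((Jᵀ * g * J)⁻¹ * (Jᵀ * h * J)).charpoly = (g⁻¹ * h).charpoly := by
  rw [Matrix.det_mul, Matrix.det_mul, Matrix.det_transpose] at hJ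
  have hJu : IsUnit J.det := isUnit_iff_ne_zero.2 (right_ne_zero_of_mul hJ)
  have hJtu : IsUnit Jᵀ.det := by rwa [Matrix.det_transpose]
  rw [Matrix.mul_inv_rev, Matrix.mul_inv_rev]
  have : J⁻¹ * (g⁻¹ * Jᵀ⁻¹) * (Jᵀ * h * J) = J⁻¹ * (g⁻¹ * h) * J := by
    calc _ = J⁻¹ * g⁻¹ * (Jᵀ⁻¹ * Jᵀ) * h * J := by simp only [Matrix.mul_assoc]
      _ = _ := by rw [Matrix.nonsing_inv_mul _ hJtu, Matrix.mul_one]; simp only [Matrix.mul_assoc]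
  rw [this]
  exact charpoly_conj_of_mul_eq_one (Matrix.mul_nonsing_inv _ hJu)

variable {V : Type*} [NormedAddCommGroup V] [InnerProductSpace ℝ V]
  {O O' : Set (EuclideanSpace ℝ (Fin n))} {θ : EuclideanSpace ℝ (Fin n) → EuclideanSpace ℝ (Fin n)}
  {f : EuclideanSpace ℝ (Fin n) → V} {y : EuclideanSpace ℝ (Fin n)}

/-- The Jacobian matrix of a change of coordinates. -/
def jacobian (θ : EuclideanSpace ℝ (Fin n) → EuclideanSpace ℝ (Fin n))
    (y : EuclideanSpace ℝ (Fin n)) : Matrix (Fin n) (Fin n) ℝ :=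
  Matrix.of fun r p => pd (coordVec n p) θ y r

lemma pd_comp_coord (hO : IsOpen O) (hO' : IsOpen O') (hθ : ContDiffOn ℝ ∞ θ O)
    (hmaps : MapsTo θ O O') {W : Type*} [NormedAddCommGroup W] [NormedSpace ℝ W]
    {F : EuclideanSpace ℝ (Fin n) → W} (hF : ContDiffOn ℝ ∞ F O')
    (hy : y ∈ O) (p : Fin n) :
    pd (coordVec n p) (F ∘ θ) y = ∑ r, jacobian θ y r p • pd (coordVec n r) F (θ y) := by
  have h1 := fderiv_comp y (differentiableAt_of_smoothOn hO' hF (hmaps hy))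
    (differentiableAt_of_smoothOn hO hθ hy)
  simp only [pd, jacobian, Matrix.of_apply]
  rw [h1, ContinuousLinearMap.comp_apply]
  conv_lhs => rw [euclidean_eq_sum (fderiv ℝ θ y (coordVec n p))]
  rw [map_sum]
  simp_rw [map_smul]

lemma paramMetric_comp (hO : IsOpen O) (hO' : IsOpen O') (hθ : ContDiffOn ℝ ∞ θ O)
    (hmaps : MapsTo θ O O') (hf : ContDiffOn ℝ ∞ f O') (hy : y ∈ O) :
    paramMetric (coordVec n) (f ∘ θ) y
      = (jacobian θ y)ᵀ * paramMetric (coordVec n) f (θ y) * jacobian θ y := by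
  ext p q
  rw [paramMetric, Matrix.of_apply, pd_comp_coord hO hO' hθ hmaps hf hy,
    pd_comp_coord hO hO' hθ hmaps hf hy, inner_sum]
  simp_rw [sum_inner, real_inner_smul_left, real_inner_smul_right, Matrix.mul_apply,
    Finset.sum_mul, Matrix.transpose_apply, paramMetric, Matrix.of_apply]
  exact Finset.sum_congr rfl fun r _ => Finset.sum_congr rfl fun s _ => by ring

/-- The second fundamental form is a tensor: the second derivatives of the coordinate change only
contribute tangential terms. -/
lemma paramSff_comp (hO : IsOpen O) (hO' : IsOpen O') (hθ : ContDiffOn ℝ ∞ θ O)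
    (hmaps : MapsTo θ O O') (hf : ContDiffOn ℝ ∞ f O') (hy : y ∈ O)
    {ν ν' : EuclideanSpace ℝ (Fin n) → V} (hν : ν' y = ν (θ y))
    (horth : ∀ p, inner ℝ (pd (coordVec n p) f (θ y)) (ν (θ y)) = 0) :
    paramSff (coordVec n) (f ∘ θ) ν' y
      = (jacobian θ y)ᵀ * paramSff (coordVec n) f ν (θ y) * jacobian θ y := by
  have smJ : ∀ r q, ContDiffOn ℝ ∞ (fun y => jacobian θ y r q) O := by
    intro r q
    have h1 := pd_smoothOn hO hθ (coordVec n q)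
    exact contDiffOn_euclidean.1 h1 r
  have smf : ∀ r, ContDiffOn ℝ ∞ (pd (coordVec n r) f) O' := fun r => pd_smoothOn hO' hf _
  ext p q
  have h1 : EqOn (pd (coordVec n q) (f ∘ θ))
      (fun y => ∑ r, jacobian θ y r q • (pd (coordVec n r) f ∘ θ) y) O := fun z hz =>
    pd_comp_coord hO hO' hθ hmaps hf hz q
  have dJ := fun r => differentiableAt_of_smoothOn hO (smJ r q) hy
  have dF := fun r => differentiableAt_of_smoothOn hO ((smf r).comp hθ hmaps) hy
  have h2 : pd (coordVec n p) (fun y => ∑ r, jacobian θ y r q • (pd (coordVec n r) f ∘ θ) y) y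
      = ∑ r, (jacobian θ y r q • pd (coordVec n p) (pd (coordVec n r) f ∘ θ) y
        + pd (coordVec n p) (fun y => jacobian θ y r q) y • pd (coordVec n r) f (θ y)) := by
    have h3 : pd (coordVec n p) (fun y => ∑ r, jacobian θ y r q • (pd (coordVec n r) f ∘ θ) y) y
        = ∑ r, pd (coordVec n p) (fun y => jacobian θ y r q • (pd (coordVec n r) f ∘ θ) y) y := by
      simp only [pd]
      rw [fderiv_fun_sum fun r _ => (dJ r).fun_smul (dF r)]
      simp
    rw [h3]
    exact Finset.sum_congr rfl fun r _ => pd_smul (dJ r) (dF r) _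
  rw [paramSff, Matrix.of_apply, pd_congr hO h1 _ hy, h2, hν, sum_inner]
  simp_rw [inner_add_left, real_inner_smul_left, horth, mul_zero, add_zero,
    pd_comp_coord hO hO' hθ hmaps (smf _) hy, sum_inner, real_inner_smul_left, Matrix.mul_apply,
    Finset.sum_mul, Matrix.transpose_apply, paramSff, Matrix.of_apply, Finset.mul_sum,
    ← Finset.sum_neg_distrib]
  exact Finset.sum_congr rfl fun r _ => Finset.sum_congr rfl fun s _ => by ring

end CoordinateChange

/-! ### Hypersurfaces in a local parametrization -/

section Parametrization

open Matrix

variable {n k : ℕ} {ρ T : ℝ} {M : Type*} [TopologicalSpace M]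
  [ChartedSpace (EuclideanSpace ℝ (Fin n)) M]
  {f ν : M → EuclideanSpace ℝ (Fin (n + 1))} {O : Set (EuclideanSpace ℝ (Fin n))}
  {χ : EuclideanSpace ℝ (Fin n) → M} {y : EuclideanSpace ℝ (Fin n)}

lemma smoothOn_comp_param (hf : ContMDiff (𝓡 n) (𝓡 (n + 1)) ∞ f)
    (hχ : ContMDiffOn (𝓡 n) (𝓡 n) ∞ χ O) : ContDiffOn ℝ ∞ (f ∘ χ) O :=
  (hf.comp_contMDiffOn hχ).contDiffOn

lemma fderiv_comp_param (hf : ContMDiff (𝓡 n) (𝓡 (n + 1)) ∞ f) (hO : IsOpen O)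
    (hχ : ContMDiffOn (𝓡 n) (𝓡 n) ∞ χ O) (hy : y ∈ O) (d : EuclideanSpace ℝ (Fin n)) :
    fderiv ℝ (f ∘ χ) y d
      = mfderiv (𝓡 n) (𝓡 (n + 1)) f (χ y) (mfderiv (𝓡 n) (𝓡 n) χ y d) := by
  have h1 : MDifferentiableAt (𝓡 n) (𝓡 n) χ y :=
    (hχ.contMDiffAt (hO.mem_nhds hy)).mdifferentiableAt (by simp)
  have h2 : MDifferentiableAt (𝓡 n) (𝓡 (n + 1)) f (χ y) :=
    (hf (χ y)).mdifferentiableAt (by simp)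
  have h3 := mfderiv_comp y h2 h1
  rw [mfderiv_eq_fderiv] at h3
  rw [h3]
  rfl

lemma inner_pd_comp_param_normal (hf : ContMDiff (𝓡 n) (𝓡 (n + 1)) ∞ f) (hO : IsOpen O)
    (hχ : ContMDiffOn (𝓡 n) (𝓡 n) ∞ χ O) (hy : y ∈ O)
    (horth : ∀ (x : M) (v : TangentSpace (𝓡 n) x),
      inner (E := EuclideanSpace ℝ (Fin (n + 1))) ℝ
        (mfderiv (𝓡 n) (𝓡 (n + 1)) f x v) (ν x) = 0) (d : EuclideanSpace ℝ (Fin n)) :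
    inner ℝ (pd d (f ∘ χ) y) (ν (χ y)) = 0 := by
  rw [pd, fderiv_comp_param hf hO hχ hy]
  exact horth (χ y) _

lemma posDef_paramMetric_param (hf : ContMDiff (𝓡 n) (𝓡 (n + 1)) ∞ f) (hO : IsOpen O)
    (hχ : ContMDiffOn (𝓡 n) (𝓡 n) ∞ χ O) (hy : y ∈ O)
    (himm : Function.Injective (mfderiv (𝓡 n) (𝓡 (n + 1)) f (χ y)))
    (hinj : Function.Injective (mfderiv (𝓡 n) (𝓡 n) χ y)) :
    (paramMetric (coordVec n) (f ∘ χ) y).PosDef := by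
  refine posDef_paramMetric fun a b hab => hinj (himm ?_)
  rwa [fderiv_comp_param hf hO hχ hy, fderiv_comp_param hf hO hχ hy] at hab

lemma inducedMetric_eq (x : M) : inducedMetric f x
    = paramMetric (coordVec n) (f ∘ (extChartAt (𝓡 n) x).symm) (extChartAt (𝓡 n) x x) := rfl

lemma secondFundamentalForm_eq (x : M) : secondFundamentalForm f ν x
    = paramSff (coordVec n) (f ∘ (extChartAt (𝓡 n) x).symm) (ν ∘ (extChartAt (𝓡 n) x).symm)
      (extChartAt (𝓡 n) x x) := by
  ext p q
  simp only [secondFundamentalForm, paramSff, Matrix.of_apply, Function.comp_apply,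
    extChartAt_to_inv]
  rfl

lemma mfderiv_extChartAt_symm_injective [IsManifold (𝓡 n) ∞ M] (x : M)
    (hy : y ∈ (extChartAt (𝓡 n) x).target) :
    Function.Injective (mfderiv (𝓡 n) (𝓡 n) (extChartAt (𝓡 n) x).symm y) := by
  have : IsManifold (𝓡 n) 1 M := IsManifold.of_le (n := ∞) (by simp)
  have h := isInvertible_mfderivWithin_extChartAt_symm (I := 𝓡 n) hy
  rw [ModelWithCorners.range_eq_univ, mfderivWithin_univ] at h
  exact h.injective

/-- In any local parametrization `χ`, the metric and the second fundamental form differ from those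
in the preferred chart by the congruence with the Jacobian matrix. -/
lemma paramMetric_paramSff_eq_congr [IsManifold (𝓡 n) ∞ M]
    (hf : ContMDiff (𝓡 n) (𝓡 (n + 1)) ∞ f) (hO : IsOpen O)
    (hχ : ContMDiffOn (𝓡 n) (𝓡 n) ∞ χ O) (hy : y ∈ O)
    (horth : ∀ (x : M) (v : TangentSpace (𝓡 n) x),
      inner (E := EuclideanSpace ℝ (Fin (n + 1))) ℝ
        (mfderiv (𝓡 n) (𝓡 (n + 1)) f x v) (ν x) = 0) :
    paramMetric (coordVec n) (f ∘ χ) y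
        = (jacobian (extChartAt (𝓡 n) (χ y) ∘ χ) y)ᵀ * inducedMetric f (χ y)
          * jacobian (extChartAt (𝓡 n) (χ y) ∘ χ) y ∧
      paramSff (coordVec n) (f ∘ χ) (ν ∘ χ) y
        = (jacobian (extChartAt (𝓡 n) (χ y) ∘ χ) y)ᵀ * secondFundamentalForm f ν (χ y)
          * jacobian (extChartAt (𝓡 n) (χ y) ∘ χ) y := by
  set φ := extChartAt (𝓡 n) (χ y) with hφ
  set O₁ := O ∩ χ ⁻¹' φ.source with hO₁def
  have hO₁ : IsOpen O₁ := hχ.continuousOn.isOpen_inter_preimage hO (isOpen_extChartAt_source _)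
  have hy₁ : y ∈ O₁ := ⟨hy, mem_extChartAt_source _⟩
  have hθ : ContDiffOn ℝ ∞ (φ ∘ χ) O₁ := by
    rw [← contMDiffOn_iff_contDiffOn]
    have h1 : ContMDiffOn (𝓡 n) (𝓡 n) ∞ φ φ.source := by
      rw [hφ, extChartAt_source]
      exact contMDiffOn_extChartAt
    exact h1.comp (hχ.mono inter_subset_left) fun z hz => hz.2
  have hmaps : MapsTo (φ ∘ χ) O₁ φ.target := fun z hz => φ.map_source hz.2
  have htarget : IsOpen φ.target := isOpen_extChartAt_target _
  have hsymm : ContMDiffOn (𝓡 n) (𝓡 n) ∞ φ.symm φ.target := contMDiffOn_extChartAt_symm _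
  have hfφ : ContDiffOn ℝ ∞ (f ∘ φ.symm) φ.target := smoothOn_comp_param hf hsymm
  have heq : EqOn (f ∘ χ) ((f ∘ φ.symm) ∘ (φ ∘ χ)) O₁ := fun z hz => by
    simp only [Function.comp_apply]
    rw [φ.left_inv hz.2]
  have horth' : ∀ p, inner ℝ (pd (coordVec n p) (f ∘ φ.symm) ((φ ∘ χ) y))
      ((ν ∘ φ.symm) ((φ ∘ χ) y)) = 0 := fun p =>
    inner_pd_comp_param_normal hf htarget hsymm (hmaps hy₁) horth _
  constructor
  · rw [inducedMetric_eq, ← hφ]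
    have h1 := paramMetric_comp hO₁ htarget hθ hmaps hfφ hy₁
    refine Eq.trans ?_ h1
    ext p q
    simp only [paramMetric, Matrix.of_apply]
    rw [pd_congr hO₁ heq _ hy₁, pd_congr hO₁ heq _ hy₁]
  · rw [secondFundamentalForm_eq, ← hφ]
    have h1 := paramSff_comp hO₁ htarget hθ hmaps hfφ hy₁ (ν := ν ∘ φ.symm) (ν' := ν ∘ χ)
      (by simp only [Function.comp_apply]; rw [φ.left_inv hy₁.2]) horth'
    refine Eq.trans ?_ h1
    ext p q
    simp only [paramSff, Matrix.of_apply]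
    rw [pd_congr hO₁ (pd_congr hO₁ heq (coordVec n q)) _ hy₁]

/-- The principal curvatures can be computed in any local parametrization. -/
lemma charpoly_param [IsManifold (𝓡 n) ∞ M]
    (hf : ContMDiff (𝓡 n) (𝓡 (n + 1)) ∞ f) (hO : IsOpen O)
    (hχ : ContMDiffOn (𝓡 n) (𝓡 n) ∞ χ O) (hy : y ∈ O)
    (himm : Function.Injective (mfderiv (𝓡 n) (𝓡 (n + 1)) f (χ y)))
    (hinj : Function.Injective (mfderiv (𝓡 n) (𝓡 n) χ y))
    (horth : ∀ (x : M) (v : TangentSpace (𝓡 n) x),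
      inner (E := EuclideanSpace ℝ (Fin (n + 1))) ℝ
        (mfderiv (𝓡 n) (𝓡 (n + 1)) f x v) (ν x) = 0) :
    ((paramMetric (coordVec n) (f ∘ χ) y)⁻¹
        * paramSff (coordVec n) (f ∘ χ) (ν ∘ χ) y).charpoly
      = ((inducedMetric f (χ y))⁻¹ * secondFundamentalForm f ν (χ y)).charpoly := by
  have hpos := posDef_paramMetric_param hf hO hχ hy himm hinj
  obtain ⟨h1, h2⟩ := paramMetric_paramSff_eq_congr hf hO hχ hy horth
  have hdet := hpos.det_pos.ne'
  rw [h1] at hdet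
  rw [h1, h2]
  exact charpoly_inv_mul_congr hdet

lemma posDef_inducedMetric [IsManifold (𝓡 n) ∞ M]
    (hf : ContMDiff (𝓡 n) (𝓡 (n + 1)) ∞ f) (x : M)
    (himm : Function.Injective (mfderiv (𝓡 n) (𝓡 (n + 1)) f x)) :
    (inducedMetric f x).PosDef := by
  rw [inducedMetric_eq]
  refine posDef_paramMetric_param hf (isOpen_extChartAt_target x) (contMDiffOn_extChartAt_symm x)
    (mem_extChartAt_target x) ?_ (mfderiv_extChartAt_symm_injective x (mem_extChartAt_target x))
  rwa [extChartAt_to_inv]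

lemma isSymm_secondFundamentalForm [IsManifold (𝓡 n) ∞ M]
    (hf : ContMDiff (𝓡 n) (𝓡 (n + 1)) ∞ f) (x : M) :
    (secondFundamentalForm f ν x).IsSymm := by
  rw [secondFundamentalForm_eq]
  exact isSymm_paramSff (isOpen_extChartAt_target x) (mem_extChartAt_target x)
    (smoothOn_comp_param hf (contMDiffOn_extChartAt_symm x)) _

lemma exists_charpoly_eq_diagonal [IsManifold (𝓡 n) ∞ M]
    (hf : ContMDiff (𝓡 n) (𝓡 (n + 1)) ∞ f) (x : M)
    (himm : Function.Injective (mfderiv (𝓡 n) (𝓡 (n + 1)) f x)) :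
    ∃ μ : Fin n → ℝ, ((inducedMetric f x)⁻¹ * secondFundamentalForm f ν x).charpoly
      = (Matrix.diagonal μ).charpoly := by
  obtain ⟨e, μ, he, hμ⟩ := exists_frame_diagonalizing (posDef_inducedMetric hf x himm)
    (isSymm_secondFundamentalForm (ν := ν) hf x)
  exact ⟨μ, by rw [charpoly_inv_mul_eq_of_frame he, hμ]⟩

lemma meanCurvature_eq_trace [IsManifold (𝓡 n) ∞ M]
    (hf : ContMDiff (𝓡 n) (𝓡 (n + 1)) ∞ f) (x : M)
    (himm : Function.Injective (mfderiv (𝓡 n) (𝓡 (n + 1)) f x)) :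
    meanCurvature f ν x = ((inducedMetric f x)⁻¹ * secondFundamentalForm f ν x).trace := by
  obtain ⟨μ, hμ⟩ := exists_charpoly_eq_diagonal (ν := ν) hf x himm
  exact sum_sortedEigenvalues hμ

end Parametrization

/-! ### Regularity of the curvature functions along the flow -/

section Regularity

open Matrix

variable {n k : ℕ} {ρ T : ℝ} {M : Type*} [TopologicalSpace M]
  [ChartedSpace (EuclideanSpace ℝ (Fin n)) M]
  {F ν : ℝ → M → EuclideanSpace ℝ (Fin (n + 1))} {O : Set (EuclideanSpace ℝ (Fin n))}
  {χ : EuclideanSpace ℝ (Fin n) → M}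

lemma contMDiff_slice {Φ : ℝ → M → EuclideanSpace ℝ (Fin (n + 1))}
    (h : ContMDiffOn ((𝓡 n).prod 𝓘(ℝ, ℝ)) (𝓡 (n + 1)) ∞ (fun p : M × ℝ => Φ p.2 p.1)
      (univ ×ˢ Ico 0 T)) {t : ℝ} (ht : t ∈ Ico 0 T) : ContMDiff (𝓡 n) (𝓡 (n + 1)) ∞ (Φ t) := by
  have h1 : ContMDiff (𝓡 n) ((𝓡 n).prod 𝓘(ℝ, ℝ)) ∞ fun x : M => (x, t) :=
    contMDiff_id.prodMk contMDiff_const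
  rw [← contMDiffOn_univ] at h1 ⊢
  exact h.comp h1 fun x _ => ⟨mem_univ _, ht⟩

lemma smoothOn_spacetime {Φ : ℝ → M → EuclideanSpace ℝ (Fin (n + 1))}
    (h : ContMDiffOn ((𝓡 n).prod 𝓘(ℝ, ℝ)) (𝓡 (n + 1)) ∞ (fun p : M × ℝ => Φ p.2 p.1)
      (univ ×ˢ Ico 0 T)) (hχ : ContMDiffOn (𝓡 n) (𝓡 n) ∞ χ O) :
    ContDiffOn ℝ ∞ (fun z : EuclideanSpace ℝ (Fin n) × ℝ => Φ z.2 (χ z.1)) (O ×ˢ Ico 0 T) := by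
  rw [← contMDiffOn_iff_contDiffOn]
  have h1 : ContMDiffOn 𝓘(ℝ, EuclideanSpace ℝ (Fin n) × ℝ) ((𝓡 n).prod 𝓘(ℝ, ℝ)) ∞
      (fun z : EuclideanSpace ℝ (Fin n) × ℝ => (χ z.1, z.2)) (O ×ˢ Ico 0 T) := by
    refine ContMDiffOn.prodMk ?_ contDiff_snd.contMDiff.contMDiffOn
    exact hχ.comp contDiff_fst.contMDiff.contMDiffOn fun z hz => hz.1
  exact h.comp h1 fun z hz => ⟨mem_univ _, hz.2⟩

/-- Spatial derivatives of the time slices of a function that is smooth up to the boundary of a time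
interval depend smoothly on time. -/
lemma smoothOn_pd_slice {Y Z : Type*} [NormedAddCommGroup Y] [NormedSpace ℝ Y]
    [NormedAddCommGroup Z] [NormedSpace ℝ Z] {O : Set Y} (hO : IsOpen O) {I : Set ℝ}
    (hI : UniqueDiffOn ℝ I) {f : Y × ℝ → Z} (hf : ContDiffOn ℝ ∞ f (O ×ˢ I)) (d : Y) :
    ContDiffOn ℝ ∞ (fun z : Y × ℝ => pd d (fun y => f (y, z.2)) z.1) (O ×ˢ I) := by
  have hu : UniqueDiffOn ℝ (O ×ˢ I) := hO.uniqueDiffOn.prod hI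
  have h1 : ContDiffOn ℝ ∞ (fun z => fderivWithin ℝ f (O ×ˢ I) z (d, 0)) (O ×ˢ I) :=
    (hf.fderivWithin hu (by simp)).clm_apply contDiffOn_const
  refine h1.congr fun z hz => ?_
  have h2 : HasFDerivWithinAt f (fderivWithin ℝ f (O ×ˢ I) z) (O ×ˢ I) z :=
    (hf.differentiableOn (by simp) z hz).hasFDerivWithinAt
  have h3 : HasFDerivAt (fun y : Y => (y, z.2)) (ContinuousLinearMap.inl ℝ Y ℝ) z.1 :=
    hasFDerivAt_prodMk_left z.1 z.2
  have h4 := HasFDerivWithinAt.comp (t := O ×ˢ I) (s := O) z.1 (g := f) h2 h3.hasFDerivWithinAt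
    fun y hy => ⟨hy, hz.2⟩
  have h5 := (h4.hasFDerivAt (hO.mem_nhds hz.1)).fderiv
  simp only [pd]
  have h6 : fderiv ℝ (fun y => f (y, z.2)) z.1 = _ := h5
  rw [h6]
  simp

/-- The speed is smooth, being `-⟨∂_t F, ν⟩`. The time derivative is one-sided at the initial time. -/
lemma IsGammaFlow.smoothOn_speed [IsManifold (𝓡 n) ∞ M] (h : IsGammaFlow k ρ T F ν)
    (hO : IsOpen O) (hχ : ContMDiffOn (𝓡 n) (𝓡 n) ∞ χ O) :
    ContDiffOn ℝ ∞ (fun z : EuclideanSpace ℝ (Fin n) × ℝ =>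
      speed k ρ (F z.2) (ν z.2) (χ z.1)) (O ×ˢ Ico 0 T) ∧
    ∀ z ∈ O ×ˢ Ico 0 T, fderivWithin ℝ (fun z : EuclideanSpace ℝ (Fin n) × ℝ => F z.2 (χ z.1))
      (O ×ˢ Ico 0 T) z (0, 1) = -speed k ρ (F z.2) (ν z.2) (χ z.1) • ν z.2 (χ z.1) := by
  have hu : UniqueDiffOn ℝ (O ×ˢ Ico 0 T) := hO.uniqueDiffOn.prod (uniqueDiffOn_Ico 0 T)
  have hF := smoothOn_spacetime h.smooth hχ
  have hν := smoothOn_spacetime h.smooth_normal hχ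
  have hder : ∀ z ∈ O ×ˢ Ico 0 T,
      fderivWithin ℝ (fun z : EuclideanSpace ℝ (Fin n) × ℝ => F z.2 (χ z.1)) (O ×ˢ Ico 0 T) z
        (0, 1) = -speed k ρ (F z.2) (ν z.2) (χ z.1) • ν z.2 (χ z.1) := by
    intro z hz
    have h2 := (hF.differentiableOn (by simp) z hz).hasFDerivWithinAt
    have h3 : HasDerivWithinAt (fun s : ℝ => (z.1, s)) ((0 : EuclideanSpace ℝ (Fin n)), (1 : ℝ))
        (Ico 0 T) z.2 :=
      ((hasDerivAt_const z.2 z.1).prodMk (hasDerivAt_id z.2)).hasDerivWithinAt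
    have h4 := HasFDerivWithinAt.comp_hasDerivWithinAt (t := O ×ˢ Ico 0 T) z.2 h2 h3
      fun s hs => ⟨hz.1, hs⟩
    have h5 := h.evolution z.2 hz.2 (χ z.1)
    exact (uniqueDiffOn_Ico 0 T z.2 hz.2).eq_deriv _ h4 h5
  refine ⟨?_, hder⟩
  have h1 : ContDiffOn ℝ ∞ (fun z => fderivWithin ℝ
      (fun z : EuclideanSpace ℝ (Fin n) × ℝ => F z.2 (χ z.1)) (O ×ˢ Ico 0 T) z (0, 1))
      (O ×ˢ Ico 0 T) :=
    (hF.fderivWithin hu (by simp)).clm_apply contDiffOn_const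
  refine ((h1.inner ℝ hν).neg).congr fun z hz => ?_
  rw [hder z hz, real_inner_smul_left, real_inner_self_eq_norm_sq, h.norm_normal z.2 hz.2]
  ring

lemma continuousOn_det {N : ℕ} {Y : Type*} [TopologicalSpace Y] {S : Set Y}
    {A : Y → Matrix (Fin N) (Fin N) ℝ} (hA : ∀ i j, ContinuousOn (fun z => A z i j) S) :
    ContinuousOn (fun z => (A z).det) S := by
  simp only [Matrix.det_apply]
  exact continuousOn_finsetSum _ fun π _ =>
    (continuousOn_finsetProd _ fun i _ => hA _ _).const_smul _

lemma continuousOn_inv_mul_trace {Y : Type*} [TopologicalSpace Y] {S : Set Y}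
    {g h : Y → Matrix (Fin n) (Fin n) ℝ} (hg : ∀ i j, ContinuousOn (fun z => g z i j) S)
    (hh : ∀ i j, ContinuousOn (fun z => h z i j) S) (hdet : ∀ z ∈ S, (g z).det ≠ 0) :
    ContinuousOn (fun z => ((g z)⁻¹ * h z).trace) S := by
  have hadj : ∀ i j, ContinuousOn (fun z => (g z).adjugate i j) S := by
    intro i j
    simp only [Matrix.adjugate_apply]
    refine continuousOn_det fun a c => ?_
    by_cases ha : a = j
    · subst ha
      simpa using continuousOn_const
    · simpa [Matrix.updateRow_ne ha] using hg a c
  have h1 : ContinuousOn (fun z => ((g z).det)⁻¹ * ∑ i, ∑ j, (g z).adjugate i j * h z j i) S :=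
    ((continuousOn_det hg).inv₀ hdet).mul (continuousOn_finsetSum _ fun i _ =>
      continuousOn_finsetSum _ fun j _ => (hadj i j).mul (hh j i))
  refine h1.congr fun z _ => ?_
  simp only
  rw [Matrix.inv_def, Ring.inverse_eq_inv', Matrix.smul_mul, Matrix.trace_smul, smul_eq_mul]
  simp only [Matrix.trace, Matrix.diag_apply, Matrix.mul_apply]

lemma IsGammaFlow.meanCurvature_param [IsManifold (𝓡 n) ∞ M] (h : IsGammaFlow k ρ T F ν)
    (hO : IsOpen O) (hχ : ContMDiffOn (𝓡 n) (𝓡 n) ∞ χ O)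
    (hinj : ∀ y ∈ O, Function.Injective (mfderiv (𝓡 n) (𝓡 n) χ y)) {y : EuclideanSpace ℝ (Fin n)}
    (hy : y ∈ O) {t : ℝ} (ht : t ∈ Ico 0 T) :
    meanCurvature (F t) (ν t) (χ y) = ((paramMetric (coordVec n) (F t ∘ χ) y)⁻¹
      * paramSff (coordVec n) (F t ∘ χ) (ν t ∘ χ) y).trace := by
  have hf := contMDiff_slice h.smooth ht
  rw [meanCurvature_eq_trace hf _ (h.immersion t ht _)]
  exact (trace_congr_of_charpoly (charpoly_param hf hO hχ hy (h.immersion t ht _) (hinj y hy)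
    (h.normal_orthogonal t ht))).symm

lemma IsGammaFlow.continuousOn_meanCurvature_param [IsManifold (𝓡 n) ∞ M]
    (h : IsGammaFlow k ρ T F ν) (hO : IsOpen O) (hχ : ContMDiffOn (𝓡 n) (𝓡 n) ∞ χ O)
    (hinj : ∀ y ∈ O, Function.Injective (mfderiv (𝓡 n) (𝓡 n) χ y)) :
    ContinuousOn (fun z : EuclideanSpace ℝ (Fin n) × ℝ =>
      meanCurvature (F z.2) (ν z.2) (χ z.1)) (O ×ˢ Ico 0 T) := by
  have hI := uniqueDiffOn_Ico (0 : ℝ) T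
  have hF := smoothOn_spacetime h.smooth hχ
  have hν := smoothOn_spacetime h.smooth_normal hχ
  have h1 := fun p => smoothOn_pd_slice hO hI hF (coordVec n p)
  have h2 := fun p q => smoothOn_pd_slice hO hI (h1 q) (coordVec n p)
  have key : ContinuousOn (fun z : EuclideanSpace ℝ (Fin n) × ℝ =>
      ((paramMetric (coordVec n) (F z.2 ∘ χ) z.1)⁻¹
        * paramSff (coordVec n) (F z.2 ∘ χ) (ν z.2 ∘ χ) z.1).trace) (O ×ˢ Ico 0 T) := by
    refine continuousOn_inv_mul_trace (fun p q => ?_) (fun p q => ?_) fun z hz => ?_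
    · exact ((h1 p).inner ℝ (h1 q)).continuousOn
    · exact (((h2 p q).inner ℝ hν).neg).continuousOn
    · exact (posDef_paramMetric_param (contMDiff_slice h.smooth hz.2) hO hχ hz.1
        (h.immersion z.2 hz.2 _) (hinj z.1 hz.1)).det_pos.ne'
  exact key.congr fun z hz => h.meanCurvature_param hO hχ hinj hz.1 hz.2

/-- A function on `M × [0, T)` is continuous if it is continuous in every chart. -/
lemma continuousOn_of_param {Q : M → ℝ → ℝ}
    (hQ : ∀ x₀ : M, ContinuousOn (fun z : EuclideanSpace ℝ (Fin n) × ℝ =>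
      Q ((extChartAt (𝓡 n) x₀).symm z.1) z.2) ((extChartAt (𝓡 n) x₀).target ×ˢ Ico 0 T)) :
    ContinuousOn (fun p : M × ℝ => Q p.1 p.2) (univ ×ˢ Ico 0 T) := by
  rintro ⟨x₀, t₀⟩ ⟨-, ht₀⟩
  set φ := extChartAt (𝓡 n) x₀ with hφ
  have hsrc : φ.source ×ˢ (univ : Set ℝ) ∈ 𝓝 (x₀, t₀) :=
    prod_mem_nhds (extChartAt_source_mem_nhds x₀) univ_mem
  have hc : ContinuousOn (fun p : M × ℝ => (φ p.1, p.2)) (φ.source ×ˢ Ico 0 T) :=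
    ((continuousOn_extChartAt x₀).comp continuousOn_fst fun p hp => hp.1).prodMk continuousOn_snd
  have h1 : ContinuousOn (fun p : M × ℝ => Q p.1 p.2) (φ.source ×ˢ Ico 0 T) := by
    refine ((hQ x₀).comp hc fun p hp => ⟨φ.map_source hp.1, hp.2⟩).congr fun p hp => ?_
    simp only [Function.comp_apply, ← hφ]
    rw [φ.left_inv hp.1]
  have h2 := h1 (x₀, t₀) ⟨mem_extChartAt_source x₀, ht₀⟩
  refine h2.mono_of_mem_nhdsWithin ?_
  have h3 : (univ ×ˢ Ico 0 T) ∩ (φ.source ×ˢ (univ : Set ℝ)) ∈ 𝓝[univ ×ˢ Ico 0 T] (x₀, t₀) :=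
    inter_mem_nhdsWithin _ hsrc
  refine mem_of_superset h3 ?_
  rintro p ⟨hp1, hp2⟩
  exact ⟨hp2.1, hp1.2⟩

lemma IsGammaFlow.continuousOn_meanCurvature [IsManifold (𝓡 n) ∞ M]
    (h : IsGammaFlow k ρ T F ν) :
    ContinuousOn (fun p : M × ℝ => meanCurvature (F p.2) (ν p.2) p.1) (univ ×ˢ Ico 0 T) :=
  continuousOn_of_param (Q := fun x t => meanCurvature (F t) (ν t) x) fun x₀ =>
    h.continuousOn_meanCurvature_param (isOpen_extChartAt_target x₀)
      (contMDiffOn_extChartAt_symm x₀) fun _ hy => mfderiv_extChartAt_symm_injective x₀ hy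

lemma IsGammaFlow.continuousOn_speed [IsManifold (𝓡 n) ∞ M] (h : IsGammaFlow k ρ T F ν) :
    ContinuousOn (fun p : M × ℝ => speed k ρ (F p.2) (ν p.2) p.1) (univ ×ˢ Ico 0 T) :=
  continuousOn_of_param (Q := fun x t => speed k ρ (F t) (ν t) x) fun x₀ =>
    (h.smoothOn_speed (isOpen_extChartAt_target x₀)
      (contMDiffOn_extChartAt_symm x₀)).1.continuousOn

end Regularity

/-! ### Graph coordinates over a tangent space -/

section GraphCoordinates

open Matrix

variable {n k : ℕ}

/-- A hypersurface is locally a graph over its tangent space at a point: there are coordinates in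
which the tangential part of the position vector is the identity, and their coordinate vectors at
the given point may be any prescribed orthonormal frame `e`. -/
lemma exists_graph_parametrization {f : EuclideanSpace ℝ (Fin n) → EuclideanSpace ℝ (Fin (n + 1))}
    {U : Set (EuclideanSpace ℝ (Fin n))} (hU : IsOpen U) (hf : ContDiffOn ℝ ∞ f U)
    {y₀ : EuclideanSpace ℝ (Fin n)} (hy₀ : y₀ ∈ U) {e : Matrix (Fin n) (Fin n) ℝ}
    (he : eᵀ * paramMetric (coordVec n) f y₀ * e = 1) {ν₀ : EuclideanSpace ℝ (Fin (n + 1))}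
    (hν₀ : ∀ p, inner ℝ (pd (coordVec n p) f y₀) ν₀ = 0) :
    ∃ (τ : Fin n → EuclideanSpace ℝ (Fin (n + 1))) (O : Set (EuclideanSpace ℝ (Fin n)))
      (w₀ : EuclideanSpace ℝ (Fin n)) (θ : EuclideanSpace ℝ (Fin n) → EuclideanSpace ℝ (Fin n)),
      Orthonormal ℝ τ ∧ (∀ i, inner ℝ (τ i) ν₀ = 0) ∧ IsOpen O ∧ w₀ ∈ O ∧ ContDiffOn ℝ ∞ θ O ∧
      MapsTo θ O U ∧ θ w₀ = y₀ ∧ jacobian θ w₀ = e ∧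
      ∀ w ∈ O, ∀ p i, inner ℝ (τ i) (pd (coordVec n p) (f ∘ θ) w) = if i = p then 1 else 0 := by
  set τ : Fin n → EuclideanSpace ℝ (Fin (n + 1)) :=
    fun i => ∑ r, e r i • pd (coordVec n r) f y₀ with hτdef
  have hN : ∀ i r, inner ℝ (τ i) (pd (coordVec n r) f y₀)
      = (eᵀ * paramMetric (coordVec n) f y₀) i r := by
    intro i r
    simp only [hτdef, sum_inner, real_inner_smul_left, Matrix.mul_apply, Matrix.transpose_apply,
      paramMetric, Matrix.of_apply]
  have hττ : ∀ i j, inner ℝ (τ i) (τ j) = if i = j then 1 else 0 := by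
    intro i j
    rw [← Matrix.one_apply, ← he, Matrix.mul_apply]
    have hj : τ j = ∑ r, e r j • pd (coordVec n r) f y₀ := rfl
    rw [hj, inner_sum]
    refine Finset.sum_congr rfl fun r _ => ?_
    rw [real_inner_smul_right, hN, mul_comm]
  have hτν : ∀ i, inner ℝ (τ i) ν₀ = 0 := by
    intro i
    simp only [hτdef, sum_inner, real_inner_smul_left, hν₀, mul_zero, Finset.sum_const_zero]
  set Θ : EuclideanSpace ℝ (Fin n) → EuclideanSpace ℝ (Fin n) :=
    fun y => WithLp.toLp 2 fun i => inner ℝ (τ i) (f y) with hΘdef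
  have hΘ : ContDiffOn ℝ ∞ Θ U := contDiffOn_euclidean.2 fun i => contDiffOn_const.inner ℝ hf
  have hΘ₀ : ContDiffAt ℝ ∞ Θ y₀ := hΘ.contDiffAt (hU.mem_nhds hy₀)
  have hpdΘ : ∀ d i, pd d Θ y₀ i = inner ℝ (τ i) (pd d f y₀) := by
    intro d i
    have h1 := (hΘ₀.differentiableAt (by simp)).hasFDerivAt
    have h2 := (EuclideanSpace.proj i : EuclideanSpace ℝ (Fin n) →L[ℝ] ℝ).hasFDerivAt.comp y₀ h1
    have h3 := (innerSL ℝ (τ i)).hasFDerivAt.comp y₀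
      (differentiableAt_of_smoothOn hU hf hy₀).hasFDerivAt
    have h4 := congrArg (fun L => L d) (h2.unique h3)
    simpa [pd] using h4
  -- the derivative of `Θ` at `y₀` is `eᵀ g`, which has the right inverse `e`
  have hsurj : Function.Surjective (fderiv ℝ Θ y₀) := by
    intro w
    refine ⟨∑ p, w p • ∑ r, e r p • coordVec n r, ?_⟩
    have h1 : ∀ p, fderiv ℝ Θ y₀ (∑ r, e r p • coordVec n r) = coordVec n p := by
      intro p
      rw [map_sum]
      ext i
      have h2 : ∀ r, (fderiv ℝ Θ y₀ (e r p • coordVec n r)) i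
          = (eᵀ * paramMetric (coordVec n) f y₀) i r * e r p := by
        intro r
        rw [map_smul, PiLp.smul_apply, smul_eq_mul, mul_comm, ← hN, ← hpdΘ]
        rfl
      rw [WithLp.ofLp_sum, Finset.sum_apply]
      simp_rw [h2]
      rw [← Matrix.mul_apply, he]
      simp [Matrix.one_apply]
    rw [map_sum]
    simp_rw [map_smul, h1]
    exact (euclidean_eq_sum w).symm
  have hinj : Function.Injective (fderiv ℝ Θ y₀) :=
    LinearMap.injective_iff_surjective.2 hsurj
  set L : EuclideanSpace ℝ (Fin n) ≃L[ℝ] EuclideanSpace ℝ (Fin n) :=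
    (LinearEquiv.ofBijective (fderiv ℝ Θ y₀ : _ →ₗ[ℝ] _)
      ⟨hinj, hsurj⟩).toContinuousLinearEquiv with hL
  have hLcoe : (L : EuclideanSpace ℝ (Fin n) →L[ℝ] EuclideanSpace ℝ (Fin n)) = fderiv ℝ Θ y₀ := by
    ext1 v
    rfl
  have hLder : HasFDerivAt Θ (L : EuclideanSpace ℝ (Fin n) →L[ℝ] EuclideanSpace ℝ (Fin n)) y₀ := by
    rw [hLcoe]
    exact (hΘ₀.differentiableAt (by simp)).hasFDerivAt
  set R := hΘ₀.toOpenPartialHomeomorph Θ hLder (by simp) with hR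
  have hRcoe : ∀ y, R y = Θ y := fun y => rfl
  have hy₀R : y₀ ∈ R.source := hΘ₀.mem_toOpenPartialHomeomorph_source hLder (by simp)
  set U₁ := U ∩ (fderiv ℝ Θ) ⁻¹' (range ((↑) : (EuclideanSpace ℝ (Fin n) ≃L[ℝ]
    EuclideanSpace ℝ (Fin n)) → (EuclideanSpace ℝ (Fin n) →L[ℝ] EuclideanSpace ℝ (Fin n))))
    with hU₁def
  have hU₁ : IsOpen U₁ := (hΘ.continuousOn_fderiv_of_isOpen hU (by simp)).isOpen_inter_preimage hU
    ContinuousLinearEquiv.isOpen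
  have hO : IsOpen (R.target ∩ R.symm ⁻¹' U₁) := R.isOpen_inter_preimage_symm hU₁
  have hθ₀ : R.symm (R y₀) = y₀ := R.left_inv hy₀R
  have hw₀ : R y₀ ∈ R.target ∩ R.symm ⁻¹' U₁ := by
    refine ⟨R.map_source hy₀R, ?_⟩
    rw [mem_preimage, hθ₀]
    exact ⟨hy₀, L, hLcoe⟩
  have hθ : ContDiffOn ℝ ∞ R.symm (R.target ∩ R.symm ⁻¹' U₁) := by
    intro w hw
    obtain ⟨hw1, hw2, L', hL'⟩ := hw
    refine (R.contDiffAt_symm hw1 (f₀' := L') ?_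
      (hΘ.contDiffAt (hU.mem_nhds hw2))).contDiffWithinAt
    rw [hL']
    exact (differentiableAt_of_smoothOn hU hΘ hw2).hasFDerivAt
  have hmaps : MapsTo R.symm (R.target ∩ R.symm ⁻¹' U₁) U := fun w hw => hw.2.1
  have hgraph : ∀ w ∈ R.target ∩ R.symm ⁻¹' U₁, ∀ p i,
      inner ℝ (τ i) (pd (coordVec n p) (f ∘ R.symm) w) = if i = p then 1 else 0 := by
    intro w hw p i
    have h1 := (innerSL ℝ (τ i)).hasFDerivAt.comp w
      (differentiableAt_of_smoothOn hO (hf.comp hθ hmaps) hw).hasFDerivAt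
    have h2 : HasFDerivAt (fun z : EuclideanSpace ℝ (Fin n) => z i)
        (EuclideanSpace.proj i : EuclideanSpace ℝ (Fin n) →L[ℝ] ℝ) w :=
      (EuclideanSpace.proj i : EuclideanSpace ℝ (Fin n) →L[ℝ] ℝ).hasFDerivAt
    have h3 : (fun z : EuclideanSpace ℝ (Fin n) => z i)
        =ᶠ[𝓝 w] innerSL ℝ (τ i) ∘ (f ∘ R.symm) := by
      filter_upwards [hO.mem_nhds hw] with z hz
      have h4 := congrArg (fun v : EuclideanSpace ℝ (Fin n) => v i) (R.right_inv hz.1)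
      exact h4.symm
    have h5 := congrArg (fun A => A (coordVec n p)) ((h1.congr_of_eventuallyEq h3).unique h2)
    simp only [ContinuousLinearMap.comp_apply, innerSL_apply_apply] at h5
    rw [pd, h5]
    simp
  refine ⟨τ, _, R y₀, R.symm, ⟨fun i => ?_, fun i j hij => ?_⟩, hτν, hO, hw₀, hθ, hmaps, hθ₀, ?_,
    hgraph⟩
  · have h1 := hττ i i
    rw [real_inner_self_eq_norm_sq, if_pos rfl] at h1
    nlinarith [norm_nonneg (τ i)]
  · simpa [hij] using hττ i j
  -- `eᵀ g` is a left inverse of both `e` and the Jacobian of the inverse map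
  · have h1 : eᵀ * paramMetric (coordVec n) f y₀ * jacobian R.symm (R y₀) = 1 := by
      ext i p
      rw [Matrix.one_apply, ← hgraph _ hw₀ p i, pd_comp_coord hO hU hθ hmaps hf hw₀, inner_sum,
        Matrix.mul_apply]
      refine Finset.sum_congr rfl fun r _ => ?_
      rw [real_inner_smul_right, hθ₀, hN, mul_comm]
    have h2 := mul_eq_one_comm.1 he
    calc jacobian R.symm (R y₀)
        = (e * (eᵀ * paramMetric (coordVec n) f y₀)) * jacobian R.symm (R y₀) := by
          rw [h2, Matrix.one_mul]
      _ = e := by rw [Matrix.mul_assoc, h1, Matrix.mul_one]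

end GraphCoordinates

section MaximumPoint

open Matrix

variable {n k : ℕ} {ρ T : ℝ} {M : Type*} [TopologicalSpace M]
  [ChartedSpace (EuclideanSpace ℝ (Fin n)) M]

/-- Around every point, a hypersurface has a parametrization as a graph over its tangent space for
which the coordinate axes at the given point are principal directions. -/
lemma exists_principal_graph_parametrization [IsManifold (𝓡 n) ∞ M]
    {f ν : M → EuclideanSpace ℝ (Fin (n + 1))} (hf : ContMDiff (𝓡 n) (𝓡 (n + 1)) ∞ f)
    (himm : ∀ x, Function.Injective (mfderiv (𝓡 n) (𝓡 (n + 1)) f x))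
    (horth : ∀ (x : M) (v : TangentSpace (𝓡 n) x),
      inner (E := EuclideanSpace ℝ (Fin (n + 1))) ℝ
        (mfderiv (𝓡 n) (𝓡 (n + 1)) f x v) (ν x) = 0) (x₀ : M) :
    ∃ (χ : EuclideanSpace ℝ (Fin n) → M) (O : Set (EuclideanSpace ℝ (Fin n)))
      (y₀ : EuclideanSpace ℝ (Fin n)) (lam : Fin n → ℝ)
      (τ : Fin n → EuclideanSpace ℝ (Fin (n + 1))),
      IsOpen O ∧ y₀ ∈ O ∧ χ y₀ = x₀ ∧ ContMDiffOn (𝓡 n) (𝓡 n) ∞ χ O ∧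
      (∀ y ∈ O, Function.Injective (mfderiv (𝓡 n) (𝓡 n) χ y)) ∧ Orthonormal ℝ τ ∧
      (∀ i, inner ℝ (τ i) (ν x₀) = 0) ∧
      (∀ y ∈ O, ∀ p i, inner ℝ (τ i) (pd (coordVec n p) (f ∘ χ) y) = if i = p then 1 else 0) ∧
      paramSff (coordVec n) (f ∘ χ) (ν ∘ χ) y₀ = Matrix.diagonal lam := by
  set φ := extChartAt (𝓡 n) x₀ with hφ
  obtain ⟨e, lam, he, hlam⟩ := exists_frame_diagonalizing (posDef_inducedMetric hf x₀ (himm x₀))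
    (isSymm_secondFundamentalForm (ν := ν) hf x₀)
  rw [inducedMetric_eq, ← hφ] at he
  rw [secondFundamentalForm_eq, ← hφ] at hlam
  have htarget : IsOpen φ.target := isOpen_extChartAt_target x₀
  have hsymm : ContMDiffOn (𝓡 n) (𝓡 n) ∞ φ.symm φ.target := contMDiffOn_extChartAt_symm x₀
  have hfφ : ContDiffOn ℝ ∞ (f ∘ φ.symm) φ.target := smoothOn_comp_param hf hsymm
  have hmem : φ x₀ ∈ φ.target := mem_extChartAt_target x₀
  have hinv : φ.symm (φ x₀) = x₀ := extChartAt_to_inv x₀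
  have hn : ∀ p, inner ℝ (pd (coordVec n p) (f ∘ φ.symm) (φ x₀)) ((ν ∘ φ.symm) (φ x₀)) = 0 :=
    fun p => inner_pd_comp_param_normal hf htarget hsymm hmem horth _
  obtain ⟨τ, O, w₀, θ, hτ, hτν, hO, hw₀, hθ, hmaps, hθ₀, hJ, hgraph⟩ :=
    exists_graph_parametrization htarget hfφ hmem he hn
  have hχ : ContMDiffOn (𝓡 n) (𝓡 n) ∞ (φ.symm ∘ θ) O :=
    hsymm.comp (contMDiffOn_iff_contDiffOn.2 hθ) hmaps
  refine ⟨φ.symm ∘ θ, O, w₀, lam, τ, hO, hw₀, by rw [Function.comp_apply, hθ₀, hinv], hχ, ?_, hτ,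
    fun i => ?_, hgraph, ?_⟩
  -- the tangential part of the derivative of `f ∘ χ` is the identity
  · intro y hy
    suffices hinj : Function.Injective (fderiv ℝ (f ∘ (φ.symm ∘ θ)) y) from fun a b hab =>
      hinj ((fderiv_comp_param hf hO hχ hy a).trans ((congrArg _ hab).trans
        (fderiv_comp_param hf hO hχ hy b).symm))
    intro a b h1
    have h2 : ∀ (v : EuclideanSpace ℝ (Fin n)) i,
        inner ℝ (τ i) (fderiv ℝ (f ∘ (φ.symm ∘ θ)) y v) = v i := by
      intro v i
      conv_lhs => rw [euclidean_eq_sum v]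
      rw [map_sum, inner_sum]
      have h3 : ∀ p, inner ℝ (τ i) (fderiv ℝ (f ∘ (φ.symm ∘ θ)) y (v p • coordVec n p))
          = v p * if i = p then 1 else 0 := by
        intro p
        rw [map_smul, real_inner_smul_right]
        exact congrArg (v p * ·) (hgraph y hy p i)
      simp_rw [h3]
      simp
    ext i
    exact (h2 a i).symm.trans ((congrArg (inner ℝ (τ i)) h1).trans (h2 b i))
  · have := hτν i
    rwa [Function.comp_apply, hinv] at this
  · rw [← hθ₀] at hn hlam
    have h1 := paramSff_comp hO htarget hθ hmaps hfφ hw₀ (ν := ν ∘ φ.symm)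
      (ν' := ν ∘ φ.symm ∘ θ) rfl hn
    rw [hJ, hlam] at h1
    exact h1

lemma paramMetric_slice {Y V : Type*} [NormedAddCommGroup Y] [NormedSpace ℝ Y]
    [NormedAddCommGroup V] [InnerProductSpace ℝ V] {S : Set (Y × ℝ)} (hS : IsOpen S)
    {f : Y × ℝ → V} (hf : ContDiffOn ℝ ∞ f S) (b : Fin n → Y) {y : Y} {t : ℝ} (hy : (y, t) ∈ S) :
    paramMetric (fun p => (b p, (0 : ℝ))) f (y, t) = paramMetric b (fun y => f (y, t)) y := by
  ext p q
  simp only [paramMetric, Matrix.of_apply]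
  rw [pd_slice (differentiableAt_of_smoothOn hS hf hy),
    pd_slice (differentiableAt_of_smoothOn hS hf hy)]

lemma paramSff_slice {Y V : Type*} [NormedAddCommGroup Y] [NormedSpace ℝ Y]
    [NormedAddCommGroup V] [InnerProductSpace ℝ V] {S : Set (Y × ℝ)} (hS : IsOpen S)
    {f ν : Y × ℝ → V} (hf : ContDiffOn ℝ ∞ f S) (b : Fin n → Y) {y : Y} {t : ℝ}
    (hy : (y, t) ∈ S) :
    paramSff (fun p => (b p, (0 : ℝ))) f ν (y, t)
      = paramSff b (fun y => f (y, t)) (fun y => ν (y, t)) y := by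
  ext p q
  have hc : Continuous fun y : Y => (y, t) := by fun_prop
  have h1 : EqOn (pd (b q) fun y => f (y, t)) (fun y => pd (b q, (0 : ℝ)) f (y, t))
      ((fun y : Y => (y, t)) ⁻¹' S) := fun y hy =>
    pd_slice (differentiableAt_of_smoothOn hS hf hy) _
  simp only [paramSff, Matrix.of_apply]
  rw [pd_congr (hS.preimage hc) h1 _ hy,
    pd_slice (differentiableAt_of_smoothOn hS (pd_smoothOn hS hf _) hy)]

/-- At a spatial maximum point, at a positive time, of the ratio of mean curvature and speed, the
time derivative of this ratio is nonpositive. -/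
lemma IsGammaFlow.exists_hasDerivAt_nonpos [IsManifold (𝓡 n) ∞ M]
    {F ν : ℝ → M → EuclideanSpace ℝ (Fin (n + 1))} (h : IsGammaFlow k ρ T F ν) (hk : 1 ≤ k)
    (hkn : k ≤ n) (hρ : ρ ∈ Ioc (0 : ℝ) 1) {t₀ : ℝ} (ht₀ : t₀ ∈ Ioo 0 T) {x₀ : M}
    (hmax : ∀ x, meanCurvature (F t₀) (ν t₀) x / speed k ρ (F t₀) (ν t₀) x
      ≤ meanCurvature (F t₀) (ν t₀) x₀ / speed k ρ (F t₀) (ν t₀) x₀) :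
    ∃ d ≤ 0, HasDerivAt
      (fun t => meanCurvature (F t) (ν t) x₀ / speed k ρ (F t) (ν t) x₀) d t₀ := by
  have hIco : ∀ {t}, t ∈ Ioo 0 T → t ∈ Ico 0 T := fun ht => Ioo_subset_Ico_self ht
  have hGpos : ∀ t ∈ Ico 0 T, ∀ x, 0 < speed k ρ (F t) (ν t) x := fun t ht x =>
    gammaSpeed_pos hk hkn hρ (h.k_convex t ht x)
  obtain ⟨χ, O, y₀, lam, τ, hO, hy₀, hχ₀, hχ, hinj, hτ, hτν, hgraph, hdiag⟩ :=
    exists_principal_graph_parametrization (contMDiff_slice h.smooth (hIco ht₀))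
      (h.immersion t₀ (hIco ht₀)) (h.normal_orthogonal t₀ (hIco ht₀)) x₀
  set S : Set (EuclideanSpace ℝ (Fin n) × ℝ) := O ×ˢ Ioo 0 T with hSdef
  have hS : IsOpen S := hO.prod isOpen_Ioo
  have hsub : S ⊆ O ×ˢ Ico 0 T := prod_mono_right Ioo_subset_Ico_self
  set f : EuclideanSpace ℝ (Fin n) × ℝ → EuclideanSpace ℝ (Fin (n + 1)) :=
    fun z => F z.2 (χ z.1) with hfdef
  set N : EuclideanSpace ℝ (Fin n) × ℝ → EuclideanSpace ℝ (Fin (n + 1)) :=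
    fun z => ν z.2 (χ z.1) with hNdef
  set G : EuclideanSpace ℝ (Fin n) × ℝ → ℝ := fun z => speed k ρ (F z.2) (ν z.2) (χ z.1) with hGdef
  have hf' : ContDiffOn ℝ ∞ f (O ×ˢ Ico 0 T) := smoothOn_spacetime h.smooth hχ
  have hf : ContDiffOn ℝ ∞ f S := hf'.mono hsub
  have hN : ContDiffOn ℝ ∞ N S := (smoothOn_spacetime h.smooth_normal hχ).mono hsub
  obtain ⟨hG', hflow'⟩ := h.smoothOn_speed hO hχ
  have hG : ContDiffOn ℝ ∞ G S := hG'.mono hsub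
  have hmet : ∀ {y t}, (y, t) ∈ S → paramMetric (spaceVec n) f (y, t)
      = paramMetric (coordVec n) (F t ∘ χ) y := fun hy => paramMetric_slice hS hf (coordVec n) hy
  have hsff : ∀ {y t}, (y, t) ∈ S → paramSff (spaceVec n) f N (y, t)
      = paramSff (coordVec n) (F t ∘ χ) (ν t ∘ χ) y := fun hy =>
    paramSff_slice hS hf (coordVec n) hy
  have hchar : ∀ {y t}, (y, t) ∈ S → ((paramMetric (spaceVec n) f (y, t))⁻¹
      * paramSff (spaceVec n) f N (y, t)).charpoly
      = ((inducedMetric (F t) (χ y))⁻¹ * secondFundamentalForm (F t) (ν t) (χ y)).charpoly := by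
    intro y t hy
    rw [hmet hy, hsff hy]
    have ht := hIco hy.2
    exact charpoly_param (contMDiff_slice h.smooth ht) hO hχ hy.1 (h.immersion t ht _)
      (hinj y hy.1) (h.normal_orthogonal t ht)
  have htrace : ∀ {y t}, (y, t) ∈ S → ((paramMetric (spaceVec n) f (y, t))⁻¹
      * paramSff (spaceVec n) f N (y, t)).trace = meanCurvature (F t) (ν t) (χ y) := by
    intro y t hy
    rw [meanCurvature_eq_trace (contMDiff_slice h.smooth (hIco hy.2)) _
      (h.immersion t (hIco hy.2) _)]
    exact trace_congr_of_charpoly (hchar hy)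
  set m := meanCurvature (F t₀) (ν t₀) x₀ / speed k ρ (F t₀) (ν t₀) x₀ with hm
  have hz₀ : (y₀, t₀) ∈ S := ⟨hy₀, ht₀⟩
  obtain ⟨H', G', hH', hG', hle⟩ := local_maximum_principle hk hkn hρ hS hz₀ hf hN hG
    (fun z hz => h.norm_normal z.2 (hIco hz.2) _)
    (by
      rintro ⟨y, t⟩ hz p
      have h1 := pd_slice (differentiableAt_of_smoothOn hS hf hz) (coordVec n p)
      rw [spaceVec, ← h1]
      exact inner_pd_comp_param_normal (contMDiff_slice h.smooth (hIco hz.2)) hO hχ hz.1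
        (h.normal_orthogonal t (hIco hz.2)) _)
    (by
      intro z hz
      have h1 := hflow' z (hsub hz)
      rwa [fderivWithin_of_mem_nhds (mem_of_superset (hS.mem_nhds hz) hsub)] at h1)
    hτ (by simpa only [hNdef, hχ₀] using hτν)
    (by
      intro y hy p i
      have h1 := pd_slice (differentiableAt_of_smoothOn hS hf hy) (coordVec n p)
      rw [spaceVec, ← h1]
      exact hgraph y hy.1 p i)
    ((hsff hz₀).trans hdiag)
    (by
      rintro ⟨y, t⟩ hz
      obtain ⟨μ, hμ⟩ := exists_charpoly_eq_diagonal (ν := ν t)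
        (contMDiff_slice h.smooth (hIco hz.2)) (χ y) (h.immersion t (hIco hz.2) _)
      exact ⟨μ, (hchar hz).trans hμ⟩)
    (by
      rintro ⟨y, t⟩ hz
      rw [sortedEigenvalues_congr (hchar hz)]
      exact h.k_convex t (hIco hz.2) _)
    (by
      rintro ⟨y, t⟩ hz
      rw [gammaMatrix_congr (hchar hz)]
      rfl)
    (m := m)
    (by
      intro y hy
      rw [htrace hy]
      exact (div_le_iff₀ (hGpos t₀ (hIco ht₀) _)).1 (hmax (χ y)))
    (by
      rw [htrace hz₀, hχ₀]
      simp only [hGdef, hχ₀]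
      exact (div_mul_cancel₀ _ (hGpos t₀ (hIco ht₀) _).ne').symm)
  have hev : ∀ᶠ s in 𝓝 (0 : ℝ), (y₀, t₀ + s) ∈ S := by
    have hc : ContinuousAt (fun s : ℝ => (y₀, t₀ + s)) 0 := by fun_prop
    exact hc.eventually_mem (hS.mem_nhds (by simpa using hz₀))
  have hH : HasDerivAt (fun s => meanCurvature (F (t₀ + s)) (ν (t₀ + s)) x₀) H' 0 := by
    refine hH'.congr_of_eventuallyEq ?_
    filter_upwards [hev] with s hs
    rw [htrace hs, hχ₀]
  have hG₁ : HasDerivAt (fun s => speed k ρ (F (t₀ + s)) (ν (t₀ + s)) x₀) G' 0 := by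
    simpa only [hGdef, hχ₀] using hG'
  have hpos : 0 < speed k ρ (F (t₀ + 0)) (ν (t₀ + 0)) x₀ := by
    rw [add_zero]
    exact hGpos t₀ (hIco ht₀) x₀
  have hq := hH.fun_div hG₁ hpos.ne'
  rw [add_zero] at hq hpos
  have hd := HasDerivAt.comp_const_add (-t₀) t₀ (f := fun s =>
    meanCurvature (F (t₀ + s)) (ν (t₀ + s)) x₀ / speed k ρ (F (t₀ + s)) (ν (t₀ + s)) x₀)
    (f' := (H' * speed k ρ (F t₀) (ν t₀) x₀ - meanCurvature (F t₀) (ν t₀) x₀ * G')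
      / speed k ρ (F t₀) (ν t₀) x₀ ^ 2) (by rwa [neg_add_cancel])
  simp only [add_neg_cancel_left] at hd
  refine ⟨_, ?_, hd⟩
  have hnum : H' * speed k ρ (F t₀) (ν t₀) x₀ - meanCurvature (F t₀) (ν t₀) x₀ * G' ≤ 0 := by
    have h1 : meanCurvature (F t₀) (ν t₀) x₀ = m * speed k ρ (F t₀) (ν t₀) x₀ :=
      (div_mul_cancel₀ _ hpos.ne').symm
    rw [h1]
    nlinarith
  exact div_nonpos_of_nonpos_of_nonneg hnum (by positivity)

end MaximumPoint

/-! ### Monotonicity of the maximum -/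

/-- If the time derivative of `w` is nonpositive at all spatial maximum points at positive times,
then the spatial maximum of `w` is nonincreasing. -/
lemma exists_isGreatest_antitoneOn {X : Type*} [TopologicalSpace X] [CompactSpace X] [Nonempty X]
    {T : ℝ} {w : X → ℝ → ℝ}
    (hw : ContinuousOn (fun p : X × ℝ => w p.1 p.2) (univ ×ˢ Ico 0 T))
    (hmax : ∀ t₀ ∈ Ioo 0 T, ∀ x₀, (∀ x, w x t₀ ≤ w x₀ t₀) →
      ∃ d ≤ 0, HasDerivAt (w x₀) d t₀) :
    ∃ m : ℝ → ℝ, (∀ t ∈ Ico 0 T, IsGreatest (range fun x => w x t) (m t)) ∧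
      AntitoneOn m (Ico 0 T) := by
  have hex : ∀ t ∈ Ico 0 T, ∃ x, ∀ y, w y t ≤ w x t := by
    intro t ht
    have hc : Continuous fun x => w x t := by
      rw [← continuousOn_univ]
      exact hw.comp (by fun_prop : Continuous fun x : X => (x, t)).continuousOn
        fun x _ => ⟨mem_univ _, ht⟩
    obtain ⟨x, -, hx⟩ := isCompact_univ.exists_isMaxOn univ_nonempty hc.continuousOn
    exact ⟨x, fun y => hx (mem_univ y)⟩
  choose! xm hxm using hex
  refine ⟨fun t => w (xm t) t, fun t ht => ⟨⟨xm t, rfl⟩, ?_⟩, ?_⟩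
  · rintro _ ⟨y, rfl⟩
    exact hxm t ht y
  intro t₁ ht₁ t₂ ht₂ h12
  by_contra! hlt
  have hne : t₁ < t₂ := lt_of_le_of_ne h12 fun h => by subst h; exact lt_irrefl _ hlt
  -- subtracting a small multiple of time makes the time derivative negative, and keeps the maximum
  -- over `[t₁, t₂]` away from the initial time
  set ε := (w (xm t₂) t₂ - w (xm t₁) t₁) / (2 * (t₂ - t₁)) with hε
  have hεpos : 0 < ε := div_pos (sub_pos.2 hlt) (by linarith)
  have hεeq : 2 * (ε * (t₂ - t₁)) = w (xm t₂) t₂ - w (xm t₁) t₁ := by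
    rw [hε]
    field_simp [(sub_pos.2 hne).ne']
  have hsub : Icc t₁ t₂ ⊆ Ico 0 T := fun t ht => ⟨ht₁.1.trans ht.1, ht.2.trans_lt ht₂.2⟩
  have hv : ContinuousOn (fun p : X × ℝ => w p.1 p.2 - ε * (p.2 - t₁)) (univ ×ˢ Icc t₁ t₂) :=
    (hw.mono (prod_mono_right hsub)).sub (by fun_prop)
  obtain ⟨⟨x₀, t₀⟩, ⟨-, ht₀⟩, hm⟩ := (isCompact_univ.prod isCompact_Icc).exists_isMaxOn
    ⟨(xm t₂, t₂), mem_univ _, h12, le_rfl⟩ hv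
  have hle : ∀ x, ∀ t ∈ Icc t₁ t₂, w x t - ε * (t - t₁) ≤ w x₀ t₀ - ε * (t₀ - t₁) :=
    fun x t ht => hm (show (x, t) ∈ univ ×ˢ Icc t₁ t₂ from ⟨mem_univ _, ht⟩)
  have h1 := hle (xm t₂) t₂ ⟨h12, le_rfl⟩
  have h01 : t₁ < t₀ := by
    refine lt_of_le_of_ne ht₀.1 fun h => ?_
    have h2 := hxm t₁ ht₁ x₀
    rw [← h] at h1
    have h3 := mul_pos hεpos (sub_pos.2 hne)
    linarith
  obtain ⟨d, hd, hder⟩ := hmax t₀ ⟨ht₁.1.trans_lt h01, ht₀.2.trans_lt ht₂.2⟩ x₀ fun x => by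
    have := hle x t₀ ht₀
    linarith
  have hder' : HasDerivAt (fun t => w x₀ t - ε * (t - t₁)) (d - ε) t₀ := by
    have h2 := hder.sub (((hasDerivAt_id t₀).sub_const t₁).const_mul ε)
    rw [mul_one] at h2
    exact h2
  have hslope := ((hasDerivAt_iff_tendsto_slope.1 hder').mono_left
    (nhdsWithin_mono t₀ (s := Iio t₀) fun s hs => (mem_Iio.1 hs).ne)).eventually_lt_const
    (show d - ε < 0 by linarith)
  obtain ⟨s, hs1, hs2⟩ := (hslope.and (Ioo_mem_nhdsLT h01)).exists
  rw [slope_def_field] at hs1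
  have h3 := hle x₀ s ⟨hs2.1.le, hs2.2.le.trans ht₀.2⟩
  have h4 := div_nonneg_of_nonpos (sub_nonpos.2 h3) (sub_nonpos.2 hs2.2.le)
  linarith

/-! ### Consequences of the bound on `H / G₁` -/

section Consequences

open Matrix

variable {n k : ℕ} {ρ T : ℝ} {z : Fin n → ℝ}

/-- `H / G_ρ` is an increasing affine function of `H / G₁`. -/
lemma sum_div_gammaSpeed (hk : 1 ≤ k) (hkn : k ≤ n) (hz : z ∈ kPositiveCone n k) :
    (∑ i, z i) / gammaSpeed k ρ z = ρ * ((∑ i, z i) / gammaSpeed k 1 z) + (1 - ρ) := by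
  have hH := (sum_pos_of_mem_cone hk hkn hz).ne'
  simp only [gammaSpeed, div_inv_eq_mul, sub_self, zero_div, add_zero, mul_add]
  congr 1
  · simp only [Finset.mul_sum]
    exact Finset.sum_congr rfl fun s _ => by ring
  · field_simp

/-- The constant of uniform `k`-convexity, `1 / a`. The value for `a ≤ 0`, which is not an upper bound
for `H / G₁`, only serves to make it positive throughout. -/
def convexityConstant (a : ℝ) : ℝ := if 0 < a then 1 / a else 1

lemma convexityConstant_pos (a : ℝ) : 0 < convexityConstant a := by
  unfold convexityConstant
  split_ifs with h
  · positivity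
  · exact one_pos

/-- Each of the terms of `H / G₁ = ∑ H / (z_{i₁} + ⋯ + z_{i_k})` is at most the sum. -/
lemma convexityConstant_mul_sum_le (hk : 1 ≤ k) (hkn : k ≤ n) (hz : z ∈ kPositiveCone n k) {a : ℝ}
    (ha : (∑ i, z i) / gammaSpeed k 1 z ≤ a) {s : Finset (Fin n)} (hs : s.card = k) :
    convexityConstant a * ∑ i, z i ≤ ∑ i ∈ s, z i := by
  have hH := sum_pos_of_mem_cone hk hkn hz
  have hσ := hz s hs
  have h1 : (∑ i, z i) / ∑ i ∈ s, z i ≤ a := by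
    refine le_trans ?_ ha
    simp only [gammaSpeed, div_inv_eq_mul, sub_self, zero_div, add_zero, Finset.mul_sum,
      mul_one_div]
    exact Finset.single_le_sum (f := fun s => (∑ i, z i) / ∑ i ∈ s, z i)
      (fun t ht => (div_pos hH (sum_pos_of_mem_powersetCard hz ht)).le)
      (Finset.mem_powersetCard.2 ⟨Finset.subset_univ s, hs⟩)
  have hapos : 0 < a := (div_pos hH hσ).trans_le h1
  rw [convexityConstant, if_pos hapos, one_div_mul_eq_div, div_le_iff₀ hapos, mul_comm]
  exact (div_le_iff₀ hσ).1 h1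

/-- The derivative of `γ_{k,ρ}` at a symmetric matrix `Z = U diag(μ) Uᵀ` is
`U diag(∂γ/∂μ) Uᵀ`, so bounds for the partial derivatives bound it as a quadratic form. -/
lemma exists_isSymmDerivative_gammaMatrix (hk : 1 ≤ k) (hkn : k ≤ n) (hρ : ρ ∈ Ioc (0 : ℝ) 1)
    {Z : Matrix (Fin n) (Fin n) ℝ} (hZ : Z.IsSymm)
    (hcone : sortedEigenvalues Z ∈ kPositiveCone n k) {c : ℝ} (hc : 0 < c)
    (hcz : ∀ s : Finset (Fin n), s.card = k →
      c * ∑ i, sortedEigenvalues Z i ≤ ∑ i ∈ s, sortedEigenvalues Z i) :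
    ∃ D : Matrix (Fin n) (Fin n) ℝ, IsSymmDerivative (gammaMatrix k ρ) Z D ∧
      ∀ ξ : Fin n → ℝ, (gradBound n k c)⁻¹ * ∑ p, ξ p ^ 2 ≤ ∑ p, ∑ q, D p q * ξ p * ξ q ∧
        ∑ p, ∑ q, D p q * ξ p * ξ q ≤ gradBound n k c * ∑ p, ξ p ^ 2 := by
  obtain ⟨U, μ, hU, hU', hZμ⟩ := exists_orthogonal_diagonalization hZ
  have hch : Z.charpoly = (Matrix.diagonal μ).charpoly := by
    rw [hZμ]
    exact charpoly_conj_of_mul_eq_one hU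
  have hμ : μ ∈ kPositiveCone n k := (sortedEigenvalues_mem_cone_iff hch).1 hcone
  obtain ⟨π, hπ⟩ := exists_perm_sortedEigenvalues hch
  have hcμ : ∀ s : Finset (Fin n), s.card = k → c * ∑ i, μ i ≤ ∑ i ∈ s, μ i := by
    intro s hs
    have h1 := hcz (s.map π.symm.toEmbedding) (by rw [Finset.card_map, hs])
    rw [hπ, Finset.sum_map] at h1
    simpa [Function.comp_apply, Equiv.sum_comp π μ] using h1
  have hb := gammaGrad_bounds hk hkn hρ hμ hc hcμ
  set a := gammaGrad k ρ μ with ha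
  have hquad : ∀ B : Matrix (Fin n) (Fin n) ℝ,
      ∑ p, ∑ q, (U * Matrix.diagonal a * Uᵀ) p q * B p q = ∑ i, a i * (Uᵀ * B * U) i i := by
    intro B
    have hent : ∀ p q, (U * Matrix.diagonal a * Uᵀ) p q = ∑ i, U p i * a i * U q i := by
      intro p q
      rw [Matrix.mul_apply]
      simp only [Matrix.mul_diagonal, Matrix.transpose_apply]
    simp only [hent, Matrix.mul_apply, Matrix.transpose_apply, Finset.sum_mul, Finset.mul_sum]
    calc ∑ p, ∑ q, ∑ i, U p i * a i * U q i * B p q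
        = ∑ p, ∑ i, ∑ q, U p i * a i * U q i * B p q :=
          Finset.sum_congr rfl fun p _ => Finset.sum_comm
      _ = ∑ i, ∑ p, ∑ q, U p i * a i * U q i * B p q := Finset.sum_comm
      _ = ∑ i, ∑ q, ∑ p, U p i * a i * U q i * B p q :=
          Finset.sum_congr rfl fun i _ => Finset.sum_comm
      _ = _ := Finset.sum_congr rfl fun i _ => Finset.sum_congr rfl fun q _ =>
          Finset.sum_congr rfl fun p _ => by ring
  refine ⟨U * Matrix.diagonal a * Uᵀ, ⟨?_, fun B hB => ?_⟩, fun ξ => ?_⟩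
  · rw [Matrix.IsSymm, Matrix.transpose_mul, Matrix.transpose_mul, Matrix.transpose_transpose,
      Matrix.diagonal_transpose, Matrix.mul_assoc]
  · rw [hquad]
    refine hasDerivAt_gammaMatrix hk hkn hρ hU hμ (W := fun s => Z + s • B) (by simpa using hZμ)
      (fun i j => ?_) hB (Eventually.of_forall fun s => ?_)
    · simpa using ((hasDerivAt_id (0 : ℝ)).mul_const (B i j)).const_add (Z i j)
    · have hs : (Z + s • B).IsSymm := hZ.add (hB.smul s)
      obtain ⟨V, η, hV, -, hη⟩ := exists_orthogonal_diagonalization hs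
      exact ⟨η, by rw [hη]; exact charpoly_conj_of_mul_eq_one hV⟩
  · have h1 : ∑ p, ∑ q, (U * Matrix.diagonal a * Uᵀ) p q * ξ p * ξ q
        = ∑ i, a i * ((Uᵀ *ᵥ ξ) i) ^ 2 := by
      have h2 := hquad (Matrix.of fun p q => ξ p * ξ q)
      simp only [Matrix.of_apply, ← mul_assoc] at h2
      rw [h2]
      refine Finset.sum_congr rfl fun i _ => ?_
      congr 1
      simp only [Matrix.mul_apply, Matrix.transpose_apply, Matrix.of_apply, Matrix.mulVec,
        dotProduct, sq, Finset.sum_mul, Finset.mul_sum]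
      exact Finset.sum_congr rfl fun p _ => Finset.sum_congr rfl fun q _ => by ring
    have h2 : ∑ i, ((Uᵀ *ᵥ ξ) i) ^ 2 = ∑ p, ξ p ^ 2 := by
      have h3 : (Uᵀ *ᵥ ξ) ⬝ᵥ (Uᵀ *ᵥ ξ) = ξ ⬝ᵥ ξ := by
        rw [Matrix.dotProduct_mulVec, Matrix.vecMul_transpose, Matrix.mulVec_mulVec, hU',
          Matrix.one_mulVec]
      simpa only [dotProduct, ← sq] using h3
    rw [h1, ← h2, Finset.mul_sum, Finset.mul_sum]
    exact ⟨Finset.sum_le_sum fun i _ => mul_le_mul_of_nonneg_right (hb i).1 (sq_nonneg _),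
      Finset.sum_le_sum fun i _ => mul_le_mul_of_nonneg_right (hb i).2 (sq_nonneg _)⟩

end Consequences

end

theorem mainTheorem7 (n k : ℕ) (hn : 4 ≤ n) (hk : 3 ≤ k) (hkn : k ≤ n - 1) :
    -- `c a` and `C a`: constants depending only on `n`, `k` and `a`
    ∃ c C : ℝ → ℝ, (∀ a, 0 < c a) ∧ (∀ a, 0 < C a) ∧
    ∀ (M : Type*) [TopologicalSpace M] [ChartedSpace (EuclideanSpace ℝ (Fin n)) M]
      [IsManifold (𝓡 n) ∞ M] [CompactSpace M] [T2Space M] [Nonempty M]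
      (F₀ ν₀ : M → EuclideanSpace ℝ (Fin (n + 1))),
    -- `α` depends only on `n`, `k` and the initial hypersurface
    ∃ α : ℝ, ∀ ρ ∈ Ioc (0 : ℝ) 1, ∀ (T : ℝ) (F ν : ℝ → M → EuclideanSpace ℝ (Fin (n + 1))),
      0 < T → IsGammaFlow k ρ T F ν → F 0 = F₀ → ν 0 = ν₀ →
      -- the maximum of `H / G_ρ` over `M_t` exists and is nonincreasing in time
      (∃ m : ℝ → ℝ,
        (∀ t ∈ Ico 0 T, IsGreatest
          (range fun x => meanCurvature (F t) (ν t) x / speed k ρ (F t) (ν t) x) (m t)) ∧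
        AntitoneOn m (Ico 0 T)) ∧
      ∀ t ∈ Ico 0 T, ∀ x : M,
        -- scale-invariant bound, uniformly in `ρ`
        meanCurvature (F t) (ν t) x / speed k 1 (F t) (ν t) x ≤ α ∧
        -- uniform `k`-convexity
        0 < meanCurvature (F t) (ν t) x ∧
        c α ≤ (∑ i : Fin n with i.val < k, principalCurvatures (F t) (ν t) x i) /
          meanCurvature (F t) (ν t) x ∧
        -- uniform parabolicity
        ∀ Z : Matrix (Fin n) (Fin n) ℝ, IsFrameSecondFundamentalForm (F t) (ν t) x Z →
          ∃ D : Matrix (Fin n) (Fin n) ℝ, IsSymmDerivative (gammaMatrix k ρ) Z D ∧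
            ∀ ξ : Fin n → ℝ, (C α)⁻¹ * ∑ p, ξ p ^ 2 ≤ ∑ p, ∑ q, D p q * ξ p * ξ q ∧
              ∑ p, ∑ q, D p q * ξ p * ξ q ≤ C α * ∑ p, ξ p ^ 2 := by
  have hk' : 1 ≤ k := by omega
  have hkn' : k ≤ n := by omega
  refine ⟨convexityConstant, fun a => gradBound n k (convexityConstant a), convexityConstant_pos,
    fun a => gradBound_pos n k (convexityConstant_pos a), ?_⟩
  intro M _ _ _ _ _ _ F₀ ν₀
  refine ⟨sSup (range fun x => meanCurvature F₀ ν₀ x / speed k 1 F₀ ν₀ x), ?_⟩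
  intro ρ hρ T F ν hT h hF₀ hν₀
  set α := sSup (range fun x => meanCurvature F₀ ν₀ x / speed k 1 F₀ ν₀ x) with hα
  have hpos : ∀ p ∈ (univ : Set M) ×ˢ Ico 0 T, speed k ρ (F p.2) (ν p.2) p.1 ≠ 0 := fun p hp =>
    (gammaSpeed_pos hk' hkn' hρ (h.k_convex p.2 hp.2 p.1)).ne'
  obtain ⟨m, hm, hanti⟩ := exists_isGreatest_antitoneOn
    (w := fun x t => meanCurvature (F t) (ν t) x / speed k ρ (F t) (ν t) x)
    (h.continuousOn_meanCurvature.div h.continuousOn_speed hpos)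
    fun t₀ ht₀ x₀ hx₀ => h.exists_hasDerivAt_nonpos hk' hkn' hρ ht₀ hx₀
  refine ⟨⟨m, hm, hanti⟩, fun t ht x => ?_⟩
  have hcone := h.k_convex t ht x
  have h0 : (0 : ℝ) ∈ Ico 0 T := ⟨le_rfl, hT⟩
  have hratio : ∀ t ∈ Ico 0 T, ∀ x, meanCurvature (F t) (ν t) x / speed k ρ (F t) (ν t) x
      = ρ * (meanCurvature (F t) (ν t) x / speed k 1 (F t) (ν t) x) + (1 - ρ) :=
    fun t ht x => sum_div_gammaSpeed hk' hkn' (h.k_convex t ht x)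
  -- `H / G_ρ` and `H / G₁` have the same maximum points. In particular `H / G₁` is bounded at the
  -- initial time, so that the supremum `α` is a genuine one.
  have hbound : meanCurvature (F t) (ν t) x / speed k 1 (F t) (ν t) x ≤ α := by
    obtain ⟨x₁, hx₁⟩ := (hm 0 h0).1
    have hle : ∀ t ∈ Ico 0 T, ∀ y, meanCurvature (F t) (ν t) y / speed k 1 (F t) (ν t) y
        ≤ meanCurvature (F 0) (ν 0) x₁ / speed k 1 (F 0) (ν 0) x₁ := by
      intro t ht y
      have h1 := ((hm t ht).2 ⟨y, rfl⟩).trans ((hanti h0 ht ht.1).trans hx₁.ge)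
      simp only [hratio t ht y, hratio 0 h0 x₁] at h1
      exact le_of_mul_le_mul_left (by linarith) hρ.1
    refine (hle t ht x).trans ?_
    rw [hα, ← hF₀, ← hν₀]
    exact le_csSup ⟨_, by rintro _ ⟨y, rfl⟩; exact hle 0 h0 y⟩ ⟨x₁, rfl⟩
  have hH : 0 < meanCurvature (F t) (ν t) x := sum_pos_of_mem_cone hk' hkn' hcone
  have hsum : ∀ s : Finset (Fin n), s.card = k →
      convexityConstant α * ∑ i, principalCurvatures (F t) (ν t) x i
        ≤ ∑ i ∈ s, principalCurvatures (F t) (ν t) x i :=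
    fun s hs => convexityConstant_mul_sum_le hk' hkn' hcone hbound hs
  refine ⟨hbound, hH, ?_, ?_⟩
  · rw [le_div_iff₀ hH]
    exact hsum _ (Fin.card_filter_val_lt.trans (min_eq_right hkn'))
  · rintro Z ⟨e, he, rfl⟩
    have hsymm := isSymm_secondFundamentalForm (ν := ν t) (contMDiff_slice h.smooth ht) x
    have hch := charpoly_inv_mul_eq_of_frame (h := secondFundamentalForm (F t) (ν t) x) he
    have heig : sortedEigenvalues (e.transpose * secondFundamentalForm (F t) (ν t) x * e)
        = principalCurvatures (F t) (ν t) x := (sortedEigenvalues_congr hch).symm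
    refine exists_isSymmDerivative_gammaMatrix hk' hkn' hρ ?_ (by rwa [heig])
      (convexityConstant_pos α) (by rwa [heig])
    rw [Matrix.IsSymm, Matrix.transpose_mul, Matrix.transpose_mul, Matrix.transpose_transpose,
      hsymm, Matrix.mul_assoc]
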